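/- Let $V$ be an $n$-dimensional vector space over the finite field $\mathbb{F}_q$, and for a subspace $W$ of $V$ let ${W \brack m}$ denote the family of all $m$-dimensional subspaces of $W$. A family $\mathcal{F}\subseteq {V\brack k}$ is called $t$-intersecting if $\dim(F_1\cap F_2)\ge t$ for all $F_1,F_2\in\mathcal{F}$, and almost $t$-intersecting if for each $F\in\mathcal{F}$ there is at most one $F'\in\mathcal{F}$ with $\dim(F\cap F')<t$. Write $\delta$ for the Kronecker delta. Let $n,k,t$ be positive integers with $k\ge t+1\ge 3$ and $$n\ge 2k+t+\delta_{2,q}+\delta_{k,t+1}(1-2t-\delta_{2,q}).$$ Suppose that $\mathcal{F}\subseteq{V\brack k}$ is almost $t$-intersecting but not $t$-intersecting, and that $\mathcal{F}$ has the maximum size among all such families. Then one of the following holds. (i) $(k,q)\ne(t+1,2)$, and there are $U_1,U_2\in{V\brack k}$ and $E\in{U_1\brack t}$ with $U_1\cap U_2\in{E\brack t-1}$ such that $$\mathcal{F}=\left\{F\in{V\brack k}: E\subseteq F,\ \dim(F\cap U_2)\ge t\right\}\cup\{U_1,U_2\}.$$ (ii) $(k,q)\in\{(t+1,2),(t+1,3)\}$,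 and there are $U_1,U_2,U_3,U_4\in{V\brack t+1}$ with $U_1\cap U_2=U_3\cap U_4\in{V\brack t-1}$ and $\dim(U_i\cap U_j)=t$ for all $i\in\{1,2\}$, $j\in\{3,4\}$ such that $$\mathcal{F}=\left\{U_1,\ U_2,\ U_3,\ U_4,\ (U_3\cap U_1)+(U_4\cap U_2),\ (U_4\cap U_1)+(U_3\cap U_2)\right\}.$$ -/

import Mathlib

namespace AlmostIntersecting

/-- The Kronecker delta on natural numbers, with integer values. -/
def delta (a b : ℕ) : ℤ := if a = b then 1 else 0

section

variable {K V : Type*} [Field K] [AddCommGroup V] [Module K V]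

/-- The family of all `m`-dimensional subspaces of the subspace `W` of `V`. -/
def subspacesOf (W : Submodule K V) (m : ℕ) : Set (Submodule K V) :=
  {F | F ≤ W ∧ Module.finrank K F = m}

variable (K V) in
/-- The family of all `m`-dimensional subspaces of `V`. -/
def subspaces (m : ℕ) : Set (Submodule K V) := subspacesOf (⊤ : Submodule K V) m

/-- Any two members of `𝓕` meet in dimension at least `t`. -/
def IsTIntersecting (t : ℕ) (𝓕 : Set (Submodule K V)) : Prop :=
  ∀ F₁ ∈ 𝓕, ∀ F₂ ∈ 𝓕, t ≤ Module.finrank K ↥(F₁ ⊓ F₂)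

/-- For each member `F` of `𝓕` there is at most one member of `𝓕` that meets `F` in dimension
less than `t`. -/
def IsAlmostTIntersecting (t : ℕ) (𝓕 : Set (Submodule K V)) : Prop :=
  ∀ F ∈ 𝓕, {F' ∈ 𝓕 | Module.finrank K ↥(F ⊓ F') < t}.Subsingleton

/-- `𝓕` is an almost `t`-intersecting family of `k`-subspaces which is not `t`-intersecting. -/
def IsProperAlmost (k t : ℕ) (𝓕 : Set (Submodule K V)) : Prop :=
  𝓕 ⊆ subspaces K V k ∧ IsAlmostTIntersecting t 𝓕 ∧ ¬ IsTIntersecting t 𝓕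

/-- `𝓕` has the maximum size among all almost `t`-intersecting families of `k`-subspaces which are
not `t`-intersecting. Over a finite field and in finite dimension all families are finite. -/
def IsMaximumProperAlmost (k t : ℕ) (𝓕 : Set (Submodule K V)) : Prop :=
  IsProperAlmost k t 𝓕 ∧ ∀ 𝓖 : Set (Submodule K V), IsProperAlmost k t 𝓖 → 𝓖.ncard ≤ 𝓕.ncard

/-- The family `𝓗(U₁, U₂, E)`. -/
def familyH (k t : ℕ) (U₁ U₂ E : Submodule K V) : Set (Submodule K V) :=
  {F ∈ subspaces K V k | E ≤ F ∧ t ≤ Module.finrank K ↥(F ⊓ U₂)} ∪ {U₁, U₂}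

/-- The family `𝓖(U₁, U₂, U₃, U₄)`. -/
def familyG (U₁ U₂ U₃ U₄ : Submodule K V) : Set (Submodule K V) :=
  {U₁, U₂, U₃, U₄, (U₃ ⊓ U₁) ⊔ (U₄ ⊓ U₂), (U₄ ⊓ U₁) ⊔ (U₃ ⊓ U₂)}

end

end AlmostIntersecting

/-!
A member of `𝓕` with a partner that it meets in dimension less than `t` yields a pair `U₁, U₂` which
every other member meets in dimension at least `t`.

Let `k ≥ t + 2`. If all members other than `U₁, U₂` contain a common `t`-space `E` of `U₁`, say,
then `𝓕` lies in a family `familyH k t U₁ U₂ E`, and maximality gives equality. Otherwise choose a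
smallest space `S` meeting `U₁`, `U₂` and all but at most one member of `𝓕` in dimension at least
`t`; it has dimension greater than `t`. Almost every member meets `S` in a `t`-space, and a space
`R` that is not a `t`-cover can be enlarged inside members: all members above `R`, up to one,
contain one of few spaces of dimension `dim R + 1`. Iterating this bounds `𝓕.ncard` by a sum of
numbers of `k`-spaces through a fixed space, with one bound for each of `dim S = t + 1`,
`dim S = t + 2` and `dim S ≥ t + 3`. For `n` as large as assumed these bounds are below the size of
`familyH`, which is estimated from below by the Bonferroni inequality.

Let `k = t + 1`. Each further member is the span of its traces on `U₁` and `U₂`, and two of them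
that meet in dimension at least `t` share a trace. If any two further members share a trace, all of
them share the same one, so `𝓕` is a `familyH`, of size `q + 3`; if two do not, they form a grid
with `U₁, U₂` and `𝓕` is a `familyG`, of size `6`. Maximality decides between `q + 3` and `6`.
-/

namespace AlmostIntersecting

open Submodule

variable {K V : Type*} [Field K] [AddCommGroup V] [Module K V]

/-! ### Subspaces and their number -/

section Dimension

/-- The dimension of a subspace. -/
noncomputable abbrev dim (A : Submodule K V) : ℕ := Module.finrank K A

/-- The `m`-dimensional subspaces between `A` and `B`. -/
def subspacesBetween (A B : Submodule K V) (m : ℕ) : Set (Submodule K V) :=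
  {C | A ≤ C ∧ C ≤ B ∧ dim C = m}

/-- The subspaces of `B` that contain `A` with codimension one; they are the points of the
projective space of `B ⧸ A`. -/
def extensions (A B : Submodule K V) : Set (Submodule K V) := subspacesBetween A B (dim A + 1)

lemma mem_subspaces {k : ℕ} {F : Submodule K V} : F ∈ subspaces K V k ↔ dim F = k := by
  simp [subspaces, subspacesOf]

lemma dim_bot : dim (⊥ : Submodule K V) = 0 := finrank_bot K V

lemma dim_top : dim (⊤ : Submodule K V) = Module.finrank K V := finrank_top K V

variable [FiniteDimensional K V] {A B R U : Submodule K V}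

lemma dim_mono (h : A ≤ B) : dim A ≤ dim B := finrank_mono h

lemma dim_sup_add_dim_inf (A B : Submodule K V) : dim (A ⊔ B) + dim (A ⊓ B) = dim A + dim B :=
  finrank_sup_add_finrank_inf_eq A B

lemma exists_mem_subspacesBetween (h : A ≤ B) {m : ℕ} (hA : dim A ≤ m) (hB : m ≤ dim B) :
    ∃ C, C ∈ subspacesBetween A B m := by
  induction m, hA using Nat.le_induction with
  | base => exact ⟨A, le_rfl, h, rfl⟩
  | succ m _ ih =>
    obtain ⟨C, hAC, hCB, hC⟩ := ih (by omega)
    obtain ⟨v, hvB, hvC⟩ := SetLike.exists_of_lt (hCB.lt_of_ne (by rintro rfl; omega))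
    refine ⟨C ⊔ K ∙ v, hAC.trans le_sup_left, sup_le hCB ?_, ?_⟩
    · rwa [span_singleton_le_iff_mem]
    · rw [dim, finrank_sup_span_singleton hvC, ← hC]

lemma exists_le_dim_eq {m : ℕ} (hB : m ≤ dim B) : ∃ C ≤ B, dim C = m := by
  obtain ⟨C, -, hC⟩ := exists_mem_subspacesBetween (bot_le : ⊥ ≤ B) (m := m)
    (by rw [dim_bot]; omega) hB
  exact ⟨C, hC⟩

lemma dim_inf_sup_add_dim_inf (h : A ≤ B) (C : Submodule K V) :
    dim (B ⊓ (A ⊔ C)) + dim (A ⊓ C) = dim A + dim (B ⊓ C) := by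
  have hmod : B ⊓ (A ⊔ C) = A ⊔ B ⊓ C := by
    rw [inf_comm, inf_comm B C, sup_inf_assoc_of_le C h]
  have hinf : A ⊓ (B ⊓ C) = A ⊓ C := by rw [← inf_assoc, inf_eq_left.2 h]
  rw [hmod, ← hinf]
  exact dim_sup_add_dim_inf A (B ⊓ C)

/-- Every `F` above `R` with `dim (F ⊓ U) ≥ t` meets `R ⊔ U` in a space so large that it
meets any `M` of the stated dimension in more than `R`. -/
lemma exists_forall_exists_mem_extensions {t : ℕ} (hRU : dim (R ⊓ U) < t) (hU : t ≤ dim U) :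
    ∃ M ∈ subspacesBetween R (R ⊔ U) (dim R + (dim U - t + 1)),
      ∀ F, R ≤ F → t ≤ dim (F ⊓ U) → ∃ C ∈ extensions R M, C ≤ F := by
  have hRsupU := dim_sup_add_dim_inf R U
  obtain ⟨M, hRM, hMU, hM⟩ := exists_mem_subspacesBetween (le_sup_left : R ≤ R ⊔ U)
    (m := dim R + (dim U - t + 1)) (by omega) (by omega)
  refine ⟨M, ⟨hRM, hMU, hM⟩, fun F hRF hF => ?_⟩
  have hFRU := dim_inf_sup_add_dim_inf hRF U
  have hFM := dim_sup_add_dim_inf (F ⊓ (R ⊔ U)) M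
  have hle : dim (F ⊓ (R ⊔ U) ⊔ M) ≤ dim (R ⊔ U) := dim_mono (sup_le inf_le_right hMU)
  obtain ⟨C, hRC, hCM, hC⟩ := exists_mem_subspacesBetween
    (le_inf (le_inf hRF le_sup_left) hRM : R ≤ F ⊓ (R ⊔ U) ⊓ M) (m := dim R + 1)
    (by omega) (by omega)
  exact ⟨C, ⟨hRC, hCM.trans inf_le_right, hC⟩, hCM.trans (inf_le_left.trans inf_le_left)⟩

end Dimension

section Counting

variable {α ι : Type*} [Finite α]

lemma ncard_mul_eq_ncard_mul {β : Type*} [Finite β] (s : Set α) (u : Set β) (r : α → β → Prop)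
    {m n : ℝ} (hm : ∀ a ∈ s, ({b ∈ u | r a b}.ncard : ℝ) = m)
    (hn : ∀ b ∈ u, ({a ∈ s | r a b}.ncard : ℝ) = n) : s.ncard * m = u.ncard * n := by
  classical
  have := Fintype.ofFinite α
  have := Fintype.ofFinite β
  have hcount := congrArg (Nat.cast : ℕ → ℝ)
    (Finset.sum_card_bipartiteAbove_eq_sum_card_bipartiteBelow (s := s.toFinset)
      (t := u.toFinset) r)
  have habove : ∀ a ∈ s.toFinset, ((u.toFinset.bipartiteAbove r a).card : ℝ) = m := by
    intro a ha
    rw [← hm a (by simpa using ha), ← Set.ncard_coe_finset]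
    simp [Finset.bipartiteAbove]
  have hbelow : ∀ b ∈ u.toFinset, ((s.toFinset.bipartiteBelow r b).card : ℝ) = n := by
    intro b hb
    rw [← hn b (by simpa using hb), ← Set.ncard_coe_finset]
    simp [Finset.bipartiteBelow]
  push_cast at hcount
  rw [Finset.sum_congr rfl habove, Finset.sum_congr rfl hbelow] at hcount
  simpa only [Set.ncard_eq_toFinset_card', Finset.sum_const, nsmul_eq_mul] using hcount

lemma cast_ncard_mono {s u : Set α} (h : s ⊆ u) : (s.ncard : ℝ) ≤ u.ncard :=
  Nat.cast_le.2 (Set.ncard_le_ncard h)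

lemma ncard_sep_add_ncard_sep_not (s : Set α) (p : α → Prop) :
    {a ∈ s | p a}.ncard + {a ∈ s | ¬ p a}.ncard = s.ncard :=
  Set.ncard_inter_add_ncard_sdiff_eq_ncard s {a | p a}

variable [Finite ι] {s : Set α} {I : Set ι} {A : ι → Set α} {b c : ℝ}

lemma ncard_le_ncard_mul_of_subset_biUnion (hs : s ⊆ ⋃ i ∈ I, A i)
    (hb : ∀ i ∈ I, ((A i).ncard : ℝ) ≤ b) : (s.ncard : ℝ) ≤ I.ncard * b := by
  refine (cast_ncard_mono hs).trans ?_
  clear hs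
  induction I, I.toFinite using Set.Finite.induction_on with
  | empty => simp
  | @insert i I hi _ ih =>
    have hI := ih fun j hj => hb j (Set.mem_insert_of_mem i hj)
    have hi' := hb i (Set.mem_insert i I)
    have hunion : ((A i ∪ ⋃ j ∈ I, A j).ncard : ℝ) ≤ (A i).ncard + (⋃ j ∈ I, A j).ncard := by
      exact_mod_cast Set.ncard_union_le _ _
    rw [Set.biUnion_insert, Set.ncard_insert_of_notMem hi]
    push_cast
    linarith

lemma bonferroni (hb : ∀ i ∈ I, b ≤ (A i).ncard)
    (hc : ∀ i ∈ I, ∀ j ∈ I, i ≠ j → ((A i ∩ A j).ncard : ℝ) ≤ c) :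
    I.ncard * b ≤ (⋃ i ∈ I, A i).ncard + I.ncard * (I.ncard - 1) / 2 * c := by
  induction I, I.toFinite using Set.Finite.induction_on with
  | empty => simp
  | @insert i I hi _ ih =>
    have hI := ih (fun j hj => hb j (Set.mem_insert_of_mem i hj))
      fun j hj l hl => hc j (Set.mem_insert_of_mem i hj) l (Set.mem_insert_of_mem i hl)
    have hi' := hb i (Set.mem_insert i I)
    have hunion : ((A i ∪ ⋃ j ∈ I, A j).ncard : ℝ) + (A i ∩ ⋃ j ∈ I, A j).ncard
        = (A i).ncard + (⋃ j ∈ I, A j).ncard := by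
      exact_mod_cast Set.ncard_union_add_ncard_inter _ _
    have hinter : ((A i ∩ ⋃ j ∈ I, A j).ncard : ℝ) ≤ I.ncard * c := by
      refine ncard_le_ncard_mul_of_subset_biUnion (A := fun j => A i ∩ A j) ?_ fun j hj =>
        hc i (Set.mem_insert i I) j (Set.mem_insert_of_mem i hj) (by rintro rfl; exact hi hj)
      rw [Set.inter_iUnion₂]
    rw [Set.biUnion_insert, Set.ncard_insert_of_notMem hi]
    push_cast
    linarith

end Counting

section GaussianBinomial

/-- The `q`-analogue `1 + q + ⋯ + q ^ (i - 1)` of the natural number `i`, which counts the points of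
an `i`-dimensional space over the field with `q` elements. -/
def qInt (q i : ℕ) : ℕ := ∑ j ∈ Finset.range i, q ^ j

lemma qInt_zero (q : ℕ) : qInt q 0 = 0 := rfl

lemma qInt_one (q : ℕ) : qInt q 1 = 1 := by simp [qInt]

lemma qInt_two (q : ℕ) : qInt q 2 = q + 1 := by simp [qInt, Finset.sum_range_succ, add_comm]

lemma qInt_three (q : ℕ) : qInt q 3 = q ^ 2 + q + 1 := by
  simp [qInt, Finset.sum_range_succ]; ring

lemma qInt_mul_sub_one (q i : ℕ) : (qInt q i : ℝ) * (q - 1) = q ^ i - 1 := by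
  simp only [qInt, Nat.cast_sum, Nat.cast_pow]
  exact geom_sum_mul _ _

lemma qInt_succ_pos (q i : ℕ) : (0 : ℝ) < qInt q (i + 1) := by
  rw [qInt, Finset.sum_range_succ']
  positivity

lemma qInt_mono (q : ℕ) : Monotone (qInt q) := fun _ _ h =>
  Finset.sum_le_sum_of_subset (Finset.range_mono h)

/-- The `q`-analogue of the factorial. -/
noncomputable def qFactorial (q i : ℕ) : ℝ := ∏ j ∈ Finset.range i, (qInt q (j + 1) : ℝ)

lemma qFactorial_pos (q i : ℕ) : 0 < qFactorial q i :=
  Finset.prod_pos fun j _ => qInt_succ_pos q j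

lemma qFactorial_succ (q i : ℕ) : qFactorial q (i + 1) = qFactorial q i * qInt q (i + 1) :=
  Finset.prod_range_succ _ _

/-- The Gaussian binomial coefficient, which counts the `j`-dimensional subspaces of an
`N`-dimensional space over the field with `q` elements. For `N < j` the truncated subtraction makes
it a junk value. -/
noncomputable def gaussBinom (q N j : ℕ) : ℝ :=
  qFactorial q N / (qFactorial q j * qFactorial q (N - j))

lemma gaussBinom_zero_right (q N : ℕ) : gaussBinom q N 0 = 1 := by
  rw [gaussBinom, Nat.sub_zero, show qFactorial q 0 = 1 from rfl, one_mul,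
    div_self (qFactorial_pos q N).ne']

lemma gaussBinom_symm (q i j : ℕ) : gaussBinom q (i + j) i = gaussBinom q (i + j) j := by
  rw [gaussBinom, gaussBinom, Nat.add_sub_cancel_left, Nat.add_sub_cancel, mul_comm]

lemma gaussBinom_succ_succ_mul (q N j : ℕ) :
    gaussBinom q (N + 1) (j + 1) * qInt q (j + 1) = qInt q (N + 1) * gaussBinom q N j := by
  rw [gaussBinom, gaussBinom, qFactorial_succ, qFactorial_succ, Nat.add_sub_add_right]
  have hj := (qFactorial_pos q j).ne'
  have hNj := (qFactorial_pos q (N - j)).ne'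
  have hsucc := (qInt_succ_pos q j).ne'
  field_simp

lemma gaussBinom_succ_left_mul (q : ℕ) {N j : ℕ} (h : j ≤ N) :
    gaussBinom q (N + 1) j * qInt q (N + 1 - j) = qInt q (N + 1) * gaussBinom q N j := by
  rw [gaussBinom, gaussBinom, qFactorial_succ, Nat.succ_sub h, qFactorial_succ]
  have hj := (qFactorial_pos q j).ne'
  have hNj := (qFactorial_pos q (N - j)).ne'
  have hsucc := (qInt_succ_pos q (N - j)).ne'
  field_simp

lemma gaussBinom_one_right (q N : ℕ) : gaussBinom q (N + 1) 1 = qInt q (N + 1) := by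
  simpa [gaussBinom_zero_right, qInt_one] using gaussBinom_succ_succ_mul q N 0

lemma one_le_gaussBinom (q : ℕ) {N j : ℕ} (h : j ≤ N) : 1 ≤ gaussBinom q N j := by
  induction j generalizing N with
  | zero => rw [gaussBinom_zero_right]
  | succ j ih =>
    obtain ⟨M, rfl⟩ := Nat.exists_eq_add_of_le' (show 1 ≤ N by omega)
    have hmono : (qInt q (j + 1) : ℝ) ≤ qInt q (M + 1) := Nat.cast_le.2 (qInt_mono q h)
    refine le_of_mul_le_mul_right ?_ (qInt_succ_pos q j)
    calc 1 * (qInt q (j + 1) : ℝ) ≤ qInt q (M + 1) * 1 := by linarith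
      _ ≤ qInt q (M + 1) * gaussBinom q M j := by gcongr; exact ih (by omega)
      _ = _ := (gaussBinom_succ_succ_mul q M j).symm

lemma gaussBinom_two_right (q t : ℕ) :
    gaussBinom q (t + 2) 2 * (q + 1 : ℝ) = qInt q (t + 2) * qInt q (t + 1) := by
  simpa [gaussBinom_one_right, qInt_two] using gaussBinom_succ_succ_mul q (t + 1) 1

lemma gaussBinom_three_right (q t : ℕ) :
    gaussBinom q (t + 3) 3 * (q ^ 2 + q + 1 : ℝ) = qInt q (t + 3) * gaussBinom q (t + 2) 2 := by
  simpa [qInt_three] using gaussBinom_succ_succ_mul q (t + 2) 2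

/-- The number of `k`-dimensional subspaces of an `n`-dimensional space that contain a given
`r`-dimensional subspace. -/
noncomputable def numAbove (q n k r : ℕ) : ℝ := if r ≤ k then gaussBinom q (n - r) (k - r) else 0

variable {n k : ℕ}

lemma one_le_numAbove (q : ℕ) {r : ℕ} (hr : r ≤ k) (hk : k ≤ n) : 1 ≤ numAbove q n k r := by
  rw [numAbove, if_pos hr]
  exact one_le_gaussBinom q (by omega)

lemma numAbove_nonneg (q : ℕ) (hk : k ≤ n) (r : ℕ) : 0 ≤ numAbove q n k r := by
  by_cases hr : r ≤ k
  · exact zero_le_one.trans (one_le_numAbove q hr hk)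
  · rw [numAbove, if_neg hr]

lemma numAbove_mul_qInt (q : ℕ) {r : ℕ} (hr : r ≤ k) (hk : k ≤ n) :
    numAbove q n k r * qInt q (k - r) = qInt q (n - r) * numAbove q n k (r + 1) := by
  rcases hr.lt_or_eq with h | rfl
  · rw [numAbove, numAbove, if_pos hr, if_pos (Nat.succ_le_of_lt h)]
    have := gaussBinom_succ_succ_mul q (n - (r + 1)) (k - (r + 1))
    rwa [show n - (r + 1) + 1 = n - r by omega, show k - (r + 1) + 1 = k - r by omega] at this
  · simp [numAbove, qInt_zero]

end GaussianBinomial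

section CountingSubspaces

variable [FiniteDimensional K V] {A B : Submodule K V}

lemma ncard_coe_submodule (A : Submodule K V) : (A : Set V).ncard = Nat.card K ^ dim A :=
  Module.natCard_eq_pow_finrank (V := A)

lemma sep_mem_extensions (h : A ≤ B) {v : V} (hvB : v ∈ B) (hvA : v ∉ A) :
    {C ∈ extensions A B | v ∈ C} = {A ⊔ K ∙ v} := by
  have hdim : dim (A ⊔ K ∙ v) = dim A + 1 := finrank_sup_span_singleton hvA
  ext C
  constructor
  · rintro ⟨⟨hAC, -, hC⟩, hvC⟩
    refine (eq_of_le_of_finrank_le (sup_le hAC ?_) (hC.trans hdim.symm).le).symm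
    rwa [span_singleton_le_iff_mem]
  · rintro rfl
    refine ⟨⟨le_sup_left, sup_le h ?_, hdim⟩, mem_sup_right (mem_span_singleton_self v)⟩
    rwa [span_singleton_le_iff_mem]

lemma subspacesBetween_dim_self (h : A ≤ B) : subspacesBetween A B (dim A) = {A} := by
  ext C
  constructor
  · rintro ⟨hAC, -, hC⟩
    exact (eq_of_le_of_finrank_le hAC hC.le).symm
  · rintro rfl
    exact ⟨le_rfl, h, rfl⟩

variable [Finite K]

instance : Finite (Submodule K V) :=
  have : Finite V := Module.finite_of_finite K
  inferInstance

lemma ncard_sdiff_of_le (h : A ≤ B) :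
    (((B : Set V) \ A).ncard : ℝ) = Nat.card K ^ dim B - Nat.card K ^ dim A := by
  have : Finite V := Module.finite_of_finite K
  have hcard := Set.ncard_sdiff_add_ncard_of_subset (show (A : Set V) ⊆ B from h)
  rw [ncard_coe_submodule, ncard_coe_submodule] at hcard
  exact eq_sub_of_add_eq (by exact_mod_cast hcard)

lemma ncard_extensions (h : A ≤ B) :
    (extensions A B).ncard = qInt (Nat.card K) (dim B - dim A) := by
  have : Finite V := Module.finite_of_finite K
  have hq : (1 : ℝ) < Nat.card K := Nat.one_lt_cast.2 Finite.one_lt_card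
  have hcount := ncard_mul_eq_ncard_mul (extensions A B) ((B : Set V) \ A) (fun C v => v ∈ C)
    (m := Nat.card K ^ (dim A + 1) - Nat.card K ^ dim A) (n := 1) ?_ ?_
  · rw [ncard_sdiff_of_le h] at hcount
    have hgeom := qInt_mul_sub_one (Nat.card K) (dim B - dim A)
    have hpow : (Nat.card K : ℝ) ^ dim B = Nat.card K ^ dim A * Nat.card K ^ (dim B - dim A) := by
      rw [← pow_add, Nat.add_sub_cancel' (dim_mono h)]
    have hpos : (0 : ℝ) < Nat.card K ^ dim A * (Nat.card K - 1) :=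
      mul_pos (by positivity) (by linarith)
    refine Nat.cast_injective (R := ℝ) (mul_right_cancel₀ hpos.ne' ?_)
    linear_combination hcount + hpow - (Nat.card K : ℝ) ^ dim A * hgeom
  · rintro C ⟨hAC, hCB, hC⟩
    rw [← hC, ← ncard_sdiff_of_le hAC]
    congr 2
    ext v
    exact ⟨fun hv => ⟨hv.2, hv.1.2⟩, fun hv => ⟨⟨hCB hv.1, hv.2⟩, hv.1⟩⟩
  · rintro v ⟨hvB, hvA⟩
    rw [sep_mem_extensions h hvB hvA, Set.ncard_singleton, Nat.cast_one]

lemma ncard_subspacesBetween (h : A ≤ B) {j : ℕ} (hj : dim A + j ≤ dim B) :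
    ((subspacesBetween A B (dim A + j)).ncard : ℝ)
      = gaussBinom (Nat.card K) (dim B - dim A) j := by
  induction j generalizing A with
  | zero => simp [subspacesBetween_dim_self h, gaussBinom_zero_right]
  | succ j ih =>
    have hcount := ncard_mul_eq_ncard_mul (extensions A B)
      (subspacesBetween A B (dim A + (j + 1))) (fun C F => C ≤ F)
      (m := gaussBinom (Nat.card K) (dim B - dim A - 1) j) (n := qInt (Nat.card K) (j + 1)) ?_ ?_
    · refine mul_right_cancel₀ (qInt_succ_pos (Nat.card K) j).ne' ?_
      rw [← hcount, ncard_extensions h]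
      have hrec := gaussBinom_succ_succ_mul (Nat.card K) (dim B - dim A - 1) j
      rw [show dim B - dim A - 1 + 1 = dim B - dim A by omega] at hrec
      exact hrec.symm
    · rintro C ⟨hAC, hCB, hC⟩
      rw [Nat.sub_sub, ← hC, ← ih hCB (by omega)]
      congr 2
      ext F
      refine ⟨fun hF => ⟨hF.2, hF.1.2.1, by have := hF.1.2.2; omega⟩,
        fun hF => ⟨⟨hAC.trans hF.1, hF.2.1, by have := hF.2.2; omega⟩, hF.1⟩⟩
    · rintro F ⟨hAF, hFB, hF⟩
      rw [show j + 1 = dim F - dim A by omega, ← ncard_extensions hAF]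
      congr 2
      ext C
      exact ⟨fun hC => ⟨hC.1.1, hC.2, hC.1.2.2⟩,
        fun hC => ⟨⟨hC.1, hC.2.1.trans hFB, hC.2.2⟩, hC.2.1⟩⟩

lemma ncard_subspacesOf {m : ℕ} (hB : m ≤ dim B) :
    ((subspacesOf B m).ncard : ℝ) = gaussBinom (Nat.card K) (dim B) m := by
  have h := ncard_subspacesBetween (bot_le : ⊥ ≤ B) (j := m) (by rwa [dim_bot, zero_add])
  rw [dim_bot, zero_add, Nat.sub_zero] at h
  rw [← h]
  congr 2
  ext F
  simp [subspacesBetween, subspacesOf]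

lemma ncard_above (R : Submodule K V) {k : ℕ} (hk : k ≤ Module.finrank K V) :
    ({F : Submodule K V | R ≤ F ∧ dim F = k}.ncard : ℝ)
      = numAbove (Nat.card K) (Module.finrank K V) k (dim R) := by
  by_cases hr : dim R ≤ k
  · have h := ncard_subspacesBetween (le_top : R ≤ ⊤) (j := k - dim R)
      (by rw [dim_top]; omega)
    rw [Nat.add_sub_cancel' hr, dim_top] at h
    rw [numAbove, if_pos hr, ← h]
    simp only [subspacesBetween, le_top, true_and]
  · have hempty : {F : Submodule K V | R ≤ F ∧ dim F = k} = ∅ :=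
      Set.eq_empty_of_forall_notMem fun F hF => hr (hF.2 ▸ dim_mono hF.1)
    rw [numAbove, if_neg hr, hempty, Set.ncard_empty, Nat.cast_zero]

end CountingSubspaces

/-! ### Families and covers -/

section Branching

variable {𝓕 𝓐 : Set (Submodule K V)} {R U : Submodule K V} {k t : ℕ} {b : ℝ}

/-- The branching factor of an extension step in an almost `t`-intersecting family of
`(t + d)`-spaces: the `qInt q (d + 1)` points that catch every member meeting a given one in
dimension at least `t`, and one more for the member that does not. -/
noncomputable def branching (q d : ℕ) : ℝ := qInt q (d + 1) + 1

/-- A `t`-cover of the family `𝓕`: a space that meets every member in dimension at least `t`. -/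
def IsCover (t : ℕ) (𝓕 : Set (Submodule K V)) (S : Submodule K V) : Prop :=
  ∀ F ∈ 𝓕, t ≤ dim (S ⊓ F)

lemma not_isCover : ¬ IsCover t 𝓕 R ↔ ∃ U ∈ 𝓕, dim (R ⊓ U) < t := by
  simp only [IsCover, not_forall, not_le, exists_prop]

lemma one_le_branching (q d : ℕ) : 1 ≤ branching q d :=
  le_add_of_nonneg_left (Nat.cast_nonneg _)

variable [Finite K] [FiniteDimensional K V]

lemma cast_ncard_above_mono (h : 𝓐 ⊆ 𝓕) (R : Submodule K V) :
    ({F ∈ 𝓐 | R ≤ F}.ncard : ℝ) ≤ {F ∈ 𝓕 | R ≤ F}.ncard :=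
  cast_ncard_mono fun _ hF => ⟨h hF.1, hF.2⟩

lemma ncard_above_le (h𝓐 : ∀ F ∈ 𝓐, dim F = k) (hk : k ≤ Module.finrank K V)
    (R : Submodule K V) :
    ({F ∈ 𝓐 | R ≤ F}.ncard : ℝ) ≤ numAbove (Nat.card K) (Module.finrank K V) k (dim R) := by
  rw [← ncard_above R hk]
  exact cast_ncard_mono fun F hF => ⟨hF.2, h𝓐 F hF.1⟩

lemma ncard_above_le_mul_of_extensions {M : Submodule K V} {i : ℕ} (hRM : R ≤ M)
    (hM : dim M = dim R + i) (hex : ∀ F ∈ 𝓐, R ≤ F → ∃ C ∈ extensions R M, C ≤ F)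
    (hb : ∀ C ∈ extensions R M, ({F ∈ 𝓐 | C ≤ F}.ncard : ℝ) ≤ b) :
    ({F ∈ 𝓐 | R ≤ F}.ncard : ℝ) ≤ qInt (Nat.card K) i * b := by
  rw [show i = dim M - dim R by omega, ← ncard_extensions hRM]
  refine ncard_le_ncard_mul_of_subset_biUnion (A := fun C => {F ∈ 𝓐 | C ≤ F}) ?_ hb
  rintro F ⟨hF, hRF⟩
  obtain ⟨C, hC, hCF⟩ := hex F hF hRF
  exact Set.mem_biUnion hC ⟨hF, hCF⟩

lemma ncard_above_le_mul_of_le_dim_inf (hRU : dim (R ⊓ U) < t) (hU : t ≤ dim U)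
    (h𝓐 : ∀ F ∈ 𝓐, R ≤ F → t ≤ dim (F ⊓ U))
    (hb : ∀ C ∈ extensions R (R ⊔ U), ({F ∈ 𝓐 | C ≤ F}.ncard : ℝ) ≤ b) :
    ({F ∈ 𝓐 | R ≤ F}.ncard : ℝ) ≤ qInt (Nat.card K) (dim U - t + 1) * b := by
  obtain ⟨M, ⟨hRM, hMU, hM⟩, hex⟩ := exists_forall_exists_mem_extensions hRU hU
  exact ncard_above_le_mul_of_extensions hRM hM (fun F hF hRF => hex F hRF (h𝓐 F hF hRF))
    fun C ⟨hRC, hCM, hC⟩ => hb C ⟨hRC, hCM.trans hMU, hC⟩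

lemma ncard_not_le_dim_inf_le_one (halm : IsAlmostTIntersecting t 𝓕) (h𝓐 : 𝓐 ⊆ 𝓕)
    (hU : U ∈ 𝓕) : {F ∈ 𝓐 | ¬ t ≤ dim (F ⊓ U)}.ncard ≤ 1 := by
  rw [Set.ncard_le_one_iff_subsingleton]
  refine (halm U hU).anti fun F hF => ⟨h𝓐 hF.1, ?_⟩
  rw [inf_comm]
  exact not_le.1 hF.2

lemma ncard_above_le_one_add_mul (halm : IsAlmostTIntersecting t 𝓕) (h𝓐 : 𝓐 ⊆ 𝓕) (hU : U ∈ 𝓕)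
    (htU : t ≤ dim U) (hRU : dim (R ⊓ U) < t)
    (hb : ∀ C, R ≤ C → dim C = dim R + 1 → ({F ∈ 𝓐 | C ≤ F}.ncard : ℝ) ≤ b) :
    ({F ∈ 𝓐 | R ≤ F}.ncard : ℝ) ≤ 1 + qInt (Nat.card K) (dim U - t + 1) * b := by
  have hsplit : ({F ∈ {F ∈ 𝓐 | R ≤ F} | t ≤ dim (F ⊓ U)}.ncard : ℝ)
      + {F ∈ {F ∈ 𝓐 | R ≤ F} | ¬ t ≤ dim (F ⊓ U)}.ncard = {F ∈ 𝓐 | R ≤ F}.ncard := by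
    exact_mod_cast ncard_sep_add_ncard_sep_not _ _
  have hexc : ({F ∈ {F ∈ 𝓐 | R ≤ F} | ¬ t ≤ dim (F ⊓ U)}.ncard : ℝ) ≤ 1 := by
    exact_mod_cast ncard_not_le_dim_inf_le_one halm ((Set.sep_subset _ _).trans h𝓐) hU
  have hmeet := ncard_above_le_mul_of_le_dim_inf (𝓐 := {F ∈ 𝓐 | t ≤ dim (F ⊓ U)}) hRU htU
    (fun F hF _ => hF.2) fun C ⟨hRC, _, hC⟩ =>
      (cast_ncard_above_mono (Set.sep_subset _ _) C).trans (hb C hRC hC)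
  have hsub := cast_ncard_mono (s := {F ∈ {F ∈ 𝓐 | R ≤ F} | t ≤ dim (F ⊓ U)})
    (u := {F ∈ {F ∈ 𝓐 | t ≤ dim (F ⊓ U)} | R ≤ F}) fun F hF => ⟨⟨hF.1.1, hF.2⟩, hF.1.2⟩
  linarith

lemma ncard_above_le_branching_mul (hdim : ∀ F ∈ 𝓕, dim F = k) (halm : IsAlmostTIntersecting t 𝓕)
    (h𝓐 : 𝓐 ⊆ 𝓕) (htk : t ≤ k) (hR : ¬ IsCover t 𝓕 R) (hb₁ : 1 ≤ b)
    (hb : ∀ C, R ≤ C → dim C = dim R + 1 → ({F ∈ 𝓐 | C ≤ F}.ncard : ℝ) ≤ b) :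
    ({F ∈ 𝓐 | R ≤ F}.ncard : ℝ) ≤ branching (Nat.card K) (k - t) * b := by
  obtain ⟨U, hU, hRU⟩ := not_isCover.1 hR
  have hle := ncard_above_le_one_add_mul halm h𝓐 hU (htk.trans (hdim U hU).ge) hRU hb
  rw [hdim U hU] at hle
  rw [branching]
  linarith

lemma ncard_above_le_pow_mul_numAbove (hdim : ∀ F ∈ 𝓕, dim F = k)
    (halm : IsAlmostTIntersecting t 𝓕) (h𝓐 : 𝓐 ⊆ 𝓕) (htk : t ≤ k) (hkn : k ≤ Module.finrank K V)
    {m j : ℕ} (hmk : m ≤ k) (hnc : ∀ Q, dim Q < m → (∃ F ∈ 𝓐, Q ≤ F) → ¬ IsCover t 𝓕 Q)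
    (R : Submodule K V) (hR : dim R + j = m) :
    ({F ∈ 𝓐 | R ≤ F}.ncard : ℝ) ≤
      branching (Nat.card K) (k - t) ^ j * numAbove (Nat.card K) (Module.finrank K V) k m := by
  have hnum := one_le_numAbove (Nat.card K) hmk hkn
  have hbranch := one_le_branching (Nat.card K) (k - t)
  induction j generalizing R with
  | zero =>
    rw [pow_zero, one_mul, ← hR, add_zero]
    exact ncard_above_le (fun F hF => hdim F (h𝓐 hF)) hkn R
  | succ j ih =>
    rcases Set.eq_empty_or_nonempty {F ∈ 𝓐 | R ≤ F} with hempty | hne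
    · rw [hempty, Set.ncard_empty, Nat.cast_zero]
      positivity
    rw [pow_succ', mul_assoc]
    exact ncard_above_le_branching_mul hdim halm h𝓐 htk (hnc R (by omega) hne)
      (one_le_mul_of_one_le_of_one_le (one_le_pow₀ hbranch) hnum) fun C _ hC => ih C (by omega)

lemma ncard_le_gaussBinom_mul {S : Submodule K V} (hS : t ≤ dim S)
    (h𝓐 : ∀ F ∈ 𝓐, t ≤ dim (F ⊓ S))
    (hb : ∀ T, T ≤ S → dim T = t → ({F ∈ 𝓐 | T ≤ F}.ncard : ℝ) ≤ b) :
    (𝓐.ncard : ℝ) ≤ gaussBinom (Nat.card K) (dim S) t * b := by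
  rw [← ncard_subspacesOf hS]
  refine ncard_le_ncard_mul_of_subset_biUnion (A := fun T => {F ∈ 𝓐 | T ≤ F}) (fun F hF => ?_)
    fun T hT => hb T hT.1 hT.2
  obtain ⟨T, hTle, hT⟩ := exists_le_dim_eq (h𝓐 F hF)
  exact Set.mem_biUnion (x := T) ⟨hTle.trans inf_le_right, hT⟩ ⟨hF, hTle.trans inf_le_left⟩

end Branching

section FamilyH

variable {k t : ℕ} {U₁ U₂ E : Submodule K V}

lemma isProperAlmost_of_forall_lt_imp_eq {𝓕 : Set (Submodule K V)}
    (hdim : ∀ F ∈ 𝓕, dim F = k)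
    (hpartner : ∀ F ∈ 𝓕, ∃ P, ∀ F' ∈ 𝓕, dim (F ⊓ F') < t → F' = P) (hU₁ : U₁ ∈ 𝓕)
    (hU₂ : U₂ ∈ 𝓕) (hlt : dim (U₁ ⊓ U₂) < t) : IsProperAlmost k t 𝓕 := by
  refine ⟨fun F hF => mem_subspaces.2 (hdim F hF), ?_, fun h => hlt.not_ge (h U₁ hU₁ U₂ hU₂)⟩
  rintro F hF A ⟨hA, hFA⟩ B ⟨hB, hFB⟩
  obtain ⟨P, hP⟩ := hpartner F hF
  rw [hP A hA hFA, hP B hB hFB]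

variable [FiniteDimensional K V]

lemma isProperAlmost_familyH (hU₁ : dim U₁ = k) (hU₂ : dim U₂ = k) (hE : dim E = t)
    (hEU : E ≤ U₁) (hlt : dim (U₁ ⊓ U₂) < t) : IsProperAlmost k t (familyH k t U₁ U₂ E) := by
  classical
  have htk : t ≤ k := hE ▸ hU₁ ▸ dim_mono hEU
  have hstar : ∀ F ∈ familyH k t U₁ U₂ E, F ≠ U₂ → E ≤ F := by
    rintro F (⟨_, hF, _⟩ | rfl | hF) hne
    exacts [hF, hEU, (hne hF).elim]
  have hmeet : ∀ F ∈ familyH k t U₁ U₂ E, F ≠ U₁ → t ≤ dim (F ⊓ U₂) := by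
    rintro F (⟨_, _, hF⟩ | hF | rfl) hne
    · exact hF
    · exact (hne hF).elim
    · rwa [inf_idem, hU₂]
  refine isProperAlmost_of_forall_lt_imp_eq ?_ (fun F hF => ⟨Equiv.swap U₁ U₂ F, ?_⟩)
    (U₁ := U₁) (U₂ := U₂) (by simp [familyH]) (by simp [familyH]) hlt
  · rintro F (⟨hF, _⟩ | rfl | rfl)
    exacts [mem_subspaces.1 hF, hU₁, hU₂]
  · intro F' hF' hFF'
    rcases eq_or_ne F U₂ with rfl | hF₂
    · rw [Equiv.swap_apply_right]
      by_contra hne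
      rw [inf_comm] at hFF'
      exact hFF'.not_ge (hmeet F' hF' hne)
    rcases eq_or_ne F' U₂ with rfl | hF'₂
    · rcases eq_or_ne F U₁ with rfl | hF₁
      · rw [Equiv.swap_apply_left]
      · exact absurd (hmeet F hF hF₁) hFF'.not_ge
    · have := dim_mono (le_inf (hstar F hF hF₂) (hstar F' hF' hF'₂))
      omega

lemma exists_familyH_spaces (ht : 1 ≤ t) (htk : t ≤ k) (hn : 2 * k + 1 ≤ Module.finrank K V + t) :
    ∃ U₁ U₂ E : Submodule K V, dim U₁ = k ∧ dim U₂ = k ∧ dim E = t ∧ E ≤ U₁ ∧ U₁ ⊓ U₂ ≤ E ∧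
      dim (U₁ ⊓ U₂) + 1 = t := by
  obtain ⟨U₁, -, hU₁⟩ := exists_le_dim_eq (B := (⊤ : Submodule K V)) (m := k)
    (by rw [dim_top]; omega)
  obtain ⟨W, hWU, hW⟩ := exists_le_dim_eq (B := U₁) (m := t - 1) (by omega)
  obtain ⟨E, hWE, hEU, hE⟩ := exists_mem_subspacesBetween hWU (m := t) (by omega) (by omega)
  obtain ⟨P, hP⟩ := Submodule.exists_isCompl U₁
  have hdimP := dim_sup_add_dim_inf U₁ P
  rw [hP.sup_eq_top, hP.inf_eq_bot, dim_bot, dim_top] at hdimP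
  obtain ⟨B, hBP, hB⟩ := exists_le_dim_eq (B := P) (m := k - t + 1) (by omega)
  have hUB : U₁ ⊓ B = ⊥ := (hP.disjoint.mono_right hBP).eq_bot
  have hinf : U₁ ⊓ (W ⊔ B) = W := by
    rw [inf_comm, sup_inf_assoc_of_le B hWU, inf_comm, hUB, sup_bot_eq]
  have hdimWB := dim_sup_add_dim_inf W B
  rw [((hP.disjoint.mono_right hBP).mono_left hWU).eq_bot, dim_bot] at hdimWB
  exact ⟨U₁, W ⊔ B, E, hU₁, by omega, hE, hEU, by rwa [hinf], by rw [hinf]; omega⟩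

lemma lt_dim_sup_of_ne {A B : Submodule K V} (hne : A ≠ B) (h : dim A = dim B) :
    dim A < dim (A ⊔ B) := by
  refine finrank_lt_finrank_of_lt (lt_of_le_of_ne le_sup_left fun hsup => hne ?_)
  exact (eq_of_le_of_finrank_le (sup_eq_left.1 hsup.symm) h.le).symm

variable [Finite K]

lemma ncard_familyH (hE : dim E = t) (hEU : E ≤ U₁) (hlt : dim (U₁ ⊓ U₂) < t) :
    (familyH k t U₁ U₂ E).ncard =
      {F ∈ subspaces K V k | E ≤ F ∧ t ≤ dim (F ⊓ U₂)}.ncard + 2 := by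
  have hne : U₁ ≠ U₂ := by
    rintro rfl
    rw [inf_idem] at hlt
    exact hlt.not_ge (hE ▸ dim_mono hEU)
  rw [familyH, Set.ncard_union_eq ?_ (Set.toFinite _) (Set.toFinite _), Set.ncard_pair hne]
  rw [Set.disjoint_right]
  rintro F (rfl | rfl) ⟨_, hEF, hF⟩
  · exact hlt.not_ge hF
  · exact hlt.not_ge (hE ▸ dim_mono (le_inf hEU hEF))

lemma ncard_above_inter_above_le (hkn : k ≤ Module.finrank K V) {C C' : Submodule K V} {r : ℕ}
    (hr : r ≤ dim (C ⊔ C')) :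
    (({F : Submodule K V | C ≤ F ∧ dim F = k} ∩ {F | C' ≤ F ∧ dim F = k}).ncard : ℝ) ≤
      numAbove (Nat.card K) (Module.finrank K V) k r := by
  obtain ⟨Q, hQ, hdimQ⟩ := exists_le_dim_eq hr
  rw [← hdimQ, ← ncard_above Q hkn]
  exact cast_ncard_mono fun F hF => ⟨hQ.trans (sup_le hF.1.1 hF.2.1), hF.1.2⟩

lemma le_ncard_star (hkn : k ≤ Module.finrank K V) (hE : dim E = t) (hU₂ : dim U₂ = k)
    (htk : t ≤ k) (hEU₂ : dim (E ⊓ U₂) + 1 = t) :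
    (qInt (Nat.card K) (k - t + 1) : ℝ) * numAbove (Nat.card K) (Module.finrank K V) k (t + 1) ≤
      {F ∈ subspaces K V k | E ≤ F ∧ t ≤ dim (F ⊓ U₂)}.ncard +
      (qInt (Nat.card K) (k - t + 1) : ℝ) * (qInt (Nat.card K) (k - t + 1) - 1) / 2 *
        numAbove (Nat.card K) (Module.finrank K V) k (t + 2) := by
  have hsup := dim_sup_add_dim_inf E U₂
  rw [show k - t + 1 = dim (E ⊔ U₂) - dim E by omega, ← ncard_extensions le_sup_left]
  have hbonf := bonferroni (I := extensions E (E ⊔ U₂))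
    (A := fun C => {F : Submodule K V | C ≤ F ∧ dim F = k})
    (fun C hC => (ncard_above C hkn).ge.trans_eq' (by rw [hC.2.2, hE]))
    fun C hC C' hC' hne => ncard_above_inter_above_le (r := t + 2) hkn (by
      have hlt := lt_dim_sup_of_ne hne (hC.2.2.trans hC'.2.2.symm)
      have := hC.2.2
      omega)
  refine hbonf.trans (add_le_add_left (cast_ncard_mono ?_) _)
  refine Set.iUnion₂_subset fun C ⟨hEC, hCU, hC⟩ F ⟨hCF, hF⟩ =>
    ⟨mem_subspaces.2 hF, hEC.trans hCF, ?_⟩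
  have hsupC := dim_sup_add_dim_inf C U₂
  have hle : dim (C ⊔ U₂) ≤ dim (E ⊔ U₂) := dim_mono (sup_le hCU le_sup_right)
  have hinf : dim (C ⊓ U₂) ≤ dim (F ⊓ U₂) := dim_mono (inf_le_inf_right U₂ hCF)
  omega

end FamilyH

section BadPair

variable {k t : ℕ} {𝓕 : Set (Submodule K V)} {U₁ U₂ F : Submodule K V}

/-- `U₁` and `U₂` are two members, meeting in dimension less than `t`, of the almost
`t`-intersecting family `𝓕` of `k`-subspaces. -/
structure IsBadPair (k t : ℕ) (𝓕 : Set (Submodule K V)) (U₁ U₂ : Submodule K V) : Prop where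
  dim_eq : ∀ F ∈ 𝓕, dim F = k
  almost : IsAlmostTIntersecting t 𝓕
  left_mem : U₁ ∈ 𝓕
  right_mem : U₂ ∈ 𝓕
  lt : dim (U₁ ⊓ U₂) < t

lemma IsProperAlmost.exists_isBadPair (h : IsProperAlmost k t 𝓕) :
    ∃ U₁ U₂, IsBadPair k t 𝓕 U₁ U₂ := by
  obtain ⟨hdim, halm, hint⟩ := h
  simp only [IsTIntersecting, not_forall, not_le] at hint
  obtain ⟨U₁, hU₁, U₂, hU₂, hlt⟩ := hint
  exact ⟨U₁, U₂, fun F hF => mem_subspaces.1 (hdim hF), halm, hU₁, hU₂, hlt⟩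

namespace IsBadPair

lemma symm (h : IsBadPair k t 𝓕 U₁ U₂) : IsBadPair k t 𝓕 U₂ U₁ :=
  ⟨h.dim_eq, h.almost, h.right_mem, h.left_mem, by rw [inf_comm]; exact h.lt⟩

lemma dim_left (h : IsBadPair k t 𝓕 U₁ U₂) : dim U₁ = k := h.dim_eq _ h.left_mem

lemma dim_right (h : IsBadPair k t 𝓕 U₁ U₂) : dim U₂ = k := h.dim_eq _ h.right_mem

lemma le_dim_inf_right (h : IsBadPair k t 𝓕 U₁ U₂) (hF : F ∈ 𝓕) (hne : F ≠ U₁) :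
    t ≤ dim (F ⊓ U₂) := by
  by_contra hlt
  rw [inf_comm, not_le] at hlt
  exact hne (h.almost U₂ h.right_mem ⟨hF, hlt⟩ ⟨h.left_mem, h.symm.lt⟩)

lemma le_dim_inf_left (h : IsBadPair k t 𝓕 U₁ U₂) (hF : F ∈ 𝓕) (hne : F ≠ U₂) :
    t ≤ dim (F ⊓ U₁) := h.symm.le_dim_inf_right hF hne

lemma eq_familyH [Finite K] [FiniteDimensional K V] (h : IsBadPair k t 𝓕 U₁ U₂)
    (hmax : IsMaximumProperAlmost k t 𝓕) {E : Submodule K V} (hE : dim E = t) (hEU : E ≤ U₁)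
    (hEU₂ : dim (E ⊓ U₂) + 1 = t) (hstar : ∀ F ∈ 𝓕, F ≠ U₁ → F ≠ U₂ → E ≤ F) :
    U₁ ⊓ U₂ ∈ subspacesOf E (t - 1) ∧ 𝓕 = familyH k t U₁ U₂ E := by
  have hlt := h.lt
  have hinf : E ⊓ U₂ = U₁ ⊓ U₂ :=
    eq_of_le_of_finrank_le (inf_le_inf_right U₂ hEU) (show dim _ ≤ dim _ by omega)
  refine ⟨⟨hinf ▸ inf_le_left, show dim _ = _ by rw [← hinf]; omega⟩, ?_⟩
  refine Set.eq_of_subset_of_ncard_le (fun F hF => ?_)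
    (hmax.2 _ (isProperAlmost_familyH h.dim_left h.dim_right hE hEU hlt)) (Set.toFinite _)
  by_cases hF₁ : F = U₁
  · exact Or.inr (Or.inl hF₁)
  by_cases hF₂ : F = U₂
  · exact Or.inr (Or.inr hF₂)
  exact Or.inl ⟨mem_subspaces.2 (h.dim_eq F hF), hstar F hF hF₁ hF₂, h.le_dim_inf_right hF hF₁⟩

end IsBadPair

end BadPair

/-! ### Pairs that almost cover -/

section Geometry

variable [FiniteDimensional K V] {t : ℕ} {U₁ U₂ E F R R' : Submodule K V}

lemma lt_dim_of_le_dim_inf {S : Submodule K V} (hlt : dim (U₁ ⊓ U₂) < t) (h₁ : t ≤ dim (S ⊓ U₁))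
    (h₂ : t ≤ dim (S ⊓ U₂)) : t < dim S := by
  by_contra! hS
  have hS₁ : S ⊓ U₁ = S := eq_of_le_of_finrank_le inf_le_left (hS.trans h₁)
  have hS₂ : S ⊓ U₂ = S := eq_of_le_of_finrank_le inf_le_left (hS.trans h₂)
  rw [hS₁] at h₁
  exact hlt.not_ge (h₁.trans (dim_mono (le_inf (inf_eq_left.1 hS₁) (inf_eq_left.1 hS₂))))

lemma dim_inf_of_dim_eq_succ (hlt : dim (U₁ ⊓ U₂) < t) (hR : dim R = t + 1)
    (h₁ : t ≤ dim (R ⊓ U₁)) (h₂ : t ≤ dim (R ⊓ U₂)) :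
    U₁ ⊓ U₂ ≤ R ∧ dim (U₁ ⊓ U₂) + 1 = t ∧ dim (R ⊓ U₁) = t ∧ dim (R ⊓ U₂) = t := by
  have hsum := dim_sup_add_dim_inf (R ⊓ U₁) (R ⊓ U₂)
  have hsup : dim (R ⊓ U₁ ⊔ R ⊓ U₂) ≤ dim R := dim_mono (sup_le inf_le_left inf_le_left)
  have hle : (R ⊓ U₁) ⊓ (R ⊓ U₂) ≤ U₁ ⊓ U₂ := inf_le_inf inf_le_right inf_le_right
  have hdim := dim_mono hle
  have heq : (R ⊓ U₁) ⊓ (R ⊓ U₂) = U₁ ⊓ U₂ :=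
    eq_of_le_of_finrank_le hle (show dim _ ≤ dim _ by omega)
  exact ⟨heq ▸ inf_le_left.trans inf_le_left, by omega, by omega, by omega⟩

lemma inf_eq_or_inf_eq_of_dim_eq_succ (hlt : dim (U₁ ⊓ U₂) < t) (hR : dim R = t + 1)
    (hR' : dim R' = t + 1) (h₁ : t ≤ dim (R ⊓ U₁)) (h₂ : t ≤ dim (R ⊓ U₂))
    (h₁' : t ≤ dim (R' ⊓ U₁)) (h₂' : t ≤ dim (R' ⊓ U₂)) (hRR' : t ≤ dim (R ⊓ R')) :
    R ⊓ U₁ = R' ⊓ U₁ ∨ R ⊓ U₂ = R' ⊓ U₂ := by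
  obtain ⟨_, hinf, hRU₁, hRU₂⟩ := dim_inf_of_dim_eq_succ hlt hR h₁ h₂
  obtain ⟨_, _, hRU₁', hRU₂'⟩ := dim_inf_of_dim_eq_succ hlt hR' h₁' h₂'
  by_contra! hne
  have hsup₁ := lt_dim_sup_of_ne hne.1 (hRU₁.trans hRU₁'.symm)
  have hsup₂ := lt_dim_sup_of_ne hne.2 (hRU₂.trans hRU₂'.symm)
  have hsum := dim_sup_add_dim_inf (R ⊓ U₁ ⊔ R' ⊓ U₁) (R ⊓ U₂ ⊔ R' ⊓ U₂)
  have hle : dim ((R ⊓ U₁ ⊔ R' ⊓ U₁) ⊓ (R ⊓ U₂ ⊔ R' ⊓ U₂)) ≤ dim (U₁ ⊓ U₂) :=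
    dim_mono (inf_le_inf (sup_le inf_le_right inf_le_right) (sup_le inf_le_right inf_le_right))
  have hle' : dim ((R ⊓ U₁ ⊔ R' ⊓ U₁) ⊔ (R ⊓ U₂ ⊔ R' ⊓ U₂)) ≤ dim (R ⊔ R') :=
    dim_mono (sup_le (sup_le_sup inf_le_left inf_le_left) (sup_le_sup inf_le_left inf_le_left))
  have hsumR := dim_sup_add_dim_inf R R'
  omega

lemma forall_eq_or_forall_eq {α β γ : Type*} {s : Set α} {f : α → β} {g : α → γ}
    (h : ∀ a ∈ s, ∀ b ∈ s, f a = f b ∨ g a = g b) :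
    (∀ a ∈ s, ∀ b ∈ s, f a = f b) ∨ (∀ a ∈ s, ∀ b ∈ s, g a = g b) := by
  by_contra! hcon
  obtain ⟨⟨a, ha, b, hb, hab⟩, c, hc, e, he, hce⟩ := hcon
  have hac := h a ha c hc
  have hbc := h b hb c hc
  have hae := h a ha e he
  have hbe := h b hb e he
  grind

lemma le_sup_of_le_dim_inf {U : Submodule K V} (hER : E ≤ R) (hR : dim R = dim E + 1)
    (hEU : dim (E ⊓ U) < t) (hRU : t ≤ dim (R ⊓ U)) : R ≤ E ⊔ U := by
  have hdim := dim_inf_sup_add_dim_inf hER U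
  exact inf_eq_left.1 (eq_of_le_of_finrank_le inf_le_left (show dim _ ≤ dim _ by omega))

lemma not_le_sup_of_inf_le (hEU : E ≤ U₁) (hWE : U₁ ⊓ U₂ ≤ E) (hEF : ¬ E ≤ F)
    (hFU : dim E ≤ dim (F ⊓ U₁)) : ¬ F ≤ E ⊔ U₂ := by
  intro hF
  have hle : F ⊓ U₁ ≤ E := calc
    F ⊓ U₁ ≤ (E ⊔ U₂) ⊓ U₁ := inf_le_inf_right U₁ hF
    _ = E ⊔ U₁ ⊓ U₂ := by rw [sup_inf_assoc_of_le U₂ hEU, inf_comm]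
    _ ≤ E := sup_le le_rfl hWE
  exact hEF (eq_of_le_of_finrank_le hle hFU ▸ inf_le_left)

lemma ncard_le_qInt_of_subset_extensions [Finite K] {k : ℕ} {𝓡 : Set (Submodule K V)}
    (hE : dim E = t) (hEU : E ≤ U₁) (hWE : U₁ ⊓ U₂ ≤ E) (hEU₂ : dim (E ⊓ U₂) < t)
    (hF : dim F = k) (hEF : ¬ E ≤ F) (hFU : t ≤ dim (F ⊓ U₁))
    (h𝓡 : ∀ R ∈ 𝓡, dim R = t + 1 ∧ E ≤ R ∧ t ≤ dim (R ⊓ U₂) ∧ t ≤ dim (R ⊓ F)) :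
    𝓡.ncard ≤ qInt (Nat.card K) (k - t) := by
  rcases 𝓡.eq_empty_or_nonempty with rfl | ⟨R₀, hR₀⟩
  · simp
  have hEF_lt : dim (E ⊓ F) < t := hE ▸ finrank_lt_finrank_of_lt (inf_lt_left.2 hEF)
  have hEF_sup : dim (E ⊔ F) ≤ k + 1 := by
    obtain ⟨hR, hER, -, hRF⟩ := h𝓡 R₀ hR₀
    have hdim := dim_inf_sup_add_dim_inf hER F
    have hle : dim (R₀ ⊓ (E ⊔ F)) ≤ dim R₀ := dim_mono inf_le_left
    have hsum := dim_sup_add_dim_inf E F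
    omega
  have hinf_lt : (E ⊔ U₂) ⊓ (E ⊔ F) < E ⊔ F := inf_lt_right.2 fun hle =>
    not_le_sup_of_inf_le hEU hWE hEF (hE.trans_le hFU) (le_sup_right.trans hle)
  have hinf : dim ((E ⊔ U₂) ⊓ (E ⊔ F)) < k + 1 :=
    (finrank_lt_finrank_of_lt hinf_lt).trans_le hEF_sup
  calc 𝓡.ncard ≤ (extensions E ((E ⊔ U₂) ⊓ (E ⊔ F))).ncard := by
        refine Set.ncard_le_ncard (fun R hR => ?_) (Set.toFinite _)
        obtain ⟨hdim, hER, hRU, hRF⟩ := h𝓡 R hR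
        rw [← hE] at hdim
        exact ⟨hER, le_inf (le_sup_of_le_dim_inf hER hdim hEU₂ hRU)
          (le_sup_of_le_dim_inf hER hdim hEF_lt hRF), hdim⟩
    _ = qInt (Nat.card K) (dim ((E ⊔ U₂) ⊓ (E ⊔ F)) - dim E) :=
        ncard_extensions (le_inf le_sup_left le_sup_left)
    _ ≤ _ := qInt_mono _ (by omega)

end Geometry

section QuasiCover

variable {k t : ℕ} {𝓕 : Set (Submodule K V)} {U₁ U₂ : Submodule K V}

/-- `S` meets `U₁`, `U₂` and all but at most one member of `𝓕` in dimension at least `t`. Members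
other than `U₁`, `U₂` of an almost `t`-intersecting family have this property. -/
def IsQuasiCover (t : ℕ) (𝓕 : Set (Submodule K V)) (U₁ U₂ S : Submodule K V) : Prop :=
  t ≤ dim (S ⊓ U₁) ∧ t ≤ dim (S ⊓ U₂) ∧ {F ∈ 𝓕 | ¬ t ≤ dim (F ⊓ S)}.ncard ≤ 1

namespace IsBadPair

lemma isQuasiCover_of_isCover (h : IsBadPair k t 𝓕 U₁ U₂) {S : Submodule K V}
    (hS : IsCover t 𝓕 S) : IsQuasiCover t 𝓕 U₁ U₂ S := by
  refine ⟨hS _ h.left_mem, hS _ h.right_mem, ?_⟩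
  rw [Set.sep_eq_empty_iff_mem_false.2 fun F hF => not_not.2 (inf_comm S F ▸ hS F hF),
    Set.ncard_empty]
  exact zero_le_one

variable [FiniteDimensional K V]

lemma not_isCover_of_dim_le (h : IsBadPair k t 𝓕 U₁ U₂) {S : Submodule K V} (hS : dim S ≤ t) :
    ¬ IsCover t 𝓕 S := fun hcover =>
  hS.not_gt (lt_dim_of_le_dim_inf h.lt (hcover _ h.left_mem) (hcover _ h.right_mem))

variable [Finite K]

lemma isQuasiCover_of_mem (h : IsBadPair k t 𝓕 U₁ U₂) {F : Submodule K V} (hF : F ∈ 𝓕)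
    (h₁ : F ≠ U₁) (h₂ : F ≠ U₂) : IsQuasiCover t 𝓕 U₁ U₂ F :=
  ⟨h.le_dim_inf_left hF h₂, h.le_dim_inf_right hF h₁,
    ncard_not_le_dim_inf_le_one h.almost subset_rfl hF⟩

end IsBadPair

variable [FiniteDimensional K V] [Finite K]

lemma cast_ncard_le_one_add {S : Submodule K V} (hexc : {F ∈ 𝓕 | ¬ t ≤ dim (F ⊓ S)}.ncard ≤ 1) :
    (𝓕.ncard : ℝ) ≤ 1 + {F ∈ 𝓕 | t ≤ dim (F ⊓ S)}.ncard := by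
  rw [← ncard_sep_add_ncard_sep_not 𝓕 fun F => t ≤ dim (F ⊓ S), add_comm]
  exact_mod_cast add_le_add_left hexc _

lemma IsBadPair.ncard_le_of_forall_not_isCover (h : IsBadPair k t 𝓕 U₁ U₂) {m : ℕ} (htm : t ≤ m)
    (hmk : m ≤ k) (hkn : k ≤ Module.finrank K V) {S : Submodule K V} (hS : dim S = m)
    (hexc : {F ∈ 𝓕 | ¬ t ≤ dim (F ⊓ S)}.ncard ≤ 1) (hnc : ∀ Q, dim Q < m → ¬ IsCover t 𝓕 Q) :
    (𝓕.ncard : ℝ) ≤ 1 + gaussBinom (Nat.card K) m t * (branching (Nat.card K) (k - t) ^ (m - t) *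
      numAbove (Nat.card K) (Module.finrank K V) k m) := by
  refine (cast_ncard_le_one_add hexc).trans (add_le_add_right ?_ 1)
  subst hS
  exact ncard_le_gaussBinom_mul htm (fun F hF => hF.2) fun T _ hT =>
    ncard_above_le_pow_mul_numAbove h.dim_eq h.almost (Set.sep_subset _ _) (htm.trans hmk) hkn hmk
      (fun Q hQ _ => hnc Q hQ) T (by omega)

end QuasiCover

section HeavySpaces

variable {k t : ℕ} {𝓕 : Set (Submodule K V)} {U₁ U₂ R R' : Submodule K V}

/-- The `(t + 1)`-spaces that lie in more members of `𝓕` than a `(t + 1)`-space that is not a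
`t`-cover can. -/
def heavySpaces (k t : ℕ) (𝓕 : Set (Submodule K V)) : Set (Submodule K V) :=
  {R | dim R = t + 1 ∧ branching (Nat.card K) (k - t) *
    numAbove (Nat.card K) (Module.finrank K V) k (t + 2) < {F ∈ 𝓕 | R ≤ F}.ncard}

namespace IsBadPair

variable [FiniteDimensional K V] [Finite K]

lemma isCover_of_mem_heavySpaces (h : IsBadPair k t 𝓕 U₁ U₂) (hk : t + 2 ≤ k)
    (hkn : k ≤ Module.finrank K V) (hR : R ∈ heavySpaces k t 𝓕) : IsCover t 𝓕 R := by
  by_contra hnc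
  refine (ncard_above_le_branching_mul h.dim_eq h.almost subset_rfl (by omega) hnc
    (one_le_numAbove _ hk hkn) fun C _ hC => ?_).not_gt hR.2
  have hle := ncard_above_le h.dim_eq hkn C
  rwa [hC, hR.1] at hle

lemma le_dim_inf_of_mem_heavySpaces (h : IsBadPair k t 𝓕 U₁ U₂) (hk : t + 2 ≤ k)
    (hkn : k ≤ Module.finrank K V) (hR : R ∈ heavySpaces k t 𝓕) (hR' : R' ∈ heavySpaces k t 𝓕) :
    t ≤ dim (R ⊓ R') := by
  by_contra! hlt
  have hle := ncard_above_le_mul_of_le_dim_inf (𝓐 := 𝓕)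
    (b := numAbove (Nat.card K) (Module.finrank K V) k (t + 2)) hlt (by rw [hR'.1]; omega)
    (fun F hF _ => inf_comm R' F ▸ h.isCover_of_mem_heavySpaces hk hkn hR' F hF)
    fun C hC => by
      have hle := ncard_above_le h.dim_eq hkn C
      rwa [hC.2.2, hR.1] at hle
  have hqInt : (qInt (Nat.card K) (dim R' - t + 1) : ℝ) ≤ branching (Nat.card K) (k - t) := by
    have hmono : (qInt (Nat.card K) (dim R' - t + 1) : ℝ) ≤ qInt (Nat.card K) (k - t + 1) := by
      exact_mod_cast qInt_mono _ (by rw [hR'.1]; omega)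
    exact hmono.trans (le_add_of_nonneg_right zero_le_one)
  exact (hle.trans (mul_le_mul_of_nonneg_right hqInt (numAbove_nonneg _ hkn _))).not_gt hR.2

lemma ncard_heavySpaces_le_of_inf_eq (h : IsBadPair k t 𝓕 U₁ U₂) (hk : t + 2 ≤ k)
    (hkn : k ≤ Module.finrank K V)
    (hstar : ∀ E ≤ U₁, dim E = t → ∃ F ∈ 𝓕, F ≠ U₂ ∧ ¬ E ≤ F)
    (heq : ∀ R ∈ heavySpaces k t 𝓕, ∀ R' ∈ heavySpaces k t 𝓕, R ⊓ U₁ = R' ⊓ U₁) :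
    (heavySpaces k t 𝓕).ncard ≤ qInt (Nat.card K) (k - t) := by
  rcases (heavySpaces k t 𝓕).eq_empty_or_nonempty with hempty | ⟨R₀, hR₀⟩
  · rw [hempty, Set.ncard_empty]
    exact Nat.zero_le _
  have hcover := fun R hR => h.isCover_of_mem_heavySpaces (R := R) hk hkn hR
  obtain ⟨hWR, -, hRU, -⟩ := dim_inf_of_dim_eq_succ h.lt hR₀.1 (hcover R₀ hR₀ _ h.left_mem)
    (hcover R₀ hR₀ _ h.right_mem)
  obtain ⟨F, hF, hne, hEF⟩ := hstar (R₀ ⊓ U₁) inf_le_right hRU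
  refine ncard_le_qInt_of_subset_extensions (U₂ := U₂) hRU inf_le_right (le_inf hWR inf_le_left)
    ((dim_mono (inf_le_inf_right U₂ inf_le_right)).trans_lt h.lt) (h.dim_eq F hF) hEF
    (h.le_dim_inf_left hF hne) fun R hR => ⟨hR.1, ?_, hcover R hR _ h.right_mem, hcover R hR F hF⟩
  exact heq R hR R₀ hR₀ ▸ inf_le_left

lemma ncard_heavySpaces_le (h : IsBadPair k t 𝓕 U₁ U₂) (hk : t + 2 ≤ k)
    (hkn : k ≤ Module.finrank K V)
    (hstar₁ : ∀ E ≤ U₁, dim E = t → ∃ F ∈ 𝓕, F ≠ U₂ ∧ ¬ E ≤ F)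
    (hstar₂ : ∀ E ≤ U₂, dim E = t → ∃ F ∈ 𝓕, F ≠ U₁ ∧ ¬ E ≤ F) :
    (heavySpaces k t 𝓕).ncard ≤ qInt (Nat.card K) (k - t) := by
  have hcover := fun R hR => h.isCover_of_mem_heavySpaces (R := R) hk hkn hR
  rcases forall_eq_or_forall_eq fun R hR R' hR' => inf_eq_or_inf_eq_of_dim_eq_succ h.lt hR.1 hR'.1
      (hcover R hR _ h.left_mem) (hcover R hR _ h.right_mem) (hcover R' hR' _ h.left_mem)
      (hcover R' hR' _ h.right_mem) (h.le_dim_inf_of_mem_heavySpaces hk hkn hR hR') with heq | heq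
  · exact h.ncard_heavySpaces_le_of_inf_eq hk hkn hstar₁ heq
  · exact h.symm.ncard_heavySpaces_le_of_inf_eq hk hkn hstar₂ heq

end IsBadPair

variable [FiniteDimensional K V] [Finite K]

lemma ncard_exists_heavySpaces_le (hdim : ∀ F ∈ 𝓕, dim F = k) (hkn : k ≤ Module.finrank K V) :
    ({F ∈ 𝓕 | ∃ R ∈ heavySpaces k t 𝓕, R ≤ F}.ncard : ℝ) ≤
      (heavySpaces k t 𝓕).ncard * numAbove (Nat.card K) (Module.finrank K V) k (t + 1) := by
  refine ncard_le_ncard_mul_of_subset_biUnion (A := fun R => {F ∈ 𝓕 | R ≤ F}) ?_ fun R hR => ?_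
  · rintro F ⟨hF, R, hR, hRF⟩
    exact Set.mem_biUnion hR ⟨hF, hRF⟩
  · have hle := ncard_above_le hdim hkn R
    rwa [hR.1] at hle

namespace IsBadPair

lemma ncard_not_exists_heavySpaces_le (h : IsBadPair k t 𝓕 U₁ U₂) (hk : t + 2 ≤ k)
    (hkn : k ≤ Module.finrank K V) {S : Submodule K V} (hS : dim S = t + 1) :
    ({F ∈ {F ∈ 𝓕 | t ≤ dim (F ⊓ S)} | ¬ ∃ R ∈ heavySpaces k t 𝓕, R ≤ F}.ncard : ℝ) ≤
      qInt (Nat.card K) (t + 1) * (branching (Nat.card K) (k - t) ^ 2 *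
        numAbove (Nat.card K) (Module.finrank K V) k (t + 2)) := by
  set 𝓐 := {F ∈ {F ∈ 𝓕 | t ≤ dim (F ⊓ S)} | ¬ ∃ R ∈ heavySpaces k t 𝓕, R ≤ F}
  have h𝓐 : 𝓐 ⊆ 𝓕 := (Set.sep_subset _ _).trans (Set.sep_subset _ _)
  have hone := one_le_mul_of_one_le_of_one_le (one_le_branching (Nat.card K) (k - t))
    (one_le_numAbove (Nat.card K) hk hkn)
  have hlight : ∀ C, dim C = t + 1 → ({F ∈ 𝓐 | C ≤ F}.ncard : ℝ) ≤
      branching (Nat.card K) (k - t) *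
        numAbove (Nat.card K) (Module.finrank K V) k (t + 2) := by
    intro C hC
    by_cases hheavy : C ∈ heavySpaces k t 𝓕
    · rw [Set.sep_eq_empty_iff_mem_false.2 fun F hF hCF => hF.2 ⟨C, hheavy, hCF⟩,
        Set.ncard_empty, Nat.cast_zero]
      exact zero_le_one.trans hone
    · exact (cast_ncard_above_mono h𝓐 C).trans (not_lt.1 fun hlt => hheavy ⟨hC, hlt⟩)
  have hle := ncard_le_gaussBinom_mul (t := t) (hS.ge.trans' t.le_succ) (fun F hF => hF.1.2)
    fun T _ hT => ncard_above_le_branching_mul h.dim_eq h.almost h𝓐 (by omega)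
      (h.not_isCover_of_dim_le hT.le) hone fun C _ hC => hlight C (by rw [hC, hT])
  rwa [hS, gaussBinom_symm, gaussBinom_one_right, ← mul_assoc (branching _ _), ← sq] at hle

lemma ncard_le_of_dim_eq_succ (h : IsBadPair k t 𝓕 U₁ U₂) (hk : t + 2 ≤ k)
    (hkn : k ≤ Module.finrank K V) {S : Submodule K V} (hS : dim S = t + 1)
    (hexc : {F ∈ 𝓕 | ¬ t ≤ dim (F ⊓ S)}.ncard ≤ 1)
    (hstar₁ : ∀ E ≤ U₁, dim E = t → ∃ F ∈ 𝓕, F ≠ U₂ ∧ ¬ E ≤ F)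
    (hstar₂ : ∀ E ≤ U₂, dim E = t → ∃ F ∈ 𝓕, F ≠ U₁ ∧ ¬ E ≤ F) :
    (𝓕.ncard : ℝ) ≤ 1 + qInt (Nat.card K) (k - t) *
        numAbove (Nat.card K) (Module.finrank K V) k (t + 1) +
      qInt (Nat.card K) (t + 1) * (branching (Nat.card K) (k - t) ^ 2 *
        numAbove (Nat.card K) (Module.finrank K V) k (t + 2)) := by
  have hheavy : ({F ∈ {F ∈ 𝓕 | t ≤ dim (F ⊓ S)} | ∃ R ∈ heavySpaces k t 𝓕, R ≤ F}.ncard : ℝ) ≤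
      qInt (Nat.card K) (k - t) * numAbove (Nat.card K) (Module.finrank K V) k (t + 1) := calc
    _ ≤ ({F ∈ 𝓕 | ∃ R ∈ heavySpaces k t 𝓕, R ≤ F}.ncard : ℝ) :=
        cast_ncard_mono fun F hF => ⟨hF.1.1, hF.2⟩
    _ ≤ _ := ncard_exists_heavySpaces_le h.dim_eq hkn
    _ ≤ _ := mul_le_mul_of_nonneg_right
        (Nat.cast_le.2 (h.ncard_heavySpaces_le hk hkn hstar₁ hstar₂)) (numAbove_nonneg _ hkn _)
  have hsplit : ({F ∈ {F ∈ 𝓕 | t ≤ dim (F ⊓ S)} | ∃ R ∈ heavySpaces k t 𝓕, R ≤ F}.ncard : ℝ) +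
      {F ∈ {F ∈ 𝓕 | t ≤ dim (F ⊓ S)} | ¬ ∃ R ∈ heavySpaces k t 𝓕, R ≤ F}.ncard =
        {F ∈ 𝓕 | t ≤ dim (F ⊓ S)}.ncard := by
    exact_mod_cast ncard_sep_add_ncard_sep_not _ _
  have hlight := h.ncard_not_exists_heavySpaces_le hk hkn hS
  have hle := cast_ncard_le_one_add hexc
  linarith

end IsBadPair

end HeavySpaces

section CoversContainingInf

variable [FiniteDimensional K V] [Finite K] {k t : ℕ} {𝓕 : Set (Submodule K V)}
  {U₁ U₂ S : Submodule K V}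

namespace IsBadPair

lemma ncard_inf_le_le (h : IsBadPair k t 𝓕 U₁ U₂) (hk : t + 2 ≤ k)
    (hkn : k ≤ Module.finrank K V) (hS : dim S = t + 2) (hWS : U₁ ⊓ U₂ ≤ S)
    (hW : dim (U₁ ⊓ U₂) + 1 = t) (hnc : ∀ Q, dim Q < t + 2 → ¬ IsCover t 𝓕 Q) :
    ({F ∈ {F ∈ 𝓕 | t ≤ dim (F ⊓ S)} | U₁ ⊓ U₂ ≤ F}.ncard : ℝ) ≤
      qInt (Nat.card K) 3 * (branching (Nat.card K) (k - t) ^ 2 *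
        numAbove (Nat.card K) (Module.finrank K V) k (t + 2)) := by
  refine ncard_above_le_mul_of_extensions hWS (by omega) (fun F hF hWF => ?_) fun T hT => ?_
  · obtain ⟨T, hWT, hT, hdim⟩ :=
      exists_mem_subspacesBetween (le_inf hWF hWS) (m := t) (by omega) hF.2
    exact ⟨T, ⟨hWT, hT.trans inf_le_right, by omega⟩, hT.trans inf_le_left⟩
  · have hdim := hT.2.2
    exact ncard_above_le_pow_mul_numAbove h.dim_eq h.almost (Set.sep_subset _ _) (by omega) hkn hk
      (fun Q hQ _ => hnc Q hQ) T (by omega)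

lemma ncard_not_inf_le_le (h : IsBadPair k t 𝓕 U₁ U₂) (hk : t + 2 ≤ k)
    (hkn : k ≤ Module.finrank K V) (hS : dim S = t + 2)
    (hnc : ∀ Q, dim Q < t + 2 → ¬ IsCover t 𝓕 Q)
    (hqc : ∀ Q, dim Q = t + 2 → IsQuasiCover t 𝓕 U₁ U₂ Q → U₁ ⊓ U₂ ≤ Q) :
    ({F ∈ {F ∈ 𝓕 | t ≤ dim (F ⊓ S)} | ¬ U₁ ⊓ U₂ ≤ F}.ncard : ℝ) ≤
      gaussBinom (Nat.card K) (t + 2) 2 * (branching (Nat.card K) (k - t) ^ 3 *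
        numAbove (Nat.card K) (Module.finrank K V) k (t + 3)) := by
  set 𝓐 := {F ∈ {F ∈ 𝓕 | t ≤ dim (F ⊓ S)} | ¬ U₁ ⊓ U₂ ≤ F}
  have h𝓐 : 𝓐 ⊆ 𝓕 := (Set.sep_subset _ _).trans (Set.sep_subset _ _)
  rcases hk.eq_or_lt with hk | hk
  · have hempty : 𝓐 = ∅ := by
      refine Set.sep_eq_empty_iff_mem_false.2 fun F hF => not_not.2 ?_
      by_cases hF₁ : F = U₁
      · exact hF₁ ▸ inf_le_left
      by_cases hF₂ : F = U₂
      · exact hF₂ ▸ inf_le_right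
      exact hqc F ((h.dim_eq F hF.1).trans hk.symm) (h.isQuasiCover_of_mem hF.1 hF₁ hF₂)
    rw [hempty, Set.ncard_empty, Nat.cast_zero]
    have := numAbove_nonneg (Nat.card K) hkn (t + 3)
    have := one_le_branching (Nat.card K) (k - t)
    have := one_le_gaussBinom (Nat.card K) (show 2 ≤ t + 2 by omega)
    positivity
  · have hle := ncard_le_gaussBinom_mul (t := t) (hS.ge.trans' (by omega)) (fun F hF => hF.1.2)
      fun T _ hT => ncard_above_le_pow_mul_numAbove (m := t + 3) (j := 3) h.dim_eq h.almost h𝓐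
        (by omega) hkn hk (fun Q hQ ⟨F, hF, hQF⟩ hcover => ?_) T (by omega)
    · rwa [hS, gaussBinom_symm] at hle
    · rcases Nat.lt_succ_iff_lt_or_eq.1 hQ with hlt | heq
      · exact hnc Q hlt hcover
      · exact hF.2 ((hqc Q heq (h.isQuasiCover_of_isCover hcover)).trans hQF)

lemma ncard_le_of_forall_inf_le (h : IsBadPair k t 𝓕 U₁ U₂) (hk : t + 2 ≤ k)
    (hkn : k ≤ Module.finrank K V) (hS : dim S = t + 2) (hSq : IsQuasiCover t 𝓕 U₁ U₂ S)
    (hW : dim (U₁ ⊓ U₂) + 1 = t) (hnc : ∀ Q, dim Q < t + 2 → ¬ IsCover t 𝓕 Q)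
    (hqc : ∀ Q, dim Q = t + 2 → IsQuasiCover t 𝓕 U₁ U₂ Q → U₁ ⊓ U₂ ≤ Q) :
    (𝓕.ncard : ℝ) ≤ 1 + qInt (Nat.card K) 3 * (branching (Nat.card K) (k - t) ^ 2 *
        numAbove (Nat.card K) (Module.finrank K V) k (t + 2)) +
      gaussBinom (Nat.card K) (t + 2) 2 * (branching (Nat.card K) (k - t) ^ 3 *
        numAbove (Nat.card K) (Module.finrank K V) k (t + 3)) := by
  have hsplit : ({F ∈ {F ∈ 𝓕 | t ≤ dim (F ⊓ S)} | U₁ ⊓ U₂ ≤ F}.ncard : ℝ) +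
      {F ∈ {F ∈ 𝓕 | t ≤ dim (F ⊓ S)} | ¬ U₁ ⊓ U₂ ≤ F}.ncard =
        {F ∈ 𝓕 | t ≤ dim (F ⊓ S)}.ncard := by
    exact_mod_cast ncard_sep_add_ncard_sep_not _ _
  have habove := h.ncard_inf_le_le hk hkn hS (hqc S hS hSq) hW hnc
  have hnot := h.ncard_not_inf_le_le (S := S) hk hkn hS hnc hqc
  have hle := cast_ncard_le_one_add hSq.2.2
  linarith

end IsBadPair

end CoversContainingInf

/-! ### Transversal covers -/

section Transversal

/-- `S` is a `(t + 2)`-space spanned by two `t`-spaces, its intersections with the `k`-spaces `U₁`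
and `U₂`, where `U₁ ⊓ U₂` has dimension less than `t`. -/
structure IsTransversal (k t : ℕ) (U₁ U₂ S : Submodule K V) : Prop where
  dim_left : dim U₁ = k
  dim_right : dim U₂ = k
  lt : dim (U₁ ⊓ U₂) < t
  dim_eq : dim S = t + 2
  dim_inf_left : dim (S ⊓ U₁) = t
  dim_inf_right : dim (S ⊓ U₂) = t
  dim_inf_inf : dim (S ⊓ (U₁ ⊓ U₂)) + 2 = t

/-- The `t`-spaces in `S` that meet `U₁` in codimension `i` and `U₂` in codimension `j`. They are
the possible intersections of `S` with the members of a family. -/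
def traces (t : ℕ) (S U₁ U₂ : Submodule K V) (i j : ℕ) : Set (Submodule K V) :=
  {T | T ≤ S ∧ dim T = t ∧ dim (T ⊓ U₁) + i = t ∧ dim (T ⊓ U₂) + j = t}

/-- The traces over which all members through a `t`-space are counted; there are few of them. -/
def specialTraces (t : ℕ) (S U₁ U₂ : Submodule K V) : Set (Submodule K V) :=
  traces t S U₁ U₂ 1 1 ∪ {S ⊓ U₁, S ⊓ U₂}

variable {k t : ℕ} {U₁ U₂ S T : Submodule K V}

lemma IsTransversal.symm (h : IsTransversal k t U₁ U₂ S) : IsTransversal k t U₂ U₁ S :=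
  ⟨h.dim_right, h.dim_left, by rw [inf_comm]; exact h.lt, h.dim_eq, h.dim_inf_right,
    h.dim_inf_left, by rw [inf_comm U₂]; exact h.dim_inf_inf⟩

section Geometry

variable [FiniteDimensional K V]

lemma dim_inf_le_succ {C C' : Submodule K V} (U : Submodule K V) (hle : C ≤ C')
    (hdim : dim C' = dim C + 1) : dim (C' ⊓ U) ≤ dim (C ⊓ U) + 1 := by
  have hC := dim_sup_add_dim_inf C U
  have hC' := dim_sup_add_dim_inf C' U
  have hmono : dim (C ⊔ U) ≤ dim (C' ⊔ U) := dim_mono (sup_le_sup_right hle U)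
  omega

lemma lt_dim_inf_of_le_sup {F U M : Submodule K V} (hTF : T ≤ F) (hT : dim T = t)
    (hFU : t ≤ dim (F ⊓ U)) (hM : M ≤ T ⊔ U) (hdim : dim M = dim U + 1) : t < dim (F ⊓ M) := by
  have hF := dim_inf_sup_add_dim_inf hTF U
  have hTU := dim_sup_add_dim_inf T U
  have hsum := dim_sup_add_dim_inf (F ⊓ (T ⊔ U)) M
  rw [inf_assoc, inf_eq_right.2 hM] at hsum
  have hle : dim (F ⊓ (T ⊔ U) ⊔ M) ≤ dim (T ⊔ U) := dim_mono (sup_le inf_le_right hM)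
  omega

namespace IsTransversal

lemma le (h : IsTransversal k t U₁ U₂ S) : t ≤ k := by
  rw [← h.dim_inf_left, ← h.dim_left]
  exact dim_mono inf_le_right

lemma dim_sup_inf_left (h : IsTransversal k t U₁ U₂ S) (hTS : T ≤ S) (hT : dim T = t) :
    dim (T ⊔ S ⊓ U₁) + dim (T ⊓ U₁) = 2 * t := by
  have hsum := dim_sup_add_dim_inf T (S ⊓ U₁)
  rw [← inf_assoc, inf_eq_left.2 hTS, h.dim_inf_left] at hsum
  omega

lemma le_sup_of_dim_inf (h : IsTransversal k t U₁ U₂ S) (hTS : T ≤ S) (hT : dim T = t)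
    (hTU : dim (T ⊓ U₁) + 2 = t) : S ≤ T ⊔ U₁ := by
  have hsum := h.dim_sup_inf_left hTS hT
  have hS := h.dim_eq
  have heq : T ⊔ S ⊓ U₁ = S :=
    eq_of_le_of_finrank_le (sup_le hTS inf_le_left) (show dim _ ≤ dim _ by omega)
  exact heq.symm.le.trans (sup_le_sup_left inf_le_right T)

lemma dim_sup_inf_sup_add_le (h : IsTransversal k t U₁ U₂ S) (hT : dim T = t) :
    dim ((T ⊔ U₁) ⊓ (T ⊔ U₂)) + dim (T ⊓ U₁) + dim (T ⊓ U₂) + 1 ≤ 3 * t := by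
  have hsum := dim_sup_add_dim_inf (T ⊔ U₁) (T ⊔ U₂)
  have hsum₁ := dim_sup_add_dim_inf T U₁
  have hsum₂ := dim_sup_add_dim_inf T U₂
  have hsumU := dim_sup_add_dim_inf U₁ U₂
  have hle : dim (U₁ ⊔ U₂) ≤ dim ((T ⊔ U₁) ⊔ (T ⊔ U₂)) :=
    dim_mono (sup_le_sup le_sup_right le_sup_right)
  have := h.lt
  have := h.dim_left
  have := h.dim_right
  omega

lemma eq_inf_left (h : IsTransversal k t U₁ U₂ S) (hTS : T ≤ S) (hT : dim T = t)
    (hTU : t ≤ dim (T ⊓ U₁)) : T = S ⊓ U₁ := by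
  have heq : T ⊓ U₁ = T := eq_of_le_of_finrank_le inf_le_left (hT.trans_le hTU)
  exact eq_of_le_of_finrank_le (le_inf hTS (inf_eq_left.1 heq)) (h.dim_inf_left.trans hT.symm).le

lemma mem_specialTraces_or (h : IsTransversal k t U₁ U₂ S) (hTS : T ≤ S) (hT : dim T = t) :
    T ∈ specialTraces t S U₁ U₂ ∨ T ∈ traces t S U₁ U₂ 2 1 ∨ T ∈ traces t S U₂ U₁ 2 1 ∨
      T ∈ traces t S U₁ U₂ 2 2 := by
  by_cases h₁ : t ≤ dim (T ⊓ U₁)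
  · exact Or.inl (Or.inr (Or.inl (h.eq_inf_left hTS hT h₁)))
  by_cases h₂ : t ≤ dim (T ⊓ U₂)
  · exact Or.inl (Or.inr (Or.inr (h.symm.eq_inf_left hTS hT h₂)))
  have hsum₁ := h.dim_sup_inf_left hTS hT
  have hsum₂ := h.symm.dim_sup_inf_left hTS hT
  have hle₁ : dim (T ⊔ S ⊓ U₁) ≤ dim S := dim_mono (sup_le hTS inf_le_left)
  have hle₂ : dim (T ⊔ S ⊓ U₂) ≤ dim S := dim_mono (sup_le hTS inf_le_left)
  have hS := h.dim_eq
  simp only [specialTraces, traces, Set.mem_union, Set.mem_ofPred_eq, hTS, hT, true_and]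
  omega

lemma inf_sup_inf_of_mem_traces (h : IsTransversal k t U₁ U₂ S)
    (hT : T ∈ traces t S U₁ U₂ 1 1) :
    S ⊓ (U₁ ⊓ U₂) ≤ T ∧ T ⊓ U₁ ⊔ T ⊓ U₂ = T := by
  obtain ⟨hTS, hT, hT₁, hT₂⟩ := hT
  have hsum := dim_sup_add_dim_inf (T ⊓ U₁) (T ⊓ U₂)
  have hsup : T ⊓ U₁ ⊔ T ⊓ U₂ ≤ T := sup_le inf_le_left inf_le_left
  have hinf : (T ⊓ U₁) ⊓ (T ⊓ U₂) ≤ S ⊓ (U₁ ⊓ U₂) :=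
    le_inf (inf_le_left.trans (inf_le_left.trans hTS)) (inf_le_inf inf_le_right inf_le_right)
  have hdimsup := dim_mono hsup
  have hdiminf := dim_mono hinf
  have hX := h.dim_inf_inf
  have heq : (T ⊓ U₁) ⊓ (T ⊓ U₂) = S ⊓ (U₁ ⊓ U₂) :=
    eq_of_le_of_finrank_le hinf (show dim _ ≤ dim _ by omega)
  exact ⟨heq ▸ inf_le_left.trans inf_le_left,
    eq_of_le_of_finrank_le hsup (show dim _ ≤ dim _ by omega)⟩

lemma exists_hyperplane (h : IsTransversal k t U₁ U₂ S) (hT : T ∈ traces t S U₁ U₂ 2 2) :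
    ∃ M, T ≤ M ∧ M ≤ T ⊔ U₂ ∧ dim M = k + 1 ∧ M ⊓ (T ⊔ U₁) ≤ S := by
  obtain ⟨hTS, hT, hT₁, hT₂⟩ := hT
  have hS₁ := h.le_sup_of_dim_inf hTS hT hT₁
  have hS₂ := h.symm.le_sup_of_dim_inf hTS hT hT₂
  obtain ⟨D, hinf, hsup⟩ := IsModularLattice.exists_inf_eq_and_sup_eq (le_inf hS₁ hS₂)
    (inf_le_right : (T ⊔ U₁) ⊓ (T ⊔ U₂) ≤ T ⊔ U₂)
  have hSD : S ≤ D := hinf.ge.trans inf_le_right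
  have hD : D ≤ T ⊔ U₂ := le_sup_right.trans hsup.le
  have hdim := dim_sup_add_dim_inf ((T ⊔ U₁) ⊓ (T ⊔ U₂)) D
  rw [hinf, hsup] at hdim
  have hle := h.dim_sup_inf_sup_add_le hT
  have hsum := dim_sup_add_dim_inf T U₂
  have hS := h.dim_eq
  have hU₂ := h.dim_right
  have htk := h.le
  obtain ⟨M, hTM, hMD, hM⟩ := exists_mem_subspacesBetween (hTS.trans hSD) (m := k + 1)
    (by omega) (by omega)
  refine ⟨M, hTM, hMD.trans hD, hM, hinf.le.trans' ?_⟩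
  exact le_inf (le_inf inf_le_right (inf_le_left.trans (hMD.trans hD))) (inf_le_left.trans hMD)

end IsTransversal

end Geometry

section Counting

variable [Finite K] [FiniteDimensional K V] {𝓐 : Set (Submodule K V)} {b b₀ b₁ : ℝ}

lemma ncard_above_le_sq_mul_numAbove {C U : Submodule K V} (hdim : ∀ F ∈ 𝓐, dim F = k)
    (hkn : k ≤ Module.finrank K V) (htU : t ≤ dim U) (hCU : dim (C ⊓ U) + 2 ≤ t)
    (hFU : ∀ F ∈ 𝓐, t ≤ dim (F ⊓ U)) :
    ({F ∈ 𝓐 | C ≤ F}.ncard : ℝ) ≤ (qInt (Nat.card K) (dim U - t + 1) : ℝ) ^ 2 *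
      numAbove (Nat.card K) (Module.finrank K V) k (dim C + 2) := by
  rw [sq, mul_assoc]
  refine ncard_above_le_mul_of_le_dim_inf (by omega) htU (fun F hF _ => hFU F hF)
    fun C₁ ⟨hCC₁, _, hC₁⟩ => ?_
  have hC₁U := dim_inf_le_succ U hCC₁ hC₁
  refine ncard_above_le_mul_of_le_dim_inf (by omega) htU (fun F hF _ => hFU F hF)
    fun C₂ ⟨_, _, hC₂⟩ => ?_
  have hle := ncard_above_le hdim hkn C₂
  rwa [hC₂, hC₁] at hle

lemma ncard_inf_mem_le {J : Set (Submodule K V)}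
    (hb : ∀ T ∈ J, ({F ∈ 𝓐 | F ⊓ S = T}.ncard : ℝ) ≤ b) :
    ({F ∈ 𝓐 | F ⊓ S ∈ J}.ncard : ℝ) ≤ J.ncard * b :=
  ncard_le_ncard_mul_of_subset_biUnion (A := fun T => {F ∈ 𝓐 | F ⊓ S = T})
    (fun _ hF => Set.mem_biUnion hF.2 ⟨hF.1, rfl⟩) hb

namespace IsTransversal

lemma ncard_traces_two_one_le (h : IsTransversal k t U₁ U₂ S) :
    ((traces t S U₁ U₂ 2 1).ncard : ℝ) ≤
      qInt (Nat.card K) t * ((Nat.card K : ℝ) ^ 2 + Nat.card K) := by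
  have ht := h.dim_inf_inf
  have hY : ((subspacesOf (S ⊓ U₂) (t - 1)).ncard : ℝ) = qInt (Nat.card K) t := by
    obtain ⟨s, rfl⟩ : ∃ s, t = s + 1 := ⟨t - 1, by omega⟩
    rw [ncard_subspacesOf (by have := h.dim_inf_right; omega), h.dim_inf_right,
      Nat.add_sub_cancel, gaussBinom_symm, gaussBinom_one_right]
  rw [← hY]
  refine ncard_le_ncard_mul_of_subset_biUnion
    (A := fun Y => extensions Y S \ {S ⊓ U₂}) (fun T hT => ?_) fun Y hY => ?_
  · obtain ⟨hTS, hT, -, hTU⟩ := hT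
    refine Set.mem_biUnion (x := T ⊓ U₂) ⟨inf_le_inf_right U₂ hTS, show dim _ = _ by omega⟩
      ⟨⟨inf_le_left, hTS, by omega⟩, ?_⟩
    rintro rfl
    rw [inf_assoc, inf_idem, h.dim_inf_right] at hTU
    omega
  · have hdimY : dim Y = t - 1 := hY.2
    have hmem : S ⊓ U₂ ∈ extensions Y S := ⟨hY.1, inf_le_left, by rw [h.dim_inf_right]; omega⟩
    rw [Set.ncard_sdiff_singleton_of_mem hmem, ncard_extensions (hY.1.trans inf_le_left), h.dim_eq,
      show t + 2 - dim Y = 3 by omega, qInt_three]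
    push_cast [Nat.add_sub_cancel]
    exact le_rfl

lemma ncard_traces_one_one_le (h : IsTransversal k t U₁ U₂ S) :
    (traces t S U₁ U₂ 1 1).ncard ≤ (Nat.card K + 1) ^ 2 := by
  have hX := h.dim_inf_inf
  have hX₁ : S ⊓ (U₁ ⊓ U₂) ≤ S ⊓ U₁ := inf_le_inf_left S inf_le_left
  have hX₂ : S ⊓ (U₁ ⊓ U₂) ≤ S ⊓ U₂ := inf_le_inf_left S inf_le_right
  calc (traces t S U₁ U₂ 1 1).ncard
      ≤ (extensions (S ⊓ (U₁ ⊓ U₂)) (S ⊓ U₁) ×ˢ extensions (S ⊓ (U₁ ⊓ U₂)) (S ⊓ U₂)).ncard := by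
        refine Set.ncard_le_ncard_of_injOn (fun T => (T ⊓ U₁, T ⊓ U₂)) (fun T hT => ?_)
          (fun T hT T' hT' heq => ?_) (Set.toFinite _)
        · have hXT := (h.inf_sup_inf_of_mem_traces hT).1
          obtain ⟨hTS, -, hT₁, hT₂⟩ := hT
          exact ⟨⟨le_inf hXT (hX₁.trans inf_le_right), inf_le_inf_right U₁ hTS,
              show dim (T ⊓ U₁) = _ by omega⟩,
            ⟨le_inf hXT (hX₂.trans inf_le_right), inf_le_inf_right U₂ hTS,
              show dim (T ⊓ U₂) = _ by omega⟩⟩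
        · obtain ⟨heq₁, heq₂⟩ := Prod.mk.inj heq
          rw [← (h.inf_sup_inf_of_mem_traces hT).2, ← (h.inf_sup_inf_of_mem_traces hT').2,
            heq₁, heq₂]
    _ = (Nat.card K + 1) ^ 2 := by
        rw [Set.ncard_prod, ncard_extensions hX₁, ncard_extensions hX₂, h.dim_inf_left,
          h.dim_inf_right, show t - dim (S ⊓ (U₁ ⊓ U₂)) = 2 by omega, qInt_two, sq]

lemma ncard_specialTraces_le (h : IsTransversal k t U₁ U₂ S) :
    (specialTraces t S U₁ U₂).ncard ≤ (Nat.card K + 1) ^ 2 + 2 :=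
  (Set.ncard_union_le _ _).trans (add_le_add h.ncard_traces_one_one_le
    ((Set.ncard_insert_le _ _).trans (by rw [Set.ncard_singleton])))

lemma ncard_le_cube (h : IsTransversal k t U₁ U₂ S) (hkn : k ≤ Module.finrank K V)
    (h𝓐 : ∀ F ∈ 𝓐, dim F = k ∧ t ≤ dim (F ⊓ U₁) ∧ t ≤ dim (F ⊓ U₂)) (hT : dim T = t)
    (hTU : dim (T ⊓ U₁) + 2 = t) {M : Submodule K V} (hTM : T ≤ M) (hMU : M ≤ T ⊔ U₂)
    (hM : dim M = k + 1) (hTF : ∀ F ∈ 𝓐, T ≤ F) (hFM : ∀ F ∈ 𝓐, F ⊓ (M ⊓ (T ⊔ U₁)) ≤ T) :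
    (𝓐.ncard : ℝ) ≤ (qInt (Nat.card K) (k - t + 1) : ℝ) ^ 3 *
      numAbove (Nat.card K) (Module.finrank K V) k (t + 3) := by
  have htk := h.le
  rw [← Set.sep_eq_self_iff_mem_true.2 hTF, pow_succ', mul_assoc]
  refine ncard_above_le_mul_of_extensions hTM (by omega) (fun F hF hTF => ?_) fun C hC => ?_
  · have hlt := lt_dim_inf_of_le_sup hTF hT (h𝓐 F hF).2.2 hMU (hM.trans (by rw [h.dim_right]))
    obtain ⟨C, hTC, hCF, hC⟩ := exists_mem_subspacesBetween (le_inf hTF hTM) (m := dim T + 1)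
      (Nat.le_succ _) (by omega)
    exact ⟨C, ⟨hTC, hCF.trans inf_le_right, hC⟩, hCF.trans inf_le_left⟩
  · rcases Set.eq_empty_or_nonempty {F ∈ 𝓐 | C ≤ F} with hempty | ⟨F, hF, hCF⟩
    · rw [hempty, Set.ncard_empty, Nat.cast_zero]
      have := numAbove_nonneg (Nat.card K) hkn (t + 3)
      positivity
    have hCT : C ⊓ U₁ ≤ T ⊓ U₁ :=
      le_inf ((hFM F hF).trans' (le_inf (inf_le_left.trans hCF)
        (inf_le_inf hC.2.1 le_sup_right))) inf_le_right
    have hle := ncard_above_le_sq_mul_numAbove (C := C) (fun F hF => (h𝓐 F hF).1) hkn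
      (htk.trans h.dim_left.ge) (by have := dim_mono hCT; omega) fun F hF => (h𝓐 F hF).2.1
    rwa [h.dim_left, hC.2.2, hT] at hle

lemma ncard_inf_eq_le_of_mem_traces_two_two (h : IsTransversal k t U₁ U₂ S)
    (hkn : k ≤ Module.finrank K V)
    (h𝓐 : ∀ F ∈ 𝓐, dim F = k ∧ t ≤ dim (F ⊓ U₁) ∧ t ≤ dim (F ⊓ U₂))
    (hT : T ∈ traces t S U₁ U₂ 2 2) :
    ({F ∈ 𝓐 | F ⊓ S = T}.ncard : ℝ) ≤ (qInt (Nat.card K) (k - t + 1) : ℝ) ^ 3 *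
      numAbove (Nat.card K) (Module.finrank K V) k (t + 3) := by
  obtain ⟨M, hTM, hMU, hM, hMS⟩ := h.exists_hyperplane hT
  exact h.ncard_le_cube hkn (fun F hF => h𝓐 F hF.1) hT.2.1 hT.2.2.1 hTM hMU hM
    (fun F hF => hF.2 ▸ inf_le_left) fun F hF => (inf_le_inf_left F hMS).trans hF.2.le

lemma ncard_not_inf_le_le (h : IsTransversal k t U₁ U₂ S) (hT : T ∈ traces t S U₁ U₂ 2 1)
    (hb₁ : ∀ R, dim R = t + 1 → ({F ∈ 𝓐 | R ≤ F}.ncard : ℝ) ≤ b₁) :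
    ({F ∈ {F ∈ 𝓐 | F ⊓ S = T} | ¬ F ⊓ ((T ⊔ U₁) ⊓ (T ⊔ U₂)) ≤ T}.ncard : ℝ) ≤
      Nat.card K * b₁ := by
  obtain ⟨hTS, hT, hT₁, hT₂⟩ := hT
  have hdim := h.dim_sup_inf_sup_add_le hT
  have hTZ : T ≤ (T ⊔ U₁) ⊓ (T ⊔ U₂) := le_inf le_sup_left le_sup_left
  have hdimC₀ := h.symm.dim_sup_inf_left hTS hT
  have hC₀ : T ⊔ S ⊓ U₂ ∈ extensions T ((T ⊔ U₁) ⊓ (T ⊔ U₂)) :=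
    ⟨le_sup_left, le_inf ((sup_le hTS inf_le_left).trans (h.le_sup_of_dim_inf hTS hT hT₁))
      (sup_le_sup_left inf_le_right T), by omega⟩
  have hb₁_nonneg : 0 ≤ b₁ := (Nat.cast_nonneg _).trans (hb₁ _ (hC₀.2.2.trans (by rw [hT])))
  have hcard : (extensions T ((T ⊔ U₁) ⊓ (T ⊔ U₂)) \ {T ⊔ S ⊓ U₂}).ncard ≤ Nat.card K := by
    have hmono := qInt_mono (Nat.card K)
      (show dim ((T ⊔ U₁) ⊓ (T ⊔ U₂)) - dim T ≤ 2 by omega)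
    rw [qInt_two] at hmono
    rw [Set.ncard_sdiff_singleton_of_mem hC₀, ncard_extensions hTZ]
    omega
  refine (ncard_le_ncard_mul_of_subset_biUnion (A := fun C => {F ∈ 𝓐 | C ≤ F})
    (I := extensions T ((T ⊔ U₁) ⊓ (T ⊔ U₂)) \ {T ⊔ S ⊓ U₂}) ?_ fun C hC => hb₁ C ?_).trans
    (mul_le_mul_of_nonneg_right (Nat.cast_le.2 hcard) hb₁_nonneg)
  · rintro F ⟨⟨hF, hFS⟩, hFZ⟩
    have hlt : T < F ⊓ ((T ⊔ U₁) ⊓ (T ⊔ U₂)) :=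
      lt_of_le_not_ge (le_inf (hFS ▸ inf_le_left) hTZ) hFZ
    obtain ⟨C, hTC, hCF, hC⟩ := exists_mem_subspacesBetween hlt.le (m := dim T + 1)
      (Nat.le_succ _) (finrank_lt_finrank_of_lt hlt)
    refine Set.mem_biUnion ⟨⟨hTC, hCF.trans inf_le_right, hC⟩, ?_⟩ ⟨hF, hCF.trans inf_le_left⟩
    rintro rfl
    have hle := dim_mono (le_inf (hCF.trans inf_le_left) (sup_le hTS inf_le_left))
    rw [hFS] at hle
    omega
  · rw [hC.1.2.2, hT]

lemma ncard_inf_eq_le_of_mem_traces_two_one (h : IsTransversal k t U₁ U₂ S)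
    (hkn : k ≤ Module.finrank K V)
    (h𝓐 : ∀ F ∈ 𝓐, dim F = k ∧ t ≤ dim (F ⊓ U₁) ∧ t ≤ dim (F ⊓ U₂))
    (hT : T ∈ traces t S U₁ U₂ 2 1)
    (hb₁ : ∀ R, dim R = t + 1 → ({F ∈ 𝓐 | R ≤ F}.ncard : ℝ) ≤ b₁) :
    ({F ∈ 𝓐 | F ⊓ S = T}.ncard : ℝ) ≤ Nat.card K * b₁ +
      (qInt (Nat.card K) (k - t + 1) : ℝ) ^ 3 *
        numAbove (Nat.card K) (Module.finrank K V) k (t + 3) := by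
  have hsplit : ({F ∈ {F ∈ 𝓐 | F ⊓ S = T} | F ⊓ ((T ⊔ U₁) ⊓ (T ⊔ U₂)) ≤ T}.ncard : ℝ) +
      {F ∈ {F ∈ 𝓐 | F ⊓ S = T} | ¬ F ⊓ ((T ⊔ U₁) ⊓ (T ⊔ U₂)) ≤ T}.ncard =
        {F ∈ 𝓐 | F ⊓ S = T}.ncard := by
    exact_mod_cast ncard_sep_add_ncard_sep_not _ _
  have hnot := h.ncard_not_inf_le_le hT hb₁
  obtain ⟨-, hT, hT₁, hT₂⟩ := hT
  have hsum := dim_sup_add_dim_inf T U₂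
  have hU₂ := h.dim_right
  have hcube := h.ncard_le_cube (𝓐 := {F ∈ {F ∈ 𝓐 | F ⊓ S = T} |
    F ⊓ ((T ⊔ U₁) ⊓ (T ⊔ U₂)) ≤ T}) hkn (fun F hF => h𝓐 F hF.1.1) hT hT₁ le_sup_left le_rfl
    (by omega) (fun F hF => hF.1.2 ▸ inf_le_left) fun F hF => by
      rw [inf_comm (T ⊔ U₂)]
      exact hF.2
  linarith

lemma ncard_inf_mem_specialTraces_le (h : IsTransversal k t U₁ U₂ S)
    (hb₀ : ∀ R, dim R = t → ({F ∈ 𝓐 | R ≤ F}.ncard : ℝ) ≤ b₀) :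
    ({F ∈ 𝓐 | F ⊓ S ∈ specialTraces t S U₁ U₂}.ncard : ℝ) ≤
      (((Nat.card K : ℝ) + 1) ^ 2 + 2) * b₀ := by
  have hcard : ((specialTraces t S U₁ U₂).ncard : ℝ) ≤ ((Nat.card K : ℝ) + 1) ^ 2 + 2 := by
    exact_mod_cast h.ncard_specialTraces_le
  have hb₀_nonneg : 0 ≤ b₀ := (Nat.cast_nonneg _).trans (hb₀ _ h.dim_inf_left)
  refine (ncard_inf_mem_le fun T hT => ?_).trans (mul_le_mul_of_nonneg_right hcard hb₀_nonneg)
  have hsub : {F ∈ 𝓐 | F ⊓ S = T} ⊆ {F ∈ 𝓐 | T ≤ F} :=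
    fun F hF => ⟨hF.1, hF.2 ▸ inf_le_left⟩
  refine (cast_ncard_mono hsub).trans (hb₀ T ?_)
  rcases hT with hT | rfl | rfl
  exacts [hT.2.1, h.dim_inf_left, h.dim_inf_right]

lemma ncard_lt_dim_inf_le (h : IsTransversal k t U₁ U₂ S)
    (hb₁ : ∀ R, dim R = t + 1 → ({F ∈ 𝓐 | R ≤ F}.ncard : ℝ) ≤ b₁) :
    ({F ∈ 𝓐 | t < dim (F ⊓ S)}.ncard : ℝ) ≤ qInt (Nat.card K) (t + 2) * b₁ := by
  have hle := ncard_le_gaussBinom_mul (𝓐 := {F ∈ 𝓐 | t < dim (F ⊓ S)}) (t := t + 1)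
    (by rw [h.dim_eq]; omega) (fun F hF => hF.2) fun R _ hR =>
      (cast_ncard_above_mono (Set.sep_subset _ _) R).trans (hb₁ R hR)
  rwa [h.dim_eq, gaussBinom_symm (Nat.card K) (t + 1) 1, gaussBinom_one_right] at hle

lemma ncard_traces_add_le (h : IsTransversal k t U₁ U₂ S) :
    ((traces t S U₁ U₂ 2 1).ncard : ℝ) + (traces t S U₂ U₁ 2 1).ncard +
      (traces t S U₁ U₂ 2 2).ncard ≤ gaussBinom (Nat.card K) (t + 2) 2 := by
  have hsub : traces t S U₁ U₂ 2 1 ∪ traces t S U₂ U₁ 2 1 ∪ traces t S U₁ U₂ 2 2 ⊆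
      subspacesOf S t := by
    rintro T ((hT | hT) | hT) <;> exact ⟨hT.1, hT.2.1⟩
  have hcard := cast_ncard_mono hsub
  rwa [ncard_subspacesOf (by rw [h.dim_eq]; omega), h.dim_eq, gaussBinom_symm,
    Set.ncard_union_eq, Set.ncard_union_eq, Nat.cast_add, Nat.cast_add] at hcard
  · refine Set.disjoint_left.2 fun T hT hT' => ?_
    have := hT.2.2.1
    have := hT'.2.2.2
    omega
  · refine Set.disjoint_left.2 fun T hT hT' => ?_
    have h22 := hT'.2.2
    rcases hT with hT | hT
    · have := hT.2.2.2
      omega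
    · have := hT.2.2.2
      omega

lemma ncard_le_add_ncard_traces (h : IsTransversal k t U₁ U₂ S)
    (hFS : ∀ F ∈ 𝓐, t ≤ dim (F ⊓ S)) :
    (𝓐.ncard : ℝ) ≤ {F ∈ 𝓐 | t < dim (F ⊓ S)}.ncard +
        {F ∈ 𝓐 | F ⊓ S ∈ specialTraces t S U₁ U₂}.ncard +
        {F ∈ 𝓐 | F ⊓ S ∈ traces t S U₁ U₂ 2 1}.ncard +
        {F ∈ 𝓐 | F ⊓ S ∈ traces t S U₂ U₁ 2 1}.ncard +
        {F ∈ 𝓐 | F ⊓ S ∈ traces t S U₁ U₂ 2 2}.ncard := by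
  have hcover : 𝓐 ⊆ {F ∈ 𝓐 | t < dim (F ⊓ S)} ∪ {F ∈ 𝓐 | F ⊓ S ∈ specialTraces t S U₁ U₂} ∪
      {F ∈ 𝓐 | F ⊓ S ∈ traces t S U₁ U₂ 2 1} ∪ {F ∈ 𝓐 | F ⊓ S ∈ traces t S U₂ U₁ 2 1} ∪
      {F ∈ 𝓐 | F ⊓ S ∈ traces t S U₁ U₂ 2 2} := by
    intro F hF
    have hor := h.mem_specialTraces_or (T := F ⊓ S) inf_le_right
    have := hFS F hF
    by_cases hlt : t < dim (F ⊓ S)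
    · simp only [Set.mem_union, Set.mem_ofPred_eq, hF, hlt, true_and, true_or]
    · specialize hor (by omega)
      simp only [Set.mem_union, Set.mem_ofPred_eq, hF, true_and]
      tauto
  refine (cast_ncard_mono hcover).trans ?_
  norm_cast
  refine (Set.ncard_union_le _ _).trans (Nat.add_le_add_right ?_ _)
  refine (Set.ncard_union_le _ _).trans (Nat.add_le_add_right ?_ _)
  refine (Set.ncard_union_le _ _).trans (Nat.add_le_add_right ?_ _)
  exact Set.ncard_union_le _ _

lemma ncard_le (h : IsTransversal k t U₁ U₂ S) (hkn : k ≤ Module.finrank K V)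
    (h𝓐 : ∀ F ∈ 𝓐, dim F = k ∧ t ≤ dim (F ⊓ U₁) ∧ t ≤ dim (F ⊓ U₂))
    (hFS : ∀ F ∈ 𝓐, t ≤ dim (F ⊓ S))
    (hb₀ : ∀ R, dim R = t → ({F ∈ 𝓐 | R ≤ F}.ncard : ℝ) ≤ b₀)
    (hb₁ : ∀ R, dim R = t + 1 → ({F ∈ 𝓐 | R ≤ F}.ncard : ℝ) ≤ b₁) :
    (𝓐.ncard : ℝ) ≤ qInt (Nat.card K) (t + 2) * b₁ + (((Nat.card K : ℝ) + 1) ^ 2 + 2) * b₀ +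
      2 * (qInt (Nat.card K) t * ((Nat.card K : ℝ) ^ 2 + Nat.card K) * (Nat.card K * b₁)) +
      gaussBinom (Nat.card K) (t + 2) 2 * ((qInt (Nat.card K) (k - t + 1) : ℝ) ^ 3 *
        numAbove (Nat.card K) (Module.finrank K V) k (t + 3)) := by
  have hunion := h.ncard_le_add_ncard_traces hFS
  obtain ⟨R, -, hR⟩ := exists_le_dim_eq (h.dim_eq.ge.trans' (Nat.le_succ (t + 1)))
  have hb₁_nonneg : 0 ≤ b₁ := (Nat.cast_nonneg _).trans (hb₁ R hR)
  have hlt := h.ncard_lt_dim_inf_le hb₁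
  have hspecial := h.ncard_inf_mem_specialTraces_le hb₀
  have h21 := ncard_inf_mem_le fun T hT =>
    h.ncard_inf_eq_le_of_mem_traces_two_one hkn h𝓐 hT hb₁
  have h12 := ncard_inf_mem_le fun T hT =>
    h.symm.ncard_inf_eq_le_of_mem_traces_two_one hkn (fun F hF => ⟨(h𝓐 F hF).1, (h𝓐 F hF).2.symm⟩)
      hT hb₁
  have h22 := ncard_inf_mem_le fun T hT => h.ncard_inf_eq_le_of_mem_traces_two_two hkn h𝓐 hT
  have hnumAbove := numAbove_nonneg (Nat.card K) hkn (t + 3)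
  have hcube := mul_le_mul_of_nonneg_right h.ncard_traces_add_le
    (show 0 ≤ (qInt (Nat.card K) (k - t + 1) : ℝ) ^ 3 *
      numAbove (Nat.card K) (Module.finrank K V) k (t + 3) by positivity)
  have hline := mul_le_mul_of_nonneg_right (add_le_add h.ncard_traces_two_one_le
    h.symm.ncard_traces_two_one_le) (show 0 ≤ Nat.card K * b₁ by positivity)
  linarith

end IsTransversal

end Counting

end Transversal

/-! ### Numerical estimates -/

section Estimates

lemma qInt_succ_le {q : ℕ} (hq : 3 ≤ q) (t : ℕ) : (qInt q (t + 1) : ℝ) ≤ 3 / 2 * (q : ℝ) ^ t := by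
  have hq' : (3 : ℝ) ≤ q := by exact_mod_cast hq
  have hb := qInt_mul_sub_one q (t + 1)
  have hx : 0 < (q : ℝ) ^ t := by positivity
  refine le_of_mul_le_mul_right (a := (q : ℝ) - 1) ?_ (by linarith)
  rw [hb, pow_succ]
  nlinarith

lemma qInt_add_two_le {q t : ℕ} (hq : 3 ≤ q) (ht : 2 ≤ t) :
    (qInt q (t + 2) : ℝ) ≤ ((q : ℝ) ^ t) ^ 2 / 2 := by
  have hq' : (3 : ℝ) ≤ q := by exact_mod_cast hq
  have hb := qInt_mul_sub_one q (t + 2)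
  have hx : (q : ℝ) ^ 2 ≤ (q : ℝ) ^ t := pow_le_pow_right₀ (by linarith) ht
  refine le_of_mul_le_mul_right (a := (q : ℝ) - 1) ?_ (by linarith)
  rw [hb, pow_add]
  nlinarith [sq_nonneg ((q : ℝ) ^ t)]

lemma qInt_mul_sq_add_mul_le {q t : ℕ} (hq : 3 ≤ q) (ht : 2 ≤ t) :
    (qInt q t : ℝ) * ((q : ℝ) ^ 2 + q) * q ≤ 2 * ((q : ℝ) ^ t) ^ 2 := by
  have hq' : (3 : ℝ) ≤ q := by exact_mod_cast hq
  have hb := qInt_mul_sub_one q t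
  have hx : (q : ℝ) ^ 2 ≤ (q : ℝ) ^ t := pow_le_pow_right₀ (by linarith) ht
  have hmul : (qInt q t : ℝ) * (q + 1) ≤ 2 * (q : ℝ) ^ t := by nlinarith
  calc (qInt q t : ℝ) * ((q : ℝ) ^ 2 + q) * q = (q : ℝ) ^ 2 * (qInt q t * (q + 1)) := by ring
    _ ≤ (q : ℝ) ^ t * (2 * (q : ℝ) ^ t) := by gcongr
    _ = 2 * ((q : ℝ) ^ t) ^ 2 := by ring

lemma gaussBinom_add_two_mul (q t : ℕ) :
    gaussBinom q (t + 2) 2 * (((q : ℝ) + 1) * ((q : ℝ) - 1) ^ 2) =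
      ((q : ℝ) ^ 2 * (q : ℝ) ^ t - 1) * (q * (q : ℝ) ^ t - 1) := by
  rw [← pow_add, ← pow_succ', add_comm 2 t, ← qInt_mul_sub_one, ← qInt_mul_sub_one]
  linear_combination ((q : ℝ) - 1) ^ 2 * gaussBinom_two_right q t

lemma gaussBinom_add_three_mul (q t : ℕ) :
    gaussBinom q (t + 3) 3 * ((q : ℝ) ^ 3 - 1) =
      ((q : ℝ) ^ 3 * (q : ℝ) ^ t - 1) * gaussBinom q (t + 2) 2 := by
  have hb := qInt_mul_sub_one q (t + 3)
  rw [pow_add, mul_comm (_ ^ t)] at hb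
  linear_combination ((q : ℝ) - 1) * gaussBinom_three_right q t + gaussBinom q (t + 2) 2 * hb

lemma gaussBinom_add_two_le {q t : ℕ} (hq : 3 ≤ q) :
    gaussBinom q (t + 2) 2 ≤ 27 / 16 * ((q : ℝ) ^ t) ^ 2 := by
  obtain ⟨u, hu⟩ : ∃ u : ℕ, q = 3 + u := ⟨q - 3, by omega⟩
  have hq' : (3 : ℝ) ≤ q := by exact_mod_cast hq
  have hpos : 0 < ((q : ℝ) + 1) * ((q : ℝ) - 1) ^ 2 :=
    mul_pos (by linarith) (pow_pos (by linarith) 2)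
  have hx : 1 ≤ (q : ℝ) ^ t := one_le_pow₀ (by linarith)
  have hcube : (q : ℝ) ^ 3 ≤ 27 / 16 * (((q : ℝ) + 1) * ((q : ℝ) - 1) ^ 2) := by
    rw [hu, ← sub_nonneg]
    push_cast
    ring_nf
    positivity
  refine le_of_mul_le_mul_right (a := ((q : ℝ) + 1) * ((q : ℝ) - 1) ^ 2) ?_ hpos
  calc gaussBinom q (t + 2) 2 * (((q : ℝ) + 1) * ((q : ℝ) - 1) ^ 2)
      = ((q : ℝ) ^ 2 * (q : ℝ) ^ t - 1) * (q * (q : ℝ) ^ t - 1) := gaussBinom_add_two_mul q t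
    _ ≤ ((q : ℝ) ^ 2 * (q : ℝ) ^ t) * (q * (q : ℝ) ^ t) := by
        gcongr
        · nlinarith
        · linarith
        · linarith
    _ = (q : ℝ) ^ 3 * ((q : ℝ) ^ t) ^ 2 := by ring
    _ ≤ 27 / 16 * (((q : ℝ) + 1) * ((q : ℝ) - 1) ^ 2) * ((q : ℝ) ^ t) ^ 2 := by gcongr
    _ = _ := by ring

lemma gaussBinom_add_three_le {q t : ℕ} (hq : 3 ≤ q) :
    gaussBinom q (t + 3) 3 ≤ 9 / 5 * ((q : ℝ) ^ t) ^ 3 := by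
  have hq' : (3 : ℝ) ≤ q := by exact_mod_cast hq
  have hcube : (3 : ℝ) ^ 3 ≤ (q : ℝ) ^ 3 := pow_le_pow_left₀ (by norm_num) hq' 3
  have hg₂ := gaussBinom_add_two_le (t := t) hq
  have hg₂_pos := one_le_gaussBinom q (show 2 ≤ t + 2 by omega)
  refine le_of_mul_le_mul_right (a := (q : ℝ) ^ 3 - 1) ?_ (by linarith)
  calc gaussBinom q (t + 3) 3 * ((q : ℝ) ^ 3 - 1)
      = ((q : ℝ) ^ 3 * (q : ℝ) ^ t - 1) * gaussBinom q (t + 2) 2 := gaussBinom_add_three_mul q t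
    _ ≤ ((q : ℝ) ^ 3 * (q : ℝ) ^ t) * (27 / 16 * ((q : ℝ) ^ t) ^ 2) := by
        gcongr
        linarith
    _ = 27 / 16 * (q : ℝ) ^ 3 * ((q : ℝ) ^ t) ^ 3 := by ring
    _ ≤ 9 / 5 * ((q : ℝ) ^ 3 - 1) * ((q : ℝ) ^ t) ^ 3 := by
        gcongr ?_ * _
        linarith
    _ = _ := by ring

lemma gaussBinom_two_add_two_le (t : ℕ) : gaussBinom 2 (t + 2) 2 ≤ 8 / 3 * ((2 : ℝ) ^ t) ^ 2 := by
  have hg := gaussBinom_add_two_mul 2 t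
  have hx : (1 : ℝ) ≤ 2 ^ t := one_le_pow₀ (by norm_num)
  push_cast at hg
  nlinarith

lemma gaussBinom_two_add_three_le (t : ℕ) :
    gaussBinom 2 (t + 3) 3 ≤ 64 / 21 * ((2 : ℝ) ^ t) ^ 3 := by
  have hg := gaussBinom_add_three_mul 2 t
  have hg₂ := gaussBinom_two_add_two_le t
  have hg₂_pos := one_le_gaussBinom 2 (show 2 ≤ t + 2 by omega)
  have hmul : (2 ^ 3 * (2 : ℝ) ^ t - 1) * gaussBinom 2 (t + 2) 2 ≤
      (2 ^ 3 * (2 : ℝ) ^ t) * (8 / 3 * ((2 : ℝ) ^ t) ^ 2) := by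
    gcongr
    linarith
  push_cast at hg
  linarith

end Estimates

/-- The numbers, over the field with `Q` elements, that govern the size `N` of a star
`{F | E ≤ F ∧ t ≤ dim (F ⊓ U)}`: `a = Q ^ d` with `d = k - t`, `x = Q ^ t`, `p` is the `Q`-analogue
of `d + 1`, and `Dᵢ` is the number of `k`-spaces through a `(t + i)`-space. The constant `c`, which
is `2` for `Q = 2` and `1` otherwise, reflects the slack `c * a ^ 2 * x ^ 2 ≤ Q ^ (n - t)` in the
dimension `n` of the ambient space. -/
structure StarData (Q c a x p D₁ D₂ D₃ N : ℝ) : Prop where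
  two_le : 2 ≤ Q
  one_le_slack : 1 ≤ c
  sq_le_a : Q ^ 2 ≤ a
  sq_le_x : Q ^ 2 ≤ x
  mul_sub_one : p * (Q - 1) = Q * a - 1
  lower : (c * a ^ 2 * x ^ 2 - Q) * D₂ ≤ (a - Q) * D₁
  upper : (c * a ^ 2 * x ^ 2 - Q ^ 2) * D₃ ≤ (a - Q ^ 2) * D₂
  one_le : 1 ≤ D₂
  nonneg : 0 ≤ D₃
  bonferroni : p * D₁ ≤ N + p * (p - 1) / 2 * D₂

namespace StarData

variable {Q c a x p D₁ D₂ D₃ N b₀ b₁ b₂ g₂ g₃ : ℝ}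

lemma four_le_a (h : StarData Q c a x p D₁ D₂ D₃ N) : 4 ≤ a := by
  nlinarith [h.two_le, h.sq_le_a]

lemma four_le_x (h : StarData Q c a x p D₁ D₂ D₃ N) : 4 ≤ x := by
  nlinarith [h.two_le, h.sq_le_x]

lemma p_nonneg (h : StarData Q c a x p D₁ D₂ D₃ N) : 0 ≤ p := by
  nlinarith [h.two_le, h.four_le_a, h.mul_sub_one]

lemma lower_bound (h : StarData Q c a x p D₁ D₂ D₃ N) : c * (a + Q) * x ^ 2 * D₂ ≤ D₁ := by
  have hx₂ : 1 ≤ x ^ 2 := one_le_pow₀ (by linarith [h.four_le_x])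
  obtain ⟨hQ, hc, ha, -, -, hlower, -, hD₂, -, -⟩ := h
  have hcx : 1 ≤ c * x ^ 2 := by nlinarith
  refine le_of_mul_le_mul_left (a := a - Q) (le_trans ?_ hlower) (by nlinarith)
  calc (a - Q) * (c * (a + Q) * x ^ 2 * D₂) = (c * a ^ 2 * x ^ 2 - Q ^ 2 * (c * x ^ 2)) * D₂ := by
        ring
    _ ≤ (c * a ^ 2 * x ^ 2 - Q) * D₂ := by
        gcongr
        nlinarith

lemma upper_bound (h : StarData Q c a x p D₁ D₂ D₃ N) : c * a * x ^ 2 * D₃ ≤ D₂ := by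
  have hx₂ : 1 ≤ x ^ 2 := one_le_pow₀ (by linarith [h.four_le_x])
  obtain ⟨hQ, hc, ha, -, -, -, hupper, hD₂, hD₃, -⟩ := h
  have hcx : 1 ≤ c * x ^ 2 := by nlinarith
  have hcax : 1 ≤ a * (c * x ^ 2) := by nlinarith
  rcases ha.eq_or_lt with rfl | hlt
  · have hpos : 0 < c * (Q ^ 2) ^ 2 * x ^ 2 - Q ^ 2 := by nlinarith
    have hzero : D₃ = 0 := hD₃.antisymm' (by nlinarith)
    rw [hzero, mul_zero]
    linarith
  · refine le_of_mul_le_mul_left (a := a - Q ^ 2) (le_trans ?_ hupper) (by linarith)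
    calc (a - Q ^ 2) * (c * a * x ^ 2 * D₃)
        = (c * a ^ 2 * x ^ 2 - Q ^ 2 * (a * (c * x ^ 2))) * D₃ := by ring
      _ ≤ (c * a ^ 2 * x ^ 2 - Q ^ 2) * D₃ := by
        gcongr
        nlinarith

section Two

lemma eq_two_mul_sub_one (h : StarData 2 c a x p D₁ D₂ D₃ N) : p = 2 * a - 1 := by
  linarith [h.mul_sub_one]

lemma two_mul_le (h : StarData 2 2 a x p D₁ D₂ D₃ N) :
    (4 * x ^ 2 - 2) * (a ^ 2 * D₂) ≤ N := by
  obtain rfl := h.eq_two_mul_sub_one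
  have ha := h.four_le_a
  have hD₂ := h.one_le
  have hmain : (2 * a - 1) * (2 * (a + 2) * x ^ 2 * D₂) ≤ (2 * a - 1) * D₁ :=
    mul_le_mul_of_nonneg_left h.lower_bound (by linarith)
  have hslack : 0 ≤ (6 * a - 4) * (x ^ 2 * D₂) := mul_nonneg (by linarith) (by positivity)
  have hloss : 0 ≤ (3 * a - 1) * D₂ := mul_nonneg (by linarith) (by linarith)
  linarith [h.bonferroni]

lemma two_mul_cube_le (h : StarData 2 2 a x p D₁ D₂ D₃ N) :
    2 * (a ^ 3 * x ^ 2 * D₃) ≤ a ^ 2 * D₂ := by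
  linarith [mul_le_mul_of_nonneg_left h.upper_bound (sq_nonneg a)]

lemma star_two (h : StarData 2 2 a x p D₁ D₂ D₃ N) (hb₁ : b₁ = 2 * x - 1) :
    (p - a) * D₁ + b₁ * ((p + 1) ^ 2 * D₂) ≤ N := by
  obtain rfl := h.eq_two_mul_sub_one
  have ha := h.four_le_a
  have hx := h.four_le_x
  have hD₂ := h.one_le
  have hmain : a * (2 * (a + 2) * x ^ 2 * D₂) ≤ a * D₁ :=
    mul_le_mul_of_nonneg_left h.lower_bound (by linarith)
  have hslack : 0 ≤ (2 * (x * (x - 4)) + 2) * (a ^ 2 * D₂) + (4 * x ^ 2 * a + 3 * a - 1) * D₂ := by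
    have hxx : 0 ≤ x * (x - 4) := mul_nonneg (by linarith) (by linarith)
    have hpos : 0 ≤ 4 * x ^ 2 * a + 3 * a - 1 := by nlinarith
    positivity
  rw [hb₁]
  linarith [h.bonferroni]

lemma contain_two (h : StarData 2 2 a x p D₁ D₂ D₃ N) (hg₂ : g₂ ≤ 8 / 3 * x ^ 2) :
    7 * ((p + 1) ^ 2 * D₂) + g₂ * ((p + 1) ^ 3 * D₃) ≤ N := by
  obtain rfl := h.eq_two_mul_sub_one
  have ha := h.four_le_a
  have hx := h.four_le_x
  have hD₂ := h.one_le
  have hD₃ := h.nonneg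
  have hg : g₂ * ((2 * a - 1 + 1) ^ 3 * D₃) ≤ 8 / 3 * x ^ 2 * ((2 * a - 1 + 1) ^ 3 * D₃) := by
    rw [sub_add_cancel]
    gcongr
  have hcoeff : 64 * (a ^ 2 * D₂) ≤ 4 * x ^ 2 * (a ^ 2 * D₂) := by
    gcongr
    nlinarith
  have hpos : 0 ≤ a ^ 2 * D₂ := by positivity
  linarith [h.two_mul_le, h.two_mul_cube_le]

lemma deep_two (h : StarData 2 2 a x p D₁ D₂ D₃ N) (hg₃ : g₃ ≤ 64 / 21 * x ^ 3) :
    g₃ * ((p + 1) ^ 3 * D₃) ≤ N := by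
  obtain rfl := h.eq_two_mul_sub_one
  have ha := h.four_le_a
  have hx := h.four_le_x
  have hD₂ := h.one_le
  have hD₃ := h.nonneg
  have hg : g₃ * ((2 * a - 1 + 1) ^ 3 * D₃) ≤ 64 / 21 * x ^ 3 * ((2 * a - 1 + 1) ^ 3 * D₃) := by
    rw [sub_add_cancel]
    gcongr
  have hcube : x * (2 * (a ^ 3 * x ^ 2 * D₃)) ≤ x * (a ^ 2 * D₂) := by
    gcongr ?_ * ?_
    exact h.two_mul_cube_le
  have hcoeff : (256 / 21 * x + 2) * (a ^ 2 * D₂) ≤ 4 * x ^ 2 * (a ^ 2 * D₂) := by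
    gcongr
    nlinarith
  linarith [h.two_mul_le]

lemma mul_cube_le_two (h : StarData 2 2 a x p D₁ D₂ D₃ N)
    (hg₂ : g₂ * 3 = (4 * x - 1) * (2 * x - 1)) :
    g₂ * (p ^ 3 * D₃) ≤ p * (16 / 3 * ((a - 4) * D₂)) := by
  have ha := h.four_le_a
  have hx := h.four_le_x
  have hp := h.p_nonneg
  have hD₃ := h.nonneg
  have hp_sq : p ^ 2 ≤ 4 * a ^ 2 := by nlinarith [h.eq_two_mul_sub_one]
  have hcoeff : g₂ * p ^ 2 ≤ 16 / 3 * (2 * a ^ 2 * x ^ 2 - 4) := by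
    have hg : g₂ * 3 ≤ 8 * x ^ 2 - 5 * x := by nlinarith
    have hmul : (g₂ * 3) * p ^ 2 ≤ (8 * x ^ 2 - 5 * x) * (4 * a ^ 2) :=
      mul_le_mul hg hp_sq (sq_nonneg p) (by nlinarith)
    have hxa : 4 * 4 ^ 2 ≤ x * a ^ 2 := by gcongr
    linarith
  calc g₂ * (p ^ 3 * D₃) = p * (g₂ * p ^ 2 * D₃) := by ring
    _ ≤ p * (16 / 3 * (2 * a ^ 2 * x ^ 2 - 4) * D₃) := by gcongr p * (?_ * D₃)
    _ ≤ p * (16 / 3 * ((a - 4) * D₂)) := by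
        gcongr p * ?_
        linarith [h.upper]

lemma transversal_coeff_two_le (hx : 4 ≤ x) (ha : 8 ≤ a) :
    (4 * x - 1) * (2 * a) + 11 * (2 * a) ^ 2 + 2 * ((x - 1) * 6 * (2 * (2 * a))) +
      (2 * a - 1) * (16 / 3 * (a - 4)) + (2 * a - 1) * (2 * a - 1 - 1) / 2 + 2 ≤
      (2 * a - 1) * (2 * (a + 2) * x ^ 2) := by
  obtain ⟨u, rfl⟩ : ∃ u, x = 4 + u := ⟨x - 4, by ring⟩
  obtain ⟨v, rfl⟩ : ∃ v, a = 8 + v := ⟨a - 8, by ring⟩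
  have hu : 0 ≤ u := by linarith
  have hv : 0 ≤ v := by linarith
  rw [← sub_nonneg]
  ring_nf
  positivity

lemma transversal_two (h : StarData 2 2 a x p D₁ D₂ D₃ N) (ha : a = 4 ∨ 8 ≤ a)
    (hb₀ : b₀ = x - 1) (hb₂ : b₂ = 4 * x - 1) (hg₂ : g₂ * 3 = (4 * x - 1) * (2 * x - 1)) :
    b₂ * ((p + 1) * D₂) + ((2 + 1) ^ 2 + 2) * ((p + 1) ^ 2 * D₂) +
      2 * (b₀ * (2 ^ 2 + 2) * (2 * ((p + 1) * D₂))) + g₂ * (p ^ 3 * D₃) + 1 < N := by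
  have hg := h.mul_cube_le_two hg₂
  have hN := h.bonferroni
  have hx := h.four_le_x
  have hD₂ := h.one_le
  obtain rfl := h.eq_two_mul_sub_one
  subst hb₀ hb₂
  rcases ha with rfl | ha
  · have hlower : (16 * x ^ 2 - 1) * D₂ ≤ D₁ := by linarith [h.lower]
    have hcoeff : (224 * x + 527) * D₂ ≤ 7 * (16 * x ^ 2 - 1) * D₂ := by
      gcongr
      nlinarith
    linarith
  · have hcoeff := mul_le_mul_of_nonneg_right (transversal_coeff_two_le hx ha)
      (zero_le_one.trans hD₂)
    have hmain : (2 * a - 1) * (2 * (a + 2) * x ^ 2 * D₂) ≤ (2 * a - 1) * D₁ :=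
      mul_le_mul_of_nonneg_left h.lower_bound (by linarith)
    linarith

end Two

section ThreeLe

lemma nine_le_a (h : StarData Q c a x p D₁ D₂ D₃ N) (hQ : 3 ≤ Q) : 9 ≤ a := by
  nlinarith [h.sq_le_a]

lemma nine_le_x (h : StarData Q c a x p D₁ D₂ D₃ N) (hQ : 3 ≤ Q) : 9 ≤ x := by
  nlinarith [h.sq_le_x]

lemma add_three_le (h : StarData Q c a x p D₁ D₂ D₃ N) (hQ : 3 ≤ Q) : a + 3 ≤ p := by
  refine le_of_mul_le_mul_right (a := Q - 1) ?_ (by linarith)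
  nlinarith [h.sq_le_a, h.mul_sub_one]

lemma le_three_halves_mul (h : StarData Q c a x p D₁ D₂ D₃ N) (hQ : 3 ≤ Q) : p ≤ 3 / 2 * a := by
  refine le_of_mul_le_mul_right (a := Q - 1) ?_ (by linarith)
  nlinarith [h.sq_le_a, h.mul_sub_one]

lemma add_one_le (h : StarData Q c a x p D₁ D₂ D₃ N) (hQ : 3 ≤ Q) : p + 1 ≤ 14 / 9 * a := by
  refine le_of_mul_le_mul_right (a := Q - 1) ?_ (by linarith)
  nlinarith [h.nine_le_a hQ, h.mul_sub_one]

lemma add_one_sq_mul_le (h : StarData Q c a x p D₁ D₂ D₃ N) (hQ : 3 ≤ Q) :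
    (p + 1) ^ 2 * D₂ ≤ (14 / 9) ^ 2 * (a ^ 2 * D₂) := by
  have hp := h.p_nonneg
  have hD₂ := h.one_le
  rw [← mul_assoc, ← mul_pow]
  gcongr ?_ ^ 2 * D₂
  exact h.add_one_le hQ

lemma mul_sq_le (h : StarData Q 1 a x p D₁ D₂ D₃ N) (hQ : 3 ≤ Q) :
    (a + 3) * x ^ 2 * D₂ ≤ D₁ := by
  have hD₂ := h.one_le
  calc (a + 3) * x ^ 2 * D₂ ≤ 1 * (a + Q) * x ^ 2 * D₂ := by
        gcongr
        linarith
    _ ≤ D₁ := h.lower_bound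

lemma loss_le (h : StarData Q c a x p D₁ D₂ D₃ N) (hQ : 3 ≤ Q) :
    p * (p - 1) / 2 * D₂ ≤ 9 / 8 * (a ^ 2 * D₂) := by
  have ha := h.nine_le_a hQ
  have hp := h.p_nonneg
  have hD₂ := h.one_le
  rw [← mul_assoc]
  gcongr
  nlinarith [h.le_three_halves_mul hQ]

lemma three_le_mul_le (h : StarData Q 1 a x p D₁ D₂ D₃ N) (hQ : 3 ≤ Q) :
    (a ^ 2 * x ^ 2 + 6 * (a * x ^ 2)) * D₂ ≤ N + 9 / 8 * (a ^ 2 * D₂) := by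
  have ha := h.nine_le_a hQ
  have hD₂ := h.one_le
  have hmain : (a + 3) * ((a + 3) * x ^ 2 * D₂) ≤ p * D₁ :=
    mul_le_mul (h.add_three_le hQ) (h.mul_sq_le hQ) (by positivity) h.p_nonneg
  have hpos : 0 ≤ x ^ 2 * D₂ := by positivity
  linarith [h.loss_le hQ, h.bonferroni]

lemma sq_mul_cube_le (h : StarData Q 1 a x p D₁ D₂ D₃ N) {r e : ℝ} (hr : 0 ≤ r)
    (hra : r ≤ e * a) : x ^ 2 * (r ^ 3 * D₃) ≤ e ^ 3 * (a ^ 2 * D₂) := by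
  have ha := h.four_le_a
  have hD₃ := h.nonneg
  have he : 0 ≤ e := by nlinarith
  calc x ^ 2 * (r ^ 3 * D₃) ≤ x ^ 2 * ((e * a) ^ 3 * D₃) := by gcongr
    _ = e ^ 3 * a ^ 2 * (1 * a * x ^ 2 * D₃) := by ring
    _ ≤ e ^ 3 * a ^ 2 * D₂ := by
        gcongr
        exact h.upper_bound
    _ = _ := by ring

lemma star_of_three_le (h : StarData Q 1 a x p D₁ D₂ D₃ N) (hQ : 3 ≤ Q) (hb₁ : b₁ ≤ 3 / 2 * x) :
    (p - a) * D₁ + b₁ * ((p + 1) ^ 2 * D₂) ≤ N := by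
  have ha := h.nine_le_a hQ
  have hx := h.nine_le_x hQ
  have hp := h.p_nonneg
  have hD₂ := h.one_le
  have hb : b₁ * ((p + 1) ^ 2 * D₂) ≤ 3 / 2 * x * ((14 / 9) ^ 2 * (a ^ 2 * D₂)) :=
    mul_le_mul hb₁ (h.add_one_sq_mul_le hQ) (by positivity) (by positivity)
  have hmain : a * ((a + 3) * x ^ 2 * D₂) ≤ a * D₁ :=
    mul_le_mul_of_nonneg_left (h.mul_sq_le hQ) (by linarith)
  have hcoeff : (15 / 4 * x + 9 / 8) * (a ^ 2 * D₂) ≤ x ^ 2 * (a ^ 2 * D₂) := by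
    gcongr
    nlinarith
  have hpos : 0 ≤ a * x ^ 2 * D₂ := by positivity
  have hpos' : 0 ≤ x * (a ^ 2 * D₂) := by positivity
  linarith [h.loss_le hQ, h.bonferroni]

lemma contain_of_three_le (h : StarData Q 1 a x p D₁ D₂ D₃ N) (hQ : 3 ≤ Q)
    (hg₂ : g₂ ≤ 27 / 16 * x ^ 2) :
    (Q ^ 2 + Q + 1) * ((p + 1) ^ 2 * D₂) + g₂ * ((p + 1) ^ 3 * D₃) ≤ N := by
  have ha := h.nine_le_a hQ
  have hx := h.nine_le_x hQ
  have hp := h.p_nonneg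
  have hD₂ := h.one_le
  have hD₃ := h.nonneg
  have hcube := h.sq_mul_cube_le (by linarith) (h.add_one_le hQ)
  have hg : g₂ * ((p + 1) ^ 3 * D₃) ≤ 27 / 16 * x ^ 2 * ((p + 1) ^ 3 * D₃) := by gcongr
  have hQx : (Q ^ 2 + Q + 1) * ((p + 1) ^ 2 * D₂) ≤ 2 * x * ((14 / 9) ^ 2 * (a ^ 2 * D₂)) :=
    mul_le_mul (by nlinarith [h.sq_le_x]) (h.add_one_sq_mul_le hQ) (by positivity) (by positivity)
  have hcoeff : (5 * x + 10) * (a ^ 2 * D₂) ≤ x ^ 2 * (a ^ 2 * D₂) := by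
    gcongr
    nlinarith
  have hpos : 0 ≤ a * x ^ 2 * D₂ := by positivity
  have hpos' : 0 ≤ x * (a ^ 2 * D₂) := by positivity
  have hpos'' : 0 ≤ a ^ 2 * D₂ := by positivity
  linarith [h.three_le_mul_le hQ]

lemma deep_of_three_le (h : StarData Q 1 a x p D₁ D₂ D₃ N) (hQ : 3 ≤ Q)
    (hg₃ : g₃ ≤ 9 / 5 * x ^ 3) : g₃ * ((p + 1) ^ 3 * D₃) ≤ N := by
  have ha := h.nine_le_a hQ
  have hx := h.nine_le_x hQ
  have hp := h.p_nonneg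
  have hD₂ := h.one_le
  have hD₃ := h.nonneg
  have hg : g₃ * ((p + 1) ^ 3 * D₃) ≤ 9 / 5 * x ^ 3 * ((p + 1) ^ 3 * D₃) := by gcongr
  have hcube : x * (x ^ 2 * ((p + 1) ^ 3 * D₃)) ≤ x * ((14 / 9) ^ 3 * (a ^ 2 * D₂)) := by
    gcongr x * ?_
    exact h.sq_mul_cube_le (by linarith) (h.add_one_le hQ)
  have hcoeff : (9 / 5 * (14 / 9) ^ 3 * x + 9 / 8) * (a ^ 2 * D₂) ≤ x ^ 2 * (a ^ 2 * D₂) := by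
    gcongr
    nlinarith
  have hpos : 0 ≤ a * x ^ 2 * D₂ := by positivity
  linarith [h.three_le_mul_le hQ]

lemma transversal_of_three_le (h : StarData Q 1 a x p D₁ D₂ D₃ N) (hQ : 3 ≤ Q)
    (hg₂ : g₂ ≤ 27 / 16 * x ^ 2) (hb₂ : b₂ ≤ x ^ 2 / 2) (hb₀ : b₀ * (Q ^ 2 + Q) * Q ≤ 2 * x ^ 2) :
    b₂ * ((p + 1) * D₂) + ((Q + 1) ^ 2 + 2) * ((p + 1) ^ 2 * D₂) +
      2 * (b₀ * (Q ^ 2 + Q) * (Q * ((p + 1) * D₂))) + g₂ * (p ^ 3 * D₃) + 1 < N := by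
  have ha := h.nine_le_a hQ
  have hx := h.nine_le_x hQ
  have hp := h.p_nonneg
  have hD₂ := h.one_le
  have hD₃ := h.nonneg
  have hbranch : (p + 1) * D₂ ≤ 14 / 9 * a * D₂ := by
    gcongr ?_ * D₂
    exact h.add_one_le hQ
  have hb₂_mul : b₂ * ((p + 1) * D₂) ≤ x ^ 2 / 2 * (14 / 9 * a * D₂) :=
    mul_le_mul hb₂ hbranch (by positivity) (by positivity)
  have hb₀_mul : b₀ * (Q ^ 2 + Q) * Q * ((p + 1) * D₂) ≤ 2 * x ^ 2 * (14 / 9 * a * D₂) :=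
    mul_le_mul hb₀ hbranch (by positivity) (by positivity)
  have hQx : ((Q + 1) ^ 2 + 2) * ((p + 1) ^ 2 * D₂) ≤ 2 * x * ((14 / 9) ^ 2 * (a ^ 2 * D₂)) :=
    mul_le_mul (by nlinarith [h.sq_le_x]) (h.add_one_sq_mul_le hQ) (by positivity) (by positivity)
  have hg : g₂ * (p ^ 3 * D₃) ≤ 27 / 16 * x ^ 2 * (p ^ 3 * D₃) := by gcongr
  have hcube := h.sq_mul_cube_le (by linarith) (h.le_three_halves_mul hQ)
  have hcoeff : (2 * (14 / 9) ^ 2 * x + 8) * (a ^ 2 * D₂) ≤ 7 / 9 * x ^ 2 * (a ^ 2 * D₂) := by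
    gcongr
    nlinarith
  have hlinear : 9 * (a * x ^ 2 * D₂) ≤ a * (a * x ^ 2 * D₂) := by gcongr
  have hconst : 81 * D₂ ≤ a ^ 2 * D₂ := by
    gcongr
    nlinarith
  have hpos : 0 ≤ a * x ^ 2 * D₂ := by positivity
  linarith [h.three_le_mul_le hQ]

end ThreeLe

end StarData

lemma numAbove_mul_pow_sub (q : ℕ) {n t d i : ℕ} (hi : i ≤ d) (hn : t + d ≤ n) :
    numAbove q n (t + d) (t + i) * ((q : ℝ) ^ d - (q : ℝ) ^ i) =
      ((q : ℝ) ^ (n - t) - (q : ℝ) ^ i) * numAbove q n (t + d) (t + i + 1) := by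
  obtain ⟨e, rfl⟩ := Nat.exists_eq_add_of_le hi
  obtain ⟨m, rfl⟩ := Nat.exists_eq_add_of_le hn
  have h := numAbove_mul_qInt q (show t + i ≤ t + (i + e) by omega) hn
  have hd := qInt_mul_sub_one q e
  have hn := qInt_mul_sub_one q (e + m)
  rw [show t + (i + e) - (t + i) = e by omega,
    show t + (i + e) + m - (t + i) = e + m by omega] at h
  rw [show t + (i + e) + m - t = i + (e + m) by omega, pow_add, pow_add (q : ℝ) i]
  linear_combination (q : ℝ) ^ i * ((q : ℝ) - 1) * h -
    (q : ℝ) ^ i * numAbove q (t + (i + e) + m) (t + (i + e)) (t + i) * hd +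
    (q : ℝ) ^ i * numAbove q (t + (i + e) + m) (t + (i + e)) (t + i + 1) * hn

lemma starData_of_le {q n t d : ℕ} {c N : ℝ} (hq : 2 ≤ q) (ht : 2 ≤ t) (hd : 2 ≤ d) (hc : 1 ≤ c)
    (hn : t + d ≤ n) (hpow : c * ((q : ℝ) ^ d) ^ 2 * ((q : ℝ) ^ t) ^ 2 ≤ (q : ℝ) ^ (n - t))
    (hN : (qInt q (d + 1) : ℝ) * numAbove q n (t + d) (t + 1) ≤
      N + qInt q (d + 1) * ((qInt q (d + 1) : ℝ) - 1) / 2 * numAbove q n (t + d) (t + 2)) :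
    StarData q c ((q : ℝ) ^ d) ((q : ℝ) ^ t) (qInt q (d + 1)) (numAbove q n (t + d) (t + 1))
      (numAbove q n (t + d) (t + 2)) (numAbove q n (t + d) (t + 3)) N where
  two_le := by exact_mod_cast hq
  one_le_slack := hc
  sq_le_a := pow_le_pow_right₀ (by exact_mod_cast one_le_two.trans hq) hd
  sq_le_x := pow_le_pow_right₀ (by exact_mod_cast one_le_two.trans hq) ht
  mul_sub_one := by rw [qInt_mul_sub_one, pow_succ']
  lower := by
    have h := numAbove_mul_pow_sub q (show 1 ≤ d by omega) hn
    rw [pow_one] at h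
    rw [mul_comm (_ - _) (numAbove _ _ _ (t + 1)), h]
    gcongr
    exact numAbove_nonneg q hn _
  upper := by
    have h := numAbove_mul_pow_sub q hd hn
    rw [mul_comm (_ - _) (numAbove _ _ _ (t + 2)), h]
    gcongr
    exact numAbove_nonneg q hn _
  one_le := one_le_numAbove q (by omega) hn
  nonneg := numAbove_nonneg q hn _
  bonferroni := hN

/-- The numerical inequalities by which a set of `N` spaces outnumbers the families that are not of
the form `familyH`. -/
structure Dominates (q n t d : ℕ) (N : ℝ) : Prop where
  star : (qInt q d : ℝ) * numAbove q n (t + d) (t + 1) +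
    qInt q (t + 1) * (branching q d ^ 2 * numAbove q n (t + d) (t + 2)) ≤ N
  contain : (qInt q 3 : ℝ) * (branching q d ^ 2 * numAbove q n (t + d) (t + 2)) +
    gaussBinom q (t + 2) 2 * (branching q d ^ 3 * numAbove q n (t + d) (t + 3)) ≤ N
  deep : gaussBinom q (t + 3) 3 * (branching q d ^ 3 * numAbove q n (t + d) (t + 3)) ≤ N
  transversal : (qInt q (t + 2) : ℝ) * (branching q d * numAbove q n (t + d) (t + 2)) +
    (((q : ℝ) + 1) ^ 2 + 2) * (branching q d ^ 2 * numAbove q n (t + d) (t + 2)) +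
    2 * (qInt q t * ((q : ℝ) ^ 2 + q) * (q * (branching q d * numAbove q n (t + d) (t + 2)))) +
    gaussBinom q (t + 2) 2 * ((qInt q (d + 1) : ℝ) ^ 3 * numAbove q n (t + d) (t + 3)) + 1 < N

lemma qInt_eq_sub_pow (q d : ℕ) : (qInt q d : ℝ) = qInt q (d + 1) - (q : ℝ) ^ d := by
  rw [qInt, qInt, Finset.sum_range_succ]
  push_cast
  ring

lemma dominates_two {n t d : ℕ} {N : ℝ} (ht : 2 ≤ t) (hd : 2 ≤ d) (hn : 2 * (t + d) + t + 1 ≤ n)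
    (hN : (qInt 2 (d + 1) : ℝ) * numAbove 2 n (t + d) (t + 1) ≤
      N + qInt 2 (d + 1) * ((qInt 2 (d + 1) : ℝ) - 1) / 2 * numAbove 2 n (t + d) (t + 2)) :
    Dominates 2 n t d N := by
  have hpow : 2 * (((2 : ℕ) : ℝ) ^ d) ^ 2 * (((2 : ℕ) : ℝ) ^ t) ^ 2 ≤ ((2 : ℕ) : ℝ) ^ (n - t) := by
    calc 2 * (((2 : ℕ) : ℝ) ^ d) ^ 2 * (((2 : ℕ) : ℝ) ^ t) ^ 2 = 2 ^ (2 * t + 2 * d + 1) := by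
          push_cast; ring
      _ ≤ ((2 : ℕ) : ℝ) ^ (n - t) := by
          push_cast
          exact pow_le_pow_right₀ one_le_two (by omega)
  have h := starData_of_le le_rfl ht hd one_le_two (by omega) hpow hN
  have ha : (2 : ℝ) ^ d = 4 ∨ (8 : ℝ) ≤ 2 ^ d := by
    rcases hd.eq_or_lt with rfl | hd
    · exact Or.inl (by norm_num)
    · exact Or.inr (le_trans (by norm_num) (pow_le_pow_right₀ (one_le_two (α := ℝ)) hd))
  have hqInt (i : ℕ) : (qInt 2 (t + i) : ℝ) = 2 ^ i * 2 ^ t - 1 := by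
    have := qInt_mul_sub_one 2 (t + i)
    push_cast at this
    rw [← pow_add, add_comm i t]
    linarith
  have hg₂ := gaussBinom_add_two_mul 2 t
  push_cast at h hg₂
  refine ⟨?_, ?_, ?_, ?_⟩
  · rw [qInt_eq_sub_pow]
    push_cast
    exact h.star_two (by simpa using hqInt 1)
  · rw [qInt_three]
    push_cast
    exact h.contain_two (gaussBinom_two_add_two_le t)
  · exact h.deep_two (gaussBinom_two_add_three_le t)
  · push_cast
    exact h.transversal_two ha (by simpa using hqInt 0) (by rw [hqInt]; norm_num) (by linarith)

lemma dominates_of_three_le {q n t d : ℕ} {N : ℝ} (hq : 3 ≤ q) (ht : 2 ≤ t) (hd : 2 ≤ d)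
    (hn : 2 * (t + d) + t ≤ n)
    (hN : (qInt q (d + 1) : ℝ) * numAbove q n (t + d) (t + 1) ≤
      N + qInt q (d + 1) * ((qInt q (d + 1) : ℝ) - 1) / 2 * numAbove q n (t + d) (t + 2)) :
    Dominates q n t d N := by
  have hq' : (3 : ℝ) ≤ q := by exact_mod_cast hq
  have hpow : 1 * ((q : ℝ) ^ d) ^ 2 * ((q : ℝ) ^ t) ^ 2 ≤ (q : ℝ) ^ (n - t) := by
    calc 1 * ((q : ℝ) ^ d) ^ 2 * ((q : ℝ) ^ t) ^ 2 = (q : ℝ) ^ (2 * t + 2 * d) := by ring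
      _ ≤ (q : ℝ) ^ (n - t) := pow_le_pow_right₀ (by linarith) (by omega)
  have h := starData_of_le (by omega) ht hd le_rfl (by omega) hpow hN
  refine ⟨?_, ?_, ?_, ?_⟩
  · rw [qInt_eq_sub_pow]
    exact h.star_of_three_le hq' (qInt_succ_le hq t)
  · rw [qInt_three]
    push_cast
    exact h.contain_of_three_le hq' (gaussBinom_add_two_le hq)
  · exact h.deep_of_three_le hq' (gaussBinom_add_three_le hq)
  · exact h.transversal_of_three_le hq' (gaussBinom_add_two_le hq) (qInt_add_two_le hq ht)
      (qInt_mul_sq_add_mul_le hq ht)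

/-! ### The case `t + 2 ≤ k` -/

lemma qInt_add (q i j : ℕ) : qInt q (i + j) = qInt q i + q ^ i * qInt q j := by
  rw [qInt, Finset.sum_range_add, qInt, qInt, Finset.mul_sum]
  simp only [pow_add]

lemma qInt_lt_pow {q : ℕ} (hq : 2 ≤ q) (i : ℕ) : qInt q i < q ^ i := by
  induction i with
  | zero => rw [qInt_zero, pow_zero]; exact one_pos
  | succ i ih =>
    rw [qInt_add, qInt_one, pow_succ]
    nlinarith

lemma branching_le_pow {q : ℕ} (hq : 2 ≤ q) (d : ℕ) : branching q d ≤ (q : ℝ) ^ (d + 1) := by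
  rw [branching]
  exact_mod_cast qInt_lt_pow hq (d + 1)

lemma gaussBinom_succ_left_le {q t m : ℕ} (hq : 2 ≤ q) (htm : t ≤ m) :
    gaussBinom q (m + 1) t ≤ 2 * q ^ t * gaussBinom q m t := by
  obtain ⟨e, rfl⟩ := Nat.exists_eq_add_of_le htm
  have hmul := gaussBinom_succ_left_mul q htm
  rw [add_assoc, Nat.add_sub_cancel_left] at hmul
  have hqInt : (qInt q (t + (e + 1)) : ℝ) ≤ 2 * q ^ t * qInt q (e + 1) := by
    have hlt : (qInt q t : ℝ) ≤ q ^ t := by exact_mod_cast (qInt_lt_pow hq t).le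
    have hone : (1 : ℝ) ≤ qInt q (e + 1) := by
      exact_mod_cast (qInt_one q).ge.trans (qInt_mono q (Nat.le_add_left 1 e))
    rw [qInt_add]
    push_cast
    nlinarith [le_mul_of_one_le_right (by positivity : (0 : ℝ) ≤ q ^ t) hone]
  refine le_of_mul_le_mul_right ?_ (qInt_succ_pos q e)
  calc gaussBinom q (t + (e + 1)) t * qInt q (e + 1)
      = qInt q (t + (e + 1)) * gaussBinom q (t + e) t := hmul
    _ ≤ 2 * q ^ t * qInt q (e + 1) * gaussBinom q (t + e) t := by
        gcongr
        exact zero_le_one.trans (one_le_gaussBinom q htm)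
    _ = 2 * q ^ t * gaussBinom q (t + e) t * qInt q (e + 1) := by ring

lemma pow_mul_numAbove_succ_le (q : ℕ) {n k m : ℕ} (hmk : m < k) (hkn : k ≤ n) :
    (q : ℝ) ^ (n - k) * numAbove q n k (m + 1) ≤ numAbove q n k m := by
  obtain ⟨e, rfl⟩ := Nat.exists_eq_add_of_lt hmk
  have hmul := numAbove_mul_qInt q hmk.le hkn
  rw [show m + e + 1 - m = e + 1 by omega,
    show n - m = n - (m + e + 1) + (e + 1) by omega, qInt_add q (n - _)] at hmul
  push_cast at hmul
  refine le_of_mul_le_mul_right ?_ (qInt_succ_pos q e)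
  rw [hmul, mul_right_comm]
  gcongr
  · exact numAbove_nonneg q hkn _
  · exact le_add_of_nonneg_left (Nat.cast_nonneg _)

lemma minimal_cover_bound_succ_le {q n k t m : ℕ} (hq : 2 ≤ q) (htm : t ≤ m) (hmk : m < k)
    (hn : 2 * k + 2 ≤ n) :
    gaussBinom q (m + 1) t * (branching q (k - t) ^ (m + 1 - t) * numAbove q n k (m + 1)) ≤
      gaussBinom q m t * (branching q (k - t) ^ (m - t) * numAbove q n k m) := by
  have hq' : (2 : ℝ) ≤ q := by exact_mod_cast hq
  have hone := one_le_branching q (k - t)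
  have hbranch : 2 * q ^ t * branching q (k - t) ≤ (q : ℝ) ^ (n - k) := by
    calc 2 * q ^ t * branching q (k - t) ≤ q * q ^ t * (q : ℝ) ^ (k - t + 1) := by
          gcongr ?_ * _ * ?_
          exact branching_le_pow hq _
      _ = (q : ℝ) ^ (1 + t + (k - t + 1)) := by ring
      _ ≤ (q : ℝ) ^ (n - k) := pow_le_pow_right₀ (by linarith) (by omega)
  have hnum := numAbove_nonneg q (show k ≤ n by omega) (m + 1)
  have hgauss := zero_le_one.trans (one_le_gaussBinom q htm)
  rw [Nat.succ_sub htm, pow_succ]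
  set b := branching q (k - t)
  calc gaussBinom q (m + 1) t * (b ^ (m - t) * b * numAbove q n k (m + 1))
      ≤ 2 * q ^ t * gaussBinom q m t * (b ^ (m - t) * b * numAbove q n k (m + 1)) := by
        gcongr
        exact gaussBinom_succ_left_le hq htm
    _ = gaussBinom q m t * (b ^ (m - t) * (2 * q ^ t * b * numAbove q n k (m + 1))) := by ring
    _ ≤ gaussBinom q m t * (b ^ (m - t) * (q ^ (n - k) * numAbove q n k (m + 1))) := by gcongr
    _ ≤ gaussBinom q m t * (b ^ (m - t) * numAbove q n k m) := by
        gcongr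
        exact pow_mul_numAbove_succ_le q hmk (by omega)

lemma minimal_cover_bound_le {q n k t m : ℕ} (hq : 2 ≤ q) (hm : t + 3 ≤ m) (hmk : m ≤ k)
    (hn : 2 * k + 2 ≤ n) :
    gaussBinom q m t * (branching q (k - t) ^ (m - t) * numAbove q n k m) ≤
      gaussBinom q (t + 3) 3 * (branching q (k - t) ^ 3 * numAbove q n k (t + 3)) := by
  induction m, hm using Nat.le_induction with
  | base => rw [gaussBinom_symm, Nat.add_sub_cancel_left]
  | succ m hm ih =>
    exact (minimal_cover_bound_succ_le hq (by omega) (by omega) hn).trans (ih (by omega))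

section LargeDimension

variable {t d : ℕ} {𝓕 : Set (Submodule K V)} {U₁ U₂ : Submodule K V}

lemma IsBadPair.isTransversal [FiniteDimensional K V] {k : ℕ} (h : IsBadPair k t 𝓕 U₁ U₂)
    {S : Submodule K V} (hS : dim S = t + 2) (h₁ : t ≤ dim (S ⊓ U₁)) (h₂ : t ≤ dim (S ⊓ U₂))
    (hW : dim (S ⊓ (U₁ ⊓ U₂)) + 2 ≤ t) : IsTransversal k t U₁ U₂ S := by
  have hsum := dim_sup_add_dim_inf (S ⊓ U₁) (S ⊓ U₂)
  rw [← inf_inf_distrib_left] at hsum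
  have hle : dim (S ⊓ U₁ ⊔ S ⊓ U₂) ≤ dim S := dim_mono (sup_le inf_le_left inf_le_left)
  exact ⟨h.dim_left, h.dim_right, h.lt, hS, by omega, by omega, by omega⟩

lemma Dominates.sq_mul_lt {q n : ℕ} {N : ℝ} (h : Dominates q n t d N) (hd : 2 ≤ d)
    (hn : t + d ≤ n) :
    (qInt q (d + 1) : ℝ) * (qInt q (d + 1) * numAbove q n (t + d) (t + 2)) < N := by
  have hone : ∀ i, 1 ≤ i → (1 : ℝ) ≤ qInt q i := fun i hi => by
    exact_mod_cast (qInt_one q).ge.trans (qInt_mono q hi)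
  have hnum := one_le_numAbove q (show t + 1 ≤ t + d by omega) hn
  have hnonneg := numAbove_nonneg q hn (t + 2)
  calc (qInt q (d + 1) : ℝ) * (qInt q (d + 1) * numAbove q n (t + d) (t + 2))
      = (qInt q (d + 1) : ℝ) ^ 2 * numAbove q n (t + d) (t + 2) := by ring
    _ ≤ branching q d ^ 2 * numAbove q n (t + d) (t + 2) := by
        gcongr
        exact le_add_of_nonneg_right zero_le_one
    _ ≤ qInt q (t + 1) * (branching q d ^ 2 * numAbove q n (t + d) (t + 2)) :=
        le_mul_of_one_le_left (by positivity) (hone _ (by omega))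
    _ < qInt q d * numAbove q n (t + d) (t + 1) +
          qInt q (t + 1) * (branching q d ^ 2 * numAbove q n (t + d) (t + 2)) :=
        lt_add_of_pos_left _ (mul_pos (by linarith [hone d (by omega)]) (by linarith))
    _ ≤ N := h.star

variable [FiniteDimensional K V] [Finite K]

lemma exists_dominates (ht : 2 ≤ t) (hd : 2 ≤ d)
    (hn : 2 * (t + d) + t + (if Nat.card K = 2 then 1 else 0) ≤ Module.finrank K V)
    (hmax : IsMaximumProperAlmost (t + d) t 𝓕) :
    ∃ N : ℝ, N + 2 ≤ 𝓕.ncard ∧ Dominates (Nat.card K) (Module.finrank K V) t d N := by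
  obtain ⟨X₁, X₂, E, hX₁, hX₂, hE, hEX, hXE, hX⟩ :=
    exists_familyH_spaces (K := K) (V := V) (k := t + d) (t := t) (by omega) (by omega) (by omega)
  have hEX₂ : E ⊓ X₂ = X₁ ⊓ X₂ :=
    le_antisymm (inf_le_inf_right _ hEX) (le_inf hXE inf_le_right)
  have hle := hmax.2 _ (isProperAlmost_familyH hX₁ hX₂ hE hEX (by omega))
  rw [ncard_familyH hE hEX (by omega)] at hle
  have hstar := le_ncard_star (K := K) (V := V) (k := t + d) (by omega) hE hX₂ (by omega)
    (by rw [hEX₂]; omega)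
  rw [Nat.add_sub_cancel_left] at hstar
  refine ⟨({F ∈ subspaces K V (t + d) | E ≤ F ∧ t ≤ dim (F ⊓ X₂)}.ncard : ℕ),
    by exact_mod_cast hle, ?_⟩
  rcases (Nat.succ_le_of_lt (Finite.one_lt_card (α := K))).eq_or_lt with hq | hq
  · rw [← hq] at hstar hn ⊢
    exact dominates_two ht hd (by simpa using hn) hstar
  · exact dominates_of_three_le hq ht hd (by omega) hstar

lemma ncard_le_ncard_sdiff_pair_add_two {α : Type*} [Finite α] (s : Set α) (a b : α) :
    s.ncard ≤ (s \ {a, b}).ncard + 2 :=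
  (Set.ncard_le_ncard_sdiff_add_ncard s {a, b}).trans (Nat.add_le_add_left
    ((Set.ncard_insert_le a {b}).trans_eq (congrArg (· + 1) (Set.ncard_singleton b))) _)

lemma ncard_above_le_sq_mul_of_le_dim_inf {𝓐 : Set (Submodule K V)} {k : ℕ} {R U : Submodule K V}
    (h𝓐 : ∀ F ∈ 𝓐, dim F = k) (hkn : k ≤ Module.finrank K V) (hlt : dim (R ⊓ U) + 1 < t)
    (htU : t ≤ dim U) (hmeet : ∀ F ∈ 𝓐, R ≤ F → t ≤ dim (F ⊓ U)) :
    ({F ∈ 𝓐 | R ≤ F}.ncard : ℝ) ≤ qInt (Nat.card K) (dim U - t + 1) *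
      (qInt (Nat.card K) (dim U - t + 1) *
        numAbove (Nat.card K) (Module.finrank K V) k (dim R + 2)) := by
  refine ncard_above_le_mul_of_le_dim_inf (by omega) htU hmeet fun C hC => ?_
  have hCU : dim (C ⊓ U) < t := by
    have hsum := dim_sup_add_dim_inf C U
    have hsumR := dim_sup_add_dim_inf R U
    have hle : dim (R ⊔ U) ≤ dim (C ⊔ U) := dim_mono (sup_le_sup_right hC.1 U)
    have hdim := hC.2.2
    omega
  refine ncard_above_le_mul_of_le_dim_inf hCU htU
    (fun F hF hCF => hmeet F hF (hC.1.trans hCF)) fun C' hC' => ?_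
  have hle := ncard_above_le h𝓐 hkn C'
  rwa [hC'.2.2, hC.2.2] at hle

namespace IsBadPair

variable {N : ℝ}

lemma dim_inf_of_large_star (h : IsBadPair (t + d) t 𝓕 U₁ U₂) (hd : 2 ≤ d)
    (hn : t + d ≤ Module.finrank K V) (hN : N + 2 ≤ 𝓕.ncard)
    (hdom : Dominates (Nat.card K) (Module.finrank K V) t d N) {E : Submodule K V}
    (hE : dim E = t) (hEU : E ≤ U₁) (hstar : ∀ F ∈ 𝓕, F ≠ U₁ → F ≠ U₂ → E ≤ F) :
    dim (E ⊓ U₂) + 1 = t := by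
  have hlt : dim (E ⊓ U₂) < t := (dim_mono (inf_le_inf_right U₂ hEU)).trans_lt h.lt
  by_contra hne
  have hne₁ : ∀ F ∈ 𝓕 \ {U₁, U₂}, F ≠ U₁ := fun F hF hF₁ => hF.2 (Or.inl hF₁)
  have hne₂ : ∀ F ∈ 𝓕 \ {U₁, U₂}, F ≠ U₂ := fun F hF hF₂ => hF.2 (Or.inr hF₂)
  have hle := ncard_above_le_sq_mul_of_le_dim_inf (𝓐 := 𝓕 \ {U₁, U₂}) (R := E) (U := U₂)
    (fun F hF => h.dim_eq F hF.1) hn (by omega) (by rw [h.dim_right]; omega)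
    fun F hF _ => h.le_dim_inf_right hF.1 (hne₁ F hF)
  have hall : {F ∈ 𝓕 \ {U₁, U₂} | E ≤ F} = 𝓕 \ {U₁, U₂} :=
    Set.sep_eq_self_iff_mem_true.2 fun F hF => hstar F hF.1 (hne₁ F hF) (hne₂ F hF)
  rw [hall, h.dim_right, hE, Nat.add_sub_cancel_left] at hle
  have hcard : (𝓕.ncard : ℝ) ≤ (𝓕 \ {U₁, U₂}).ncard + 2 := by
    exact_mod_cast ncard_le_ncard_sdiff_pair_add_two 𝓕 U₁ U₂
  have hlarge := hdom.sq_mul_lt hd hn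
  linarith

lemma exists_minimal_isQuasiCover (h : IsBadPair (t + d) t 𝓕 U₁ U₂)
    (hne : ∃ F ∈ 𝓕, F ≠ U₁ ∧ F ≠ U₂) :
    ∃ S, IsQuasiCover t 𝓕 U₁ U₂ S ∧ t < dim S ∧ dim S ≤ t + d ∧
      ∀ Q, dim Q < dim S → ¬ IsCover t 𝓕 Q := by
  obtain ⟨F, hF, hF₁, hF₂⟩ := hne
  have hFq := h.isQuasiCover_of_mem hF hF₁ hF₂
  obtain ⟨S, hS, hmin⟩ := Set.exists_min_image {S | IsQuasiCover t 𝓕 U₁ U₂ S} dim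
    (Set.toFinite _) ⟨F, hFq⟩
  exact ⟨S, hS, lt_dim_of_le_dim_inf h.lt hS.1 hS.2.1, (hmin F hFq).trans_eq (h.dim_eq F hF),
    fun Q hQ hQc => hQ.not_ge (hmin Q (h.isQuasiCover_of_isCover hQc))⟩

lemma lt_dim_inf_inf_of_isQuasiCover (h : IsBadPair (t + d) t 𝓕 U₁ U₂) (hd : 2 ≤ d)
    (hn : t + d ≤ Module.finrank K V) (hN : N + 2 ≤ 𝓕.ncard)
    (hdom : Dominates (Nat.card K) (Module.finrank K V) t d N)
    (hmin : ∀ Q, dim Q < t + 2 → ¬ IsCover t 𝓕 Q) {Q : Submodule K V} (hQ : dim Q = t + 2)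
    (hQq : IsQuasiCover t 𝓕 U₁ U₂ Q) : t < dim (Q ⊓ (U₁ ⊓ U₂)) + 2 := by
  by_contra! hQW
  have htr := h.isTransversal hQ hQq.1 hQq.2.1 hQW
  set 𝓐 := {F ∈ 𝓕 | t ≤ dim (F ⊓ Q)} \ {U₁, U₂}
  have hpow (j : ℕ) (R : Submodule K V) (hR : dim R + j = t + 2) :
      ({F ∈ 𝓐 | R ≤ F}.ncard : ℝ) ≤ branching (Nat.card K) (t + d - t) ^ j *
        numAbove (Nat.card K) (Module.finrank K V) (t + d) (t + 2) :=
    ncard_above_le_pow_mul_numAbove h.dim_eq h.almost (fun F hF => hF.1.1) (by omega) hn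
      (by omega) (fun Q hQ _ => hmin Q hQ) R hR
  have hle := htr.ncard_le hn (𝓐 := 𝓐)
    (fun F hF => ⟨h.dim_eq F hF.1.1, h.le_dim_inf_left hF.1.1 fun hF₂ => hF.2 (Or.inr hF₂),
      h.le_dim_inf_right hF.1.1 fun hF₁ => hF.2 (Or.inl hF₁)⟩)
    (fun F hF => hF.1.2) (fun R hR => hpow 2 R (by omega)) fun R hR => hpow 1 R (by omega)
  rw [Nat.add_sub_cancel_left, pow_one] at hle
  have hexc := cast_ncard_le_one_add hQq.2.2
  have hcard : ({F ∈ 𝓕 | t ≤ dim (F ⊓ Q)}.ncard : ℝ) ≤ 𝓐.ncard + 2 := by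
    exact_mod_cast ncard_le_ncard_sdiff_pair_add_two _ U₁ U₂
  have htransversal := hdom.transversal
  linarith

lemma not_minimal_isQuasiCover_add_two (h : IsBadPair (t + d) t 𝓕 U₁ U₂) (hd : 2 ≤ d)
    (hn : t + d ≤ Module.finrank K V) (hN : N + 2 ≤ 𝓕.ncard)
    (hdom : Dominates (Nat.card K) (Module.finrank K V) t d N) {S : Submodule K V}
    (hS : dim S = t + 2) (hSq : IsQuasiCover t 𝓕 U₁ U₂ S) :
    ¬ ∀ Q, dim Q < t + 2 → ¬ IsCover t 𝓕 Q := by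
  intro hmin
  have hlt := h.lt
  have hlarge {Q : Submodule K V} (hQ : dim Q = t + 2) (hQq : IsQuasiCover t 𝓕 U₁ U₂ Q) :=
    h.lt_dim_inf_inf_of_isQuasiCover hd hn hN hdom hmin hQ hQq
  have hW : dim (U₁ ⊓ U₂) + 1 = t := by
    have hSW := hlarge hS hSq
    have hle : dim (S ⊓ (U₁ ⊓ U₂)) ≤ dim (U₁ ⊓ U₂) := dim_mono inf_le_right
    omega
  have hcont : ∀ Q, dim Q = t + 2 → IsQuasiCover t 𝓕 U₁ U₂ Q → U₁ ⊓ U₂ ≤ Q := fun Q hQ hQq => by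
    have hQW := hlarge hQ hQq
    exact inf_eq_right.1 (Submodule.eq_of_le_of_finrank_le inf_le_right
      (show dim _ ≤ dim _ by omega))
  have hle := h.ncard_le_of_forall_inf_le (by omega) hn hS hSq hW hmin hcont
  rw [Nat.add_sub_cancel_left] at hle
  have hcontain := hdom.contain
  linarith

lemma exists_star_of_large (h : IsBadPair (t + d) t 𝓕 U₁ U₂) (hd : 2 ≤ d)
    (hn : 2 * (t + d) + 2 ≤ Module.finrank K V) (hN : N + 2 ≤ 𝓕.ncard)
    (hdom : Dominates (Nat.card K) (Module.finrank K V) t d N) :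
    (∃ E ≤ U₁, dim E = t ∧ ∀ F ∈ 𝓕, F ≠ U₁ → F ≠ U₂ → E ≤ F) ∨
    (∃ E ≤ U₂, dim E = t ∧ ∀ F ∈ 𝓕, F ≠ U₁ → F ≠ U₂ → E ≤ F) := by
  by_contra! ⟨hstar₁, hstar₂⟩
  have hkn : t + d ≤ Module.finrank K V := by omega
  obtain ⟨E, hEU, hE⟩ := exists_le_dim_eq (h.dim_left.ge.trans' (Nat.le_add_right t d))
  obtain ⟨F, hF, hF₁, hF₂, -⟩ := hstar₁ E hEU hE
  obtain ⟨S, hSq, htS, hSk, hmin⟩ := h.exists_minimal_isQuasiCover ⟨F, hF, hF₁, hF₂⟩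
  obtain hS | hS | hS : dim S = t + 1 ∨ dim S = t + 2 ∨ t + 3 ≤ dim S := by omega
  · have hle := h.ncard_le_of_dim_eq_succ (by omega) hkn hS hSq.2.2
      (fun E hEU hE => by
        obtain ⟨F, hF, -, hF₂, hEF⟩ := hstar₁ E hEU hE
        exact ⟨F, hF, hF₂, hEF⟩)
      (fun E hEU hE => by
        obtain ⟨F, hF, hF₁, -, hEF⟩ := hstar₂ E hEU hE
        exact ⟨F, hF, hF₁, hEF⟩)
    rw [Nat.add_sub_cancel_left] at hle
    have := hdom.star
    linarith
  · exact h.not_minimal_isQuasiCover_add_two hd hkn hN hdom hS hSq (hS ▸ hmin)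
  · have hle := h.ncard_le_of_forall_not_isCover htS.le hSk hkn rfl hSq.2.2 hmin
    have hbound := minimal_cover_bound_le (Finite.one_lt_card (α := K)) hS hSk hn
    rw [Nat.add_sub_cancel_left] at hle hbound
    have := hdom.deep
    linarith

end IsBadPair

theorem exists_eq_familyH_of_add_two_le {k : ℕ} (ht : 2 ≤ t) (hk : t + 2 ≤ k)
    (hn : 2 * k + t + (if Nat.card K = 2 then 1 else 0) ≤ Module.finrank K V)
    (hmax : IsMaximumProperAlmost k t 𝓕) :
    ∃ U₁ ∈ subspaces K V k, ∃ U₂ ∈ subspaces K V k, ∃ E ∈ subspacesOf U₁ t,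
      U₁ ⊓ U₂ ∈ subspacesOf E (t - 1) ∧ 𝓕 = familyH k t U₁ U₂ E := by
  obtain ⟨d, rfl⟩ := Nat.exists_eq_add_of_le (show t ≤ k by omega)
  have hd : 2 ≤ d := by omega
  have hkn : t + d ≤ Module.finrank K V := by omega
  obtain ⟨N, hN, hdom⟩ := exists_dominates ht hd hn hmax
  have hfamily {U₁ U₂ E : Submodule K V} (h : IsBadPair (t + d) t 𝓕 U₁ U₂) (hEU : E ≤ U₁)
      (hE : dim E = t) (hstar : ∀ F ∈ 𝓕, F ≠ U₁ → F ≠ U₂ → E ≤ F) :=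
    h.eq_familyH hmax hE hEU (h.dim_inf_of_large_star hd hkn hN hdom hE hEU hstar) hstar
  obtain ⟨U₁, U₂, h⟩ := hmax.1.exists_isBadPair
  have hU₁ := mem_subspaces.2 h.dim_left
  have hU₂ := mem_subspaces.2 h.dim_right
  obtain ⟨E, hEU, hE, hstar⟩ | ⟨E, hEU, hE, hstar⟩ := h.exists_star_of_large hd (by omega) hN hdom
  · exact ⟨U₁, hU₁, U₂, hU₂, E, ⟨hEU, hE⟩, hfamily h hEU hE hstar⟩
  · exact ⟨U₂, hU₂, U₁, hU₁, E, ⟨hEU, hE⟩,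
      hfamily h.symm hEU hE fun F hF hF₂ hF₁ => hstar F hF hF₁ hF₂⟩

end LargeDimension

/-! ### The case `k = t + 1` -/

variable {t : ℕ} {𝓕 : Set (Submodule K V)} {U₁ U₂ U₃ U₄ : Submodule K V}

/-- The configurations of four `(t + 1)`-spaces which generate the families `familyG`: the pairs
`U₁, U₂` and `U₃, U₄` have the same `(t - 1)`-dimensional intersection, and each `Uᵢ` of the first
pair meets each `Uⱼ` of the second in dimension `t`. The equation `dim (U₁ ⊓ U₂) + 1 = t` avoids a
truncated subtraction. -/
structure IsGrid (t : ℕ) (U₁ U₂ U₃ U₄ : Submodule K V) : Prop where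
  dim₁ : dim U₁ = t + 1
  dim₂ : dim U₂ = t + 1
  dim₃ : dim U₃ = t + 1
  dim₄ : dim U₄ = t + 1
  inf_eq : U₁ ⊓ U₂ = U₃ ⊓ U₄
  dim_inf : dim (U₁ ⊓ U₂) + 1 = t
  dim₁₃ : dim (U₁ ⊓ U₃) = t
  dim₁₄ : dim (U₁ ⊓ U₄) = t
  dim₂₃ : dim (U₂ ⊓ U₃) = t
  dim₂₄ : dim (U₂ ⊓ U₄) = t

lemma ncard_insert_insert_of_notMem {α : Type*} [Finite α] {a b : α} {s : Set α} (hab : a ≠ b)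
    (ha : a ∉ s) (hb : b ∉ s) : (insert a (insert b s)).ncard = s.ncard + 2 := by
  rw [Set.ncard_insert_of_notMem (by simp [hab, ha]), Set.ncard_insert_of_notMem hb]

lemma sup_inf_cancel_of_le {A B : Submodule K V} (hW : U₁ ⊓ U₂ ≤ A) (hA : A ≤ U₁) (hB : B ≤ U₂) :
    (A ⊔ B) ⊓ U₁ = A := by
  rw [sup_inf_assoc_of_le B hA]
  exact sup_eq_left.2 ((le_inf inf_le_right (inf_le_left.trans hB)).trans hW)

lemma isProperAlmost_of_three_pairs {k : ℕ}
    {A A' B B' C C' : Submodule K V}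
    (hdim : ∀ F ∈ ({A, A', B, B', C, C'} : Set (Submodule K V)), dim F = k) (htk : t ≤ k)
    (hlt : dim (A ⊓ A') < t) (hB : ∀ F ∈ ({A, A'} : Set (Submodule K V)),
      t ≤ dim (F ⊓ B) ∧ t ≤ dim (F ⊓ B'))
    (hC : ∀ F ∈ ({A, A', B, B'} : Set (Submodule K V)), t ≤ dim (F ⊓ C) ∧ t ≤ dim (F ⊓ C')) :
    IsProperAlmost k t {A, A', B, B', C, C'} := by
  have hself (F) (hF : F ∈ ({A, A', B, B', C, C'} : Set (Submodule K V))) : t ≤ dim (F ⊓ F) := by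
    rwa [inf_idem, hdim F hF]
  simp only [Set.mem_insert_iff, Set.mem_singleton_iff, forall_eq_or_imp, forall_eq] at hB hC hself
  refine isProperAlmost_of_forall_lt_imp_eq hdim ?_ (by simp) (by simp) hlt
  rintro F (rfl | rfl | rfl | rfl | rfl | rfl)
  exacts [⟨A', by grind [inf_comm]⟩, ⟨A, by grind [inf_comm]⟩, ⟨B', by grind [inf_comm]⟩,
    ⟨B, by grind [inf_comm]⟩, ⟨C', by grind [inf_comm]⟩, ⟨C, by grind [inf_comm]⟩]

namespace IsGrid

lemma symm (h : IsGrid t U₁ U₂ U₃ U₄) : IsGrid t U₁ U₂ U₄ U₃ :=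
  ⟨h.dim₁, h.dim₂, h.dim₄, h.dim₃, h.inf_eq.trans (inf_comm _ _), h.dim_inf, h.dim₁₄, h.dim₁₃,
    h.dim₂₄, h.dim₂₃⟩

lemma dim_inf_right (h : IsGrid t U₁ U₂ U₃ U₄) : dim (U₃ ⊓ U₄) + 1 = t := h.inf_eq ▸ h.dim_inf

end IsGrid

lemma IsBadPair.le_dim_inf_of_mem_sdiff {k : ℕ} {F : Submodule K V}
    (h : IsBadPair k t 𝓕 U₁ U₂) (hF : F ∈ 𝓕 \ {U₁, U₂}) :
    t ≤ dim (F ⊓ U₁) ∧ t ≤ dim (F ⊓ U₂) :=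
  ⟨h.le_dim_inf_left hF.1 fun hF₂ => hF.2 (Or.inr hF₂),
    h.le_dim_inf_right hF.1 fun hF₁ => hF.2 (Or.inl hF₁)⟩

section FiniteDimensional

variable [FiniteDimensional K V]

namespace IsGrid

lemma dim_sup (h : IsGrid t U₁ U₂ U₃ U₄) : dim (U₃ ⊓ U₁ ⊔ U₄ ⊓ U₂) = t + 1 := by
  have hsum := dim_sup_add_dim_inf (U₃ ⊓ U₁) (U₄ ⊓ U₂)
  rw [inf_inf_inf_comm, ← h.inf_eq, inf_idem, inf_comm U₃, inf_comm U₄, h.dim₁₃, h.dim₂₄] at hsum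
  have hdim := h.dim_inf
  rw [inf_comm U₃, inf_comm U₄]
  omega

lemma le_dim_inf_sup (h : IsGrid t U₁ U₂ U₃ U₄) :
    ∀ F ∈ ({U₁, U₂, U₃, U₄} : Set (Submodule K V)), t ≤ dim (F ⊓ (U₃ ⊓ U₁ ⊔ U₄ ⊓ U₂)) := by
  have h₁₃ : t ≤ dim (U₃ ⊓ U₁) := by rw [inf_comm, h.dim₁₃]
  have h₂₄ : t ≤ dim (U₄ ⊓ U₂) := by rw [inf_comm, h.dim₂₄]
  rintro F (rfl | rfl | rfl | rfl)
  · exact h₁₃.trans (dim_mono (le_inf inf_le_right le_sup_left))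
  · exact h₂₄.trans (dim_mono (le_inf inf_le_right le_sup_right))
  · exact h₁₃.trans (dim_mono (le_inf inf_le_left le_sup_left))
  · exact h₂₄.trans (dim_mono (le_inf inf_le_left le_sup_right))

lemma sup_notMem (h : IsGrid t U₁ U₂ U₃ U₄) :
    U₃ ⊓ U₁ ⊔ U₄ ⊓ U₂ ∉ ({U₁, U₂, U₃, U₄} : Set (Submodule K V)) := by
  have hinf := h.dim_inf
  have hinf' := h.dim_inf_right
  have h₁₃ : dim (U₃ ⊓ U₁) = t := by rw [inf_comm, h.dim₁₃]
  have h₂₄ : dim (U₄ ⊓ U₂) = t := by rw [inf_comm, h.dim₂₄]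
  rintro (heq | heq | heq | heq)
  · have := dim_mono (le_inf (heq.le.trans' le_sup_right) inf_le_right : U₄ ⊓ U₂ ≤ U₁ ⊓ U₂)
    omega
  · have := dim_mono (le_inf inf_le_right (heq.le.trans' le_sup_left) : U₃ ⊓ U₁ ≤ U₁ ⊓ U₂)
    omega
  · have := dim_mono (le_inf (heq.le.trans' le_sup_right) inf_le_left : U₄ ⊓ U₂ ≤ U₃ ⊓ U₄)
    omega
  · have := dim_mono (le_inf inf_le_left (heq.le.trans' le_sup_left) : U₃ ⊓ U₁ ≤ U₃ ⊓ U₄)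
    omega

lemma sup_ne_sup (h : IsGrid t U₁ U₂ U₃ U₄) : U₃ ⊓ U₁ ⊔ U₄ ⊓ U₂ ≠ U₄ ⊓ U₁ ⊔ U₃ ⊓ U₂ := by
  intro heq
  have hsum := dim_sup_add_dim_inf (U₁ ⊓ U₃) (U₁ ⊓ U₄)
  have hle : dim (U₁ ⊓ U₃ ⊓ (U₁ ⊓ U₄)) ≤ dim (U₃ ⊓ U₄) :=
    dim_mono (inf_le_inf inf_le_right inf_le_right)
  have hinf := h.dim_inf_right
  have hsup : U₁ ⊓ U₃ ⊔ U₁ ⊓ U₄ = U₁ := eq_of_le_of_finrank_le (sup_le inf_le_left inf_le_left)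
    (show dim _ ≤ dim _ by rw [h.dim₁₃, h.dim₁₄] at hsum; rw [h.dim₁]; omega)
  have hU₁ : U₁ ≤ U₃ ⊓ U₁ ⊔ U₄ ⊓ U₂ := hsup.ge.trans (sup_le
    ((inf_comm U₁ U₃).le.trans le_sup_left)
    ((inf_comm U₁ U₄).le.trans (le_sup_left.trans heq.ge)))
  have heq₁ := eq_of_le_of_finrank_le hU₁ (show dim _ ≤ dim _ by rw [h.dim_sup, h.dim₁])
  exact h.sup_notMem (Or.inl heq₁.symm)

lemma isProperAlmost_familyG (h : IsGrid t U₁ U₂ U₃ U₄) :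
    IsProperAlmost (t + 1) t (familyG U₁ U₂ U₃ U₄) := by
  have hswap : ({U₁, U₂, U₃, U₄} : Set (Submodule K V)) = {U₁, U₂, U₄, U₃} := by
    rw [Set.pair_comm U₃]
  refine isProperAlmost_of_three_pairs ?_ (Nat.le_succ t) (by have := h.dim_inf; omega) ?_
    fun F hF => ⟨h.le_dim_inf_sup F hF, h.symm.le_dim_inf_sup F (hswap ▸ hF)⟩
  · rintro F (rfl | rfl | rfl | rfl | rfl | rfl)
    exacts [h.dim₁, h.dim₂, h.dim₃, h.dim₄, h.dim_sup, h.symm.dim_sup]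
  · rintro F (rfl | rfl)
    exacts [⟨h.dim₁₃.ge, h.dim₁₄.ge⟩, ⟨h.dim₂₃.ge, h.dim₂₄.ge⟩]

lemma ncard_familyG [Finite K] (h : IsGrid t U₁ U₂ U₃ U₄) : (familyG U₁ U₂ U₃ U₄).ncard = 6 := by
  have hne {A B : Submodule K V} {m : ℕ} (hm : m < t + 1) (hA : dim A = t + 1)
      (hAB : dim (A ⊓ B) = m) : A ≠ B := by
    rintro rfl
    rw [inf_idem] at hAB
    omega
  have hinf : dim (U₁ ⊓ U₂) < t + 1 := by have := h.dim_inf; omega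
  have h₁₃ := hne (Nat.lt_succ_self t) h.dim₁ h.dim₁₃
  have h₁₄ := hne (Nat.lt_succ_self t) h.dim₁ h.dim₁₄
  have h₂₃ := hne (Nat.lt_succ_self t) h.dim₂ h.dim₂₃
  have h₂₄ := hne (Nat.lt_succ_self t) h.dim₂ h.dim₂₄
  have hP := h.sup_notMem
  have hQ := h.symm.sup_notMem
  rw [familyG, ncard_insert_insert_of_notMem (hne hinf h.dim₁ rfl) (by grind) (by grind),
    ncard_insert_insert_of_notMem (hne (h.inf_eq ▸ hinf) h.dim₃ rfl) (by grind) (by grind),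
    Set.ncard_pair h.sup_ne_sup]

end IsGrid

section Existence

variable {A A' B B' : Submodule K V}

lemma dim_sup_of_mem_extensions (hA : A ∈ extensions (U₁ ⊓ U₂) U₁)
    (hB : B ∈ extensions (U₁ ⊓ U₂) U₂) : dim (A ⊔ B) = dim (U₁ ⊓ U₂) + 2 := by
  have hinf : A ⊓ B = U₁ ⊓ U₂ := le_antisymm (inf_le_inf hA.2.1 hB.2.1) (le_inf hA.1 hB.1)
  have hsum := dim_sup_add_dim_inf A B
  rw [hinf, hA.2.2, hB.2.2] at hsum
  omega

lemma sup_eq_of_mem_extensions {W U : Submodule K V} (hU : dim U = dim W + 2)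
    (hA : A ∈ extensions W U) (hA' : A' ∈ extensions W U) (hne : A ≠ A') : A ⊔ A' = U := by
  have hlt := lt_dim_sup_of_ne hne (hA.2.2.trans hA'.2.2.symm)
  rw [hA.2.2] at hlt
  exact eq_of_le_of_finrank_le (sup_le hA.2.1 hA'.2.1) (show dim _ ≤ dim _ by omega)

lemma isGrid_of_mem_extensions (hU₁ : dim U₁ = t + 1) (hU₂ : dim U₂ = t + 1)
    (hinf : dim (U₁ ⊓ U₂) + 1 = t) (hA : A ∈ extensions (U₁ ⊓ U₂) U₁)
    (hA' : A' ∈ extensions (U₁ ⊓ U₂) U₁) (hB : B ∈ extensions (U₁ ⊓ U₂) U₂)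
    (hB' : B' ∈ extensions (U₁ ⊓ U₂) U₂) (hAA' : A ≠ A') (hBB' : B ≠ B') :
    IsGrid t U₁ U₂ (A ⊔ B) (A' ⊔ B') := by
  have hdim (X Y : Submodule K V) (hX : X ∈ extensions (U₁ ⊓ U₂) U₁)
      (hY : Y ∈ extensions (U₁ ⊓ U₂) U₂) :
      dim (X ⊔ Y) = t + 1 ∧ dim (U₁ ⊓ (X ⊔ Y)) = t ∧ dim (U₂ ⊓ (X ⊔ Y)) = t := by
    refine ⟨by rw [dim_sup_of_mem_extensions hX hY, ← hinf], ?_, ?_⟩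
    · rw [inf_comm, sup_inf_cancel_of_le hX.1 hX.2.1 hY.2.1, hX.2.2, hinf]
    · rw [inf_comm, sup_comm, sup_inf_cancel_of_le (inf_comm U₁ U₂ ▸ hY.1) hY.2.1 hX.2.1, hY.2.2,
        hinf]
  obtain ⟨hAB, hAB₁, hAB₂⟩ := hdim A B hA hB
  obtain ⟨hAB', hAB₁', hAB₂'⟩ := hdim A' B' hA' hB'
  have hsup : A ⊔ B ⊔ (A' ⊔ B') = U₁ ⊔ U₂ := by
    rw [sup_sup_sup_comm, sup_eq_of_mem_extensions (by omega) hA hA' hAA',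
      sup_eq_of_mem_extensions (by omega) hB hB' hBB']
  have hsum := dim_sup_add_dim_inf U₁ U₂
  have hsum' := dim_sup_add_dim_inf (A ⊔ B) (A' ⊔ B')
  rw [hsup] at hsum'
  have hle : U₁ ⊓ U₂ ≤ (A ⊔ B) ⊓ (A' ⊔ B') :=
    le_inf (hA.1.trans le_sup_left) (hA'.1.trans le_sup_left)
  exact ⟨hU₁, hU₂, hAB, hAB', eq_of_le_of_finrank_le hle (show dim _ ≤ dim _ by omega), hinf, hAB₁,
    hAB₁', hAB₂, hAB₂'⟩

variable [Finite K]

lemma exists_ne_mem_extensions {W U : Submodule K V} (hWU : W ≤ U) (hU : dim U = dim W + 2) :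
    ∃ A ∈ extensions W U, ∃ A' ∈ extensions W U, A ≠ A' := by
  have hcard := ncard_extensions hWU
  rw [hU, Nat.add_sub_cancel_left, qInt_two] at hcard
  have hq := Finite.one_lt_card (α := K)
  obtain ⟨A, hA, A', hA', hne⟩ :=
    (Set.one_lt_ncard (Set.toFinite (extensions W U))).1 (by omega)
  exact ⟨A, hA, A', hA', hne⟩

lemma exists_isGrid (ht : 1 ≤ t) (hn : t + 3 ≤ Module.finrank K V) :
    ∃ U₁ U₂ U₃ U₄ : Submodule K V, IsGrid t U₁ U₂ U₃ U₄ := by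
  obtain ⟨U₁, U₂, -, hU₁, hU₂, -, -, -, hinf⟩ :=
    exists_familyH_spaces (K := K) (V := V) ht (Nat.le_succ t) (by omega)
  obtain ⟨A, hA, A', hA', hAA'⟩ := exists_ne_mem_extensions (W := U₁ ⊓ U₂) (U := U₁) inf_le_left
    (by omega)
  obtain ⟨B, hB, B', hB', hBB'⟩ := exists_ne_mem_extensions (W := U₁ ⊓ U₂) (U := U₂) inf_le_right
    (by omega)
  exact ⟨U₁, U₂, _, _, isGrid_of_mem_extensions hU₁ hU₂ hinf hA hA' hB hB' hAA' hBB'⟩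

lemma exists_isProperAlmost_card_add_three_le (ht : 1 ≤ t) (hn : t + 3 ≤ Module.finrank K V) :
    ∃ 𝓖 : Set (Submodule K V), IsProperAlmost (t + 1) t 𝓖 ∧ Nat.card K + 3 ≤ 𝓖.ncard := by
  obtain ⟨U₁, U₂, E, hU₁, hU₂, hE, hEU, hWE, hinf⟩ :=
    exists_familyH_spaces (K := K) (V := V) ht (Nat.le_succ t) (by omega)
  refine ⟨_, isProperAlmost_familyH hU₁ hU₂ hE hEU (by omega), ?_⟩
  have hEU₂ : E ⊓ U₂ = U₁ ⊓ U₂ :=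
    le_antisymm (inf_le_inf_right U₂ hEU) (le_inf hWE inf_le_right)
  have hsum := dim_sup_add_dim_inf E U₂
  rw [hEU₂] at hsum
  have hcard := ncard_extensions (le_sup_left : E ≤ E ⊔ U₂)
  rw [show dim (E ⊔ U₂) - dim E = 2 by omega, qInt_two] at hcard
  have hsub : extensions E (E ⊔ U₂) ⊆
      {F ∈ subspaces K V (t + 1) | E ≤ F ∧ t ≤ dim (F ⊓ U₂)} := by
    intro F ⟨hEF, hFE, hF⟩
    have hsumF := dim_sup_add_dim_inf F U₂
    have hle : dim (F ⊔ U₂) ≤ dim (E ⊔ U₂) := dim_mono (sup_le hFE le_sup_right)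
    exact ⟨mem_subspaces.2 (by omega), hEF, by omega⟩
  have hle := Set.ncard_le_ncard hsub
  rw [ncard_familyH hE hEU (by omega)]
  omega

end Existence

lemma inf_sup_inf_eq_of_dim_eq_succ {R : Submodule K V} (hlt : dim (U₁ ⊓ U₂) < t)
    (hR : dim R = t + 1) (h₁ : t ≤ dim (R ⊓ U₁)) (h₂ : t ≤ dim (R ⊓ U₂)) :
    R ⊓ U₁ ⊔ R ⊓ U₂ = R := by
  have hsum := dim_sup_add_dim_inf (R ⊓ U₁) (R ⊓ U₂)
  have hle : dim ((R ⊓ U₁) ⊓ (R ⊓ U₂)) ≤ dim (U₁ ⊓ U₂) :=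
    dim_mono (inf_le_inf inf_le_right inf_le_right)
  exact eq_of_le_of_finrank_le (sup_le inf_le_left inf_le_left) (show dim _ ≤ dim _ by omega)

namespace IsBadPair

variable {F : Submodule K V}

lemma dim_inf_of_mem_sdiff (h : IsBadPair (t + 1) t 𝓕 U₁ U₂) (hF : F ∈ 𝓕 \ {U₁, U₂}) :
    U₁ ⊓ U₂ ≤ F ∧ dim (U₁ ⊓ U₂) + 1 = t ∧ dim (F ⊓ U₁) = t ∧ dim (F ⊓ U₂) = t :=
  dim_inf_of_dim_eq_succ h.lt (h.dim_eq F hF.1) (h.le_dim_inf_of_mem_sdiff hF).1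
    (h.le_dim_inf_of_mem_sdiff hF).2

lemma inf_sup_inf_eq_of_mem_sdiff (h : IsBadPair (t + 1) t 𝓕 U₁ U₂) (hF : F ∈ 𝓕 \ {U₁, U₂}) :
    F ⊓ U₁ ⊔ F ⊓ U₂ = F :=
  inf_sup_inf_eq_of_dim_eq_succ h.lt (h.dim_eq F hF.1) (h.le_dim_inf_of_mem_sdiff hF).1
    (h.le_dim_inf_of_mem_sdiff hF).2

lemma inf_eq_or_inf_eq (h : IsBadPair (t + 1) t 𝓕 U₁ U₂) {F' : Submodule K V}
    (hF : F ∈ 𝓕 \ {U₁, U₂}) (hF' : F' ∈ 𝓕 \ {U₁, U₂}) (hFF' : t ≤ dim (F ⊓ F')) :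
    F ⊓ U₁ = F' ⊓ U₁ ∨ F ⊓ U₂ = F' ⊓ U₂ :=
  have ⟨h₁, h₂⟩ := h.le_dim_inf_of_mem_sdiff hF
  have ⟨h₁', h₂'⟩ := h.le_dim_inf_of_mem_sdiff hF'
  inf_eq_or_inf_eq_of_dim_eq_succ h.lt (h.dim_eq F hF.1) (h.dim_eq F' hF'.1) h₁ h₂ h₁' h₂' hFF'

lemma isGrid (h : IsBadPair (t + 1) t 𝓕 U₁ U₂) (h' : IsBadPair (t + 1) t 𝓕 U₃ U₄)
    (hU₃ : U₃ ∈ 𝓕 \ {U₁, U₂}) (hU₄ : U₄ ∈ 𝓕 \ {U₁, U₂}) : IsGrid t U₁ U₂ U₃ U₄ := by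
  obtain ⟨hle₃, hinf, h₃₁, h₃₂⟩ := h.dim_inf_of_mem_sdiff hU₃
  obtain ⟨hle₄, -, h₄₁, h₄₂⟩ := h.dim_inf_of_mem_sdiff hU₄
  have hlt := h'.lt
  have heq : U₁ ⊓ U₂ = U₃ ⊓ U₄ :=
    eq_of_le_of_finrank_le (le_inf hle₃ hle₄) (show dim _ ≤ dim _ by omega)
  rw [inf_comm] at h₃₁ h₃₂ h₄₁ h₄₂
  exact ⟨h.dim_left, h.dim_right, h'.dim_left, h'.dim_right, heq, hinf, h₃₁, h₄₁, h₃₂, h₄₂⟩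

lemma subset_familyG (h : IsBadPair (t + 1) t 𝓕 U₁ U₂) (h' : IsBadPair (t + 1) t 𝓕 U₃ U₄)
    (hU₃ : U₃ ∈ 𝓕 \ {U₁, U₂}) (hU₄ : U₄ ∈ 𝓕 \ {U₁, U₂}) : 𝓕 ⊆ familyG U₁ U₂ U₃ U₄ := by
  have hne (X : Submodule K V) (hX : t ≤ dim (U₃ ⊓ X)) : U₃ ⊓ X ≠ U₄ ⊓ X := fun heq =>
    h'.lt.not_ge (hX.trans (dim_mono (le_inf inf_le_left (heq.le.trans inf_le_left))))
  obtain ⟨hU₃₁, hU₃₂⟩ := h.le_dim_inf_of_mem_sdiff hU₃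
  intro F hF
  by_cases hF₁₂ : F ∈ ({U₁, U₂} : Set (Submodule K V))
  · exact hF₁₂.imp_right Or.inl
  by_cases hF₃ : F = U₃
  · simp [familyG, hF₃]
  by_cases hF₄ : F = U₄
  · simp [familyG, hF₄]
  have hsup := h.inf_sup_inf_eq_of_mem_sdiff ⟨hF, hF₁₂⟩
  have heq₃ := h.inf_eq_or_inf_eq ⟨hF, hF₁₂⟩ hU₃ (h'.le_dim_inf_left hF hF₄)
  have heq₄ := h.inf_eq_or_inf_eq ⟨hF, hF₁₂⟩ hU₄ (h'.le_dim_inf_right hF hF₃)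
  obtain heq₃ | heq₃ := heq₃ <;> obtain heq₄ | heq₄ := heq₄
  · exact (hne U₁ hU₃₁ (heq₃.symm.trans heq₄)).elim
  · rw [heq₃, heq₄] at hsup
    simp [familyG, ← hsup]
  · rw [heq₃, heq₄] at hsup
    simp [familyG, ← hsup]
  · exact (hne U₂ hU₃₂ (heq₃.symm.trans heq₄)).elim

variable [Finite K]

lemma ncard_le_card_add_three_of_star (h : IsBadPair (t + 1) t 𝓕 U₁ U₂) {E : Submodule K V}
    (hE : dim E = t) (hEU : E ≤ U₁) (hEU₂ : dim (E ⊓ U₂) + 1 = t)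
    (hstar : ∀ F ∈ 𝓕 \ {U₁, U₂}, E ≤ F) : 𝓕.ncard ≤ Nat.card K + 3 := by
  have hsum := dim_sup_add_dim_inf E U₂
  have hU₂ := h.dim_right
  have hcard := ncard_extensions (le_sup_left : E ≤ E ⊔ U₂)
  rw [show dim (E ⊔ U₂) - dim E = 2 by omega, qInt_two] at hcard
  have hsub : 𝓕 \ {U₁, U₂} ⊆ extensions E (E ⊔ U₂) := by
    intro F hF
    have hFE : E = F ⊓ U₁ := eq_of_le_of_finrank_le (le_inf (hstar F hF) hEU)
      ((h.dim_inf_of_mem_sdiff hF).2.2.1.trans hE.symm).le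
    refine ⟨hstar F hF, ?_, by rw [h.dim_eq F hF.1, hE]⟩
    rw [← h.inf_sup_inf_eq_of_mem_sdiff hF, ← hFE]
    exact sup_le_sup_left inf_le_right E
  have hle := Set.ncard_le_ncard hsub
  have hpair := ncard_le_ncard_sdiff_pair_add_two 𝓕 U₁ U₂
  omega

lemma exists_eq_familyH_of_inf_eq (h : IsBadPair (t + 1) t 𝓕 U₁ U₂)
    (hmax : IsMaximumProperAlmost (t + 1) t 𝓕) (hF : F ∈ 𝓕 \ {U₁, U₂})
    (heq : ∀ F' ∈ 𝓕 \ {U₁, U₂}, F ⊓ U₁ = F' ⊓ U₁) :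
    𝓕.ncard ≤ Nat.card K + 3 ∧ ∃ E ∈ subspacesOf U₁ t,
      U₁ ⊓ U₂ ∈ subspacesOf E (t - 1) ∧ 𝓕 = familyH (t + 1) t U₁ U₂ E := by
  obtain ⟨hle, hinf, hFU₁, -⟩ := h.dim_inf_of_mem_sdiff hF
  have hFU₂ : dim ((F ⊓ U₁) ⊓ U₂) + 1 = t := by rwa [inf_assoc, inf_eq_right.2 hle]
  have hstar : ∀ F' ∈ 𝓕 \ {U₁, U₂}, F ⊓ U₁ ≤ F' := fun F' hF' =>
    (heq F' hF').le.trans inf_le_left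
  exact ⟨h.ncard_le_card_add_three_of_star hFU₁ inf_le_right hFU₂ hstar, F ⊓ U₁,
    ⟨inf_le_right, hFU₁⟩, h.eq_familyH hmax hFU₁ inf_le_right hFU₂
      fun F' hF' hF₁ hF₂ => hstar F' ⟨hF', by simp [hF₁, hF₂]⟩⟩

lemma exists_eq_familyH_of_forall_le_dim_inf (h : IsBadPair (t + 1) t 𝓕 U₁ U₂)
    (hmax : IsMaximumProperAlmost (t + 1) t 𝓕) (hne : (𝓕 \ {U₁, U₂}).Nonempty)
    (hint : ∀ F ∈ 𝓕 \ {U₁, U₂}, ∀ F' ∈ 𝓕 \ {U₁, U₂}, t ≤ dim (F ⊓ F')) :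
    𝓕.ncard ≤ Nat.card K + 3 ∧ ∃ U₁ ∈ subspaces K V (t + 1), ∃ U₂ ∈ subspaces K V (t + 1),
      ∃ E ∈ subspacesOf U₁ t,
        U₁ ⊓ U₂ ∈ subspacesOf E (t - 1) ∧ 𝓕 = familyH (t + 1) t U₁ U₂ E := by
  obtain ⟨F, hF⟩ := hne
  have hU₁ := mem_subspaces.2 h.dim_left
  have hU₂ := mem_subspaces.2 h.dim_right
  obtain heq | heq := forall_eq_or_forall_eq (f := (· ⊓ U₁)) (g := (· ⊓ U₂))
    fun F hF F' hF' => h.inf_eq_or_inf_eq hF hF' (hint F hF F' hF')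
  · exact (h.exists_eq_familyH_of_inf_eq hmax hF (heq F hF)).imp_right
      fun hE => ⟨U₁, hU₁, U₂, hU₂, hE⟩
  · rw [Set.pair_comm] at hF heq
    exact (h.symm.exists_eq_familyH_of_inf_eq hmax hF (heq F hF)).imp_right
      fun hE => ⟨U₂, hU₂, U₁, hU₁, hE⟩

end IsBadPair

theorem exists_eq_familyH_or_exists_eq_familyG [Finite K] (ht : 1 ≤ t)
    (hn : t + 3 ≤ Module.finrank K V) (hmax : IsMaximumProperAlmost (t + 1) t 𝓕) :
    (3 ≤ Nat.card K ∧
      ∃ U₁ ∈ subspaces K V (t + 1), ∃ U₂ ∈ subspaces K V (t + 1), ∃ E ∈ subspacesOf U₁ t,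
        U₁ ⊓ U₂ ∈ subspacesOf E (t - 1) ∧ 𝓕 = familyH (t + 1) t U₁ U₂ E) ∨
    (Nat.card K ≤ 3 ∧
      ∃ U₁ U₂ U₃ U₄ : Submodule K V, IsGrid t U₁ U₂ U₃ U₄ ∧ 𝓕 = familyG U₁ U₂ U₃ U₄) := by
  obtain ⟨X₁, X₂, X₃, X₄, hX⟩ := exists_isGrid (K := K) (V := V) ht hn
  have hsix : 6 ≤ 𝓕.ncard := hX.ncard_familyG ▸ hmax.2 _ hX.isProperAlmost_familyG
  obtain ⟨𝓗, h𝓗, hcard⟩ := exists_isProperAlmost_card_add_three_le (K := K) (V := V) ht hn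
  have hcard' := hcard.trans (hmax.2 _ h𝓗)
  obtain ⟨U₁, U₂, h⟩ := hmax.1.exists_isBadPair
  have hne : (𝓕 \ {U₁, U₂}).Nonempty := by
    have hpair := ncard_le_ncard_sdiff_pair_add_two 𝓕 U₁ U₂
    exact Set.nonempty_of_ncard_ne_zero (by omega)
  by_cases hint : ∀ F ∈ 𝓕 \ {U₁, U₂}, ∀ F' ∈ 𝓕 \ {U₁, U₂}, t ≤ dim (F ⊓ F')
  · obtain ⟨hle, hH⟩ := h.exists_eq_familyH_of_forall_le_dim_inf hmax hne hint
    exact Or.inl ⟨by omega, hH⟩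
  · push Not at hint
    obtain ⟨U₃, hU₃, U₄, hU₄, hlt⟩ := hint
    have h' : IsBadPair (t + 1) t 𝓕 U₃ U₄ := ⟨h.dim_eq, h.almost, hU₃.1, hU₄.1, hlt⟩
    have hgrid := h.isGrid h' hU₃ hU₄
    have heq := Set.eq_of_subset_of_ncard_le (h.subset_familyG h' hU₃ hU₄)
      (hgrid.ncard_familyG.trans_le hsix)
    rw [heq, hgrid.ncard_familyG] at hcard'
    exact Or.inr ⟨by omega, U₁, U₂, U₃, U₄, hgrid, heq⟩

end FiniteDimensional

end AlmostIntersecting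

theorem theorem1p4 {K V : Type*} [Field K] [Finite K] [AddCommGroup V] [Module K V]
    [FiniteDimensional K V] (q n k t : ℕ)
    (hq : Nat.card K = q) (hn : Module.finrank K V = n)
    (hkt : t + 1 ≤ k) (ht : 3 ≤ t + 1)
    (hbound : 2 * (k : ℤ) + t + AlmostIntersecting.delta 2 q
      + AlmostIntersecting.delta k (t + 1) * (1 - 2 * (t : ℤ) - AlmostIntersecting.delta 2 q)
        ≤ (n : ℤ))
    (𝓕 : Set (Submodule K V)) (h𝓕 : AlmostIntersecting.IsMaximumProperAlmost k t 𝓕) :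
    ((k, q) ≠ (t + 1, 2) ∧
      ∃ U₁ ∈ AlmostIntersecting.subspaces K V k, ∃ U₂ ∈ AlmostIntersecting.subspaces K V k,
      ∃ E ∈ AlmostIntersecting.subspacesOf U₁ t,
        U₁ ⊓ U₂ ∈ AlmostIntersecting.subspacesOf E (t - 1) ∧
        𝓕 = AlmostIntersecting.familyH k t U₁ U₂ E) ∨
    (((k, q) = (t + 1, 2) ∨ (k, q) = (t + 1, 3)) ∧
      ∃ U₁ ∈ AlmostIntersecting.subspaces K V (t + 1),
      ∃ U₂ ∈ AlmostIntersecting.subspaces K V (t + 1),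
      ∃ U₃ ∈ AlmostIntersecting.subspaces K V (t + 1),
      ∃ U₄ ∈ AlmostIntersecting.subspaces K V (t + 1),
        U₁ ⊓ U₂ = U₃ ⊓ U₄ ∧ U₁ ⊓ U₂ ∈ AlmostIntersecting.subspaces K V (t - 1) ∧
        Module.finrank K ↥(U₁ ⊓ U₃) = t ∧ Module.finrank K ↥(U₁ ⊓ U₄) = t ∧
        Module.finrank K ↥(U₂ ⊓ U₃) = t ∧ Module.finrank K ↥(U₂ ⊓ U₄) = t ∧
        𝓕 = AlmostIntersecting.familyG U₁ U₂ U₃ U₄) := by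
  subst hq hn
  have hcard := Finite.one_lt_card (α := K)
  rcases hkt.eq_or_lt with rfl | hk
  · have hn : t + 3 ≤ Module.finrank K V := by
      rw [AlmostIntersecting.delta, AlmostIntersecting.delta, if_pos rfl] at hbound
      push_cast at hbound
      omega
    rcases AlmostIntersecting.exists_eq_familyH_or_exists_eq_familyG (by omega) hn h𝓕 with
      ⟨hq, hH⟩ | ⟨hq, U₁, U₂, U₃, U₄, h, h𝓕⟩
    · exact Or.inl ⟨by simp only [ne_eq, Prod.mk.injEq]; omega, hH⟩
    · have hinf : Module.finrank K ↥(U₁ ⊓ U₂) = t - 1 := Nat.eq_sub_of_add_eq h.dim_inf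
      refine Or.inr ⟨by simp only [Prod.mk.injEq, true_and]; omega, ?_⟩
      simp only [AlmostIntersecting.mem_subspaces]
      exact ⟨U₁, h.dim₁, U₂, h.dim₂, U₃, h.dim₃, U₄, h.dim₄, h.inf_eq, hinf, h.dim₁₃, h.dim₁₄,
        h.dim₂₃, h.dim₂₄, h𝓕⟩
  · have hn : 2 * k + t + (if Nat.card K = 2 then 1 else 0) ≤ Module.finrank K V := by
      rw [AlmostIntersecting.delta, AlmostIntersecting.delta, if_neg hk.ne'] at hbound
      split_ifs at hbound ⊢ <;> omega
    exact Or.inl ⟨by simp only [ne_eq, Prod.mk.injEq]; omega,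
      AlmostIntersecting.exists_eq_familyH_of_add_two_le (by omega) hk hn h𝓕⟩
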